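/- Conventions. A $C^\infty$-ring is a set $\mathfrak C$ with operations $\Phi_f:\mathfrak C^n\to\mathfrak C$ for all smooth $f:\mathbb R^n\to\mathbb R$, $n\ge 0$, compatible with composition and with the coordinate projections. It is finitely generated if there are $c_1,\dots,c_n\in\mathfrak C$ such that every element is of the form $\Phi_f(c_1,\dots,c_n)$. It is fair if $\mathfrak C\cong C^\infty(\mathbb R^n)/I$ for an ideal $I$ such that $f\in I$ whenever at each $p\in\mathbb R^n$ the germ of $f$ is the germ of an element of $I$. It is good if $\mathfrak C\cong C^\infty(\mathbb R^n)/I$ with $I$ generated by finitely many functions together with all functions that vanish to infinite order along some closed $Z\subseteq\mathbb R^n$. The spectrum $\operatorname{Spec}\mathfrak C$ is the set of $\mathbb R$-points $x:\mathfrak C\to\mathbb R$ with the coarsest topology making all $x\mapsto x(c)$ continuous, with the sheaf $\mathcal O$ of families of elements of the localizations $\mathfrak C_x$ that are locally of the form $\pi_x(c)\pi_x(d)^{-1}$. A fair affine $C^\infty$-scheme is a $C^\infty$-ringed space isomorphic to $\operatorname{Spec}\mathfrak C$ with $\mathfrak C$ fair; a locally good $C^\infty$-scheme is one covered by open subspaces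 isomorphic to $\operatorname{Spec}\mathfrak C$ with $\mathfrak C$ good. The cotangent module $\Omega_{\mathfrak C}$ is the $\mathfrak C$-module generated by symbols $dc$, $c\in\mathfrak C$, with relations $d\Phi_f(c_1,\dots,c_n)=\sum_i\Phi_{\partial f/\partial x_i}(c_1,\dots,c_n)\,dc_i$. For a $\mathfrak C$-module $M$, $\operatorname{MSpec}M$ is the sheafification of $U\mapsto M\otimes_{\mathfrak C}\mathcal O(U)$ on $\operatorname{Spec}\mathfrak C$. For a $C^\infty$-ringed space $\underline X=(X,\mathcal O_X)$ the cotangent presheaf $\mathcal PT^*\underline X$ is $U\mapsto\Omega_{\mathcal O_X(U)}$, and the cotangent sheaf $T^*\underline X$ is its sheafification. A sheaf of $\mathcal O_X$-modules $\mathcal E$ is coherent if $X$ is covered by open $U$ with $(U,\mathcal O_X|_U)\cong\operatorname{Spec}\mathfrak C$, identifying $\mathcal E|_U$ with $\operatorname{MSpec}M$ for a finitely presented $\mathfrak C$-module $M$, and it is a vector bundle of rank $n$ if $X$ is covered by open $U$ with $\mathcal E|_U\cong\mathcal O_X|_U\otimes_{\mathbb R}\mathbb R^n$. Manifolds are smooth,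 Hausdorff and second countable. Theorem. (a) Let $\mathfrak C$ be a finitely generated $C^\infty$-ring and $\underline X=\operatorname{Spec}\mathfrak C$. Then there is a canonical isomorphism of sheaves of $\mathcal O_X$-modules $T^*\underline X\cong\operatorname{MSpec}\Omega_{\mathfrak C}$, which over each open $U$ takes the differential of the section of $\mathcal O_X(U)$ defined by $c\in\mathfrak C$ to the section defined by $dc\in\Omega_{\mathfrak C}$. (b) Let $\underline X$ be a fair affine $C^\infty$-scheme. Then $\mathcal PT^*\underline X$ is a sheaf, so that the canonical morphism $\mathcal PT^*\underline X\to T^*\underline X$ is an isomorphism and $(T^*\underline X)(U)\cong\Omega_{\mathcal O_X(U)}$ for all open $U\subseteq X$. (c) Let $\underline X$ be a locally good $C^\infty$-scheme. Then $T^*\underline X$ is a coherent sheaf. (d) Let $X$ be an $n$-manifold, possibly with boundary or corners, that is, locally modelled on $\mathbb R^n_k:=[0,\infty)^k\times\mathbb R^{n-k}$ for some $0\le k\le n$, and let $\underline X=\operatorname{Spec}C^\infty(X)$ be the associated $C^\infty$-scheme, which is canonically isomorphic to $X$ with its sheaf of smooth functions $U\mapsto C^\infty(U)$. Then $T^*\underline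 X$ is a vector bundle of rank $n$ on $\underline X$, and under this identification there are isomorphisms $(T^*\underline X)(U)\cong C^\infty(T^*X|_U)$ for all open $U\subseteq X$, linear over $C^\infty(U)$, compatible with restriction, and taking the differential of a smooth function on $X$ to its usual differential. When $X=\mathbb R^n_k$ with $0\le k\le n$ there is an isomorphism $T^*(\underline{\mathbb R^n_k})\cong\mathcal O_{\mathbb R^n_k}\otimes_{\mathbb R}(\mathbb R^n)^*$, which takes the differential of the restriction of a linear form $\lambda$ to $1\otimes\lambda$. -/

import Mathlib

open scoped ContDiff Manifold Topology TensorProduct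

universe u v

noncomputable section

namespace CInf

/-! ### Smooth functions on `ℝⁿ` -/

/-- The `ℝ`-algebra `C^∞(ℝⁿ)` of smooth functions `ℝⁿ → ℝ`. -/
def smoothSubalgebra (n : ℕ) : Subalgebra ℝ ((Fin n → ℝ) → ℝ) where
  carrier := {f | ContDiff ℝ ∞ f}
  mul_mem' hf hg := by
    rw [Set.mem_ofPred_eq] at *
    exact hf.mul hg
  add_mem' hf hg := by
    rw [Set.mem_ofPred_eq] at *
    exact hf.add hg
  algebraMap_mem' r := by
    rw [Set.mem_ofPred_eq]
    exact contDiff_const (c := r)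

/-- The type `C^∞(ℝⁿ)`. -/
abbrev SmoothFn (n : ℕ) : Type := ↥(smoothSubalgebra n)

namespace SmoothFn

theorem mem_iff {n : ℕ} {f : (Fin n → ℝ) → ℝ} : f ∈ smoothSubalgebra n ↔ ContDiff ℝ ∞ f :=
  Iff.of_eq Set.mem_ofPred_eq

theorem smooth {n : ℕ} (f : SmoothFn n) : ContDiff ℝ ∞ f.1 := mem_iff.1 f.2

/-- The coordinate function `x ↦ x j`. -/
def proj {n : ℕ} (j : Fin n) : SmoothFn n :=
  ⟨fun x => x j, mem_iff.2 (contDiff_apply ℝ ℝ j)⟩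

/-- The composite `x ↦ g (f₁ x, …, f_m x)`. -/
def comp {m n : ℕ} (g : SmoothFn m) (f : Fin m → SmoothFn n) : SmoothFn n :=
  ⟨fun x => g.1 fun i => (f i).1 x, mem_iff.2 (g.smooth.comp (contDiff_pi.2 fun i => (f i).smooth))⟩

/-- The partial derivative `∂f/∂xᵢ`. -/
def pderiv {n : ℕ} (f : SmoothFn n) (i : Fin n) : SmoothFn n :=
  ⟨fun x => fderiv ℝ f.1 x (Pi.single i 1),
    mem_iff.2 ((f.smooth.fderiv_right (m := ∞) (by simp)).clm_apply contDiff_const)⟩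

end SmoothFn

/-! ### `C^∞`-rings -/

/-- A `C^∞`-ring: a set `C` with an operation `Φ_f : Cⁿ → C` for every smooth `f : ℝⁿ → ℝ`,
compatible with composition and projections. As usual in Mathlib, the induced commutative
`ℝ`-algebra structure is recorded together with the operations; by `op_add`, `op_mul` and
`op_const` it is the one that the operations determine. -/
class CInfRing (C : Type u) extends CommRing C, Algebra ℝ C where
  /-- the operation `Φ_f` -/
  op : ∀ {n : ℕ}, SmoothFn n → (Fin n → C) → C
  op_comp : ∀ {m n : ℕ} (g : SmoothFn m) (f : Fin m → SmoothFn n) (c : Fin n → C),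
    op (g.comp f) c = op g fun i => op (f i) c
  op_proj : ∀ {n : ℕ} (j : Fin n) (c : Fin n → C), op (SmoothFn.proj j) c = c j
  op_add : ∀ a b : C, op (SmoothFn.proj 0 + SmoothFn.proj 1 : SmoothFn 2) ![a, b] = a + b
  op_mul : ∀ a b : C, op (SmoothFn.proj 0 * SmoothFn.proj 1 : SmoothFn 2) ![a, b] = a * b
  op_const : ∀ r : ℝ, op (r • (1 : SmoothFn 0)) ![] = r • (1 : C)

/-- A morphism of `C^∞`-rings: a map commuting with all operations `Φ_f` (and hence a morphism of
`ℝ`-algebras). -/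
structure CInfHom (C : Type u) (D : Type v) [CInfRing C] [CInfRing D] extends C →ₐ[ℝ] D where
  map_op' : ∀ {n : ℕ} (f : SmoothFn n) (c : Fin n → C),
    toFun (CInfRing.op f c) = CInfRing.op f fun i => toFun (c i)

/-- An isomorphism of `C^∞`-rings. -/
structure CInfEquiv (C : Type u) (D : Type v) [CInfRing C] [CInfRing D] extends C ≃ₐ[ℝ] D where
  map_op' : ∀ {n : ℕ} (f : SmoothFn n) (c : Fin n → C),
    toFun (CInfRing.op f c) = CInfRing.op f fun i => toFun (c i)

instance {C : Type u} {D : Type v} [CInfRing C] [CInfRing D] :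
    CoeFun (CInfHom C D) fun _ => C → D := ⟨fun φ => φ.toAlgHom⟩

instance {C : Type u} {D : Type v} [CInfRing C] [CInfRing D] :
    CoeFun (CInfEquiv C D) fun _ => C → D := ⟨fun φ => φ.toAlgEquiv⟩

theorem CInfHom.map_op {C : Type u} {D : Type v} [CInfRing C] [CInfRing D] (φ : CInfHom C D)
    {n : ℕ} (f : SmoothFn n) (c : Fin n → C) :
    φ (CInfRing.op f c) = CInfRing.op f fun i => φ (c i) := φ.map_op' f c

theorem CInfHom.ext {C : Type u} {D : Type v} [CInfRing C] [CInfRing D] {φ ψ : CInfHom C D}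
    (h : ∀ c, φ c = ψ c) : φ = ψ := by
  cases φ; cases ψ; congr 1; exact AlgHom.ext h

namespace CInfRing

section evalHom

variable {C : Type u} [CInfRing C] {n : ℕ} (c : Fin n → C)

theorem op_add' (f g : SmoothFn n) : op (f + g) c = op f c + op g c := by
  have h : f + g = (SmoothFn.proj 0 + SmoothFn.proj 1 : SmoothFn 2).comp ![f, g] := rfl
  rw [h, op_comp, ← op_add]
  congr 1
  funext i
  fin_cases i <;> rfl

theorem op_mul' (f g : SmoothFn n) : op (f * g) c = op f c * op g c := by
  have h : f * g = (SmoothFn.proj 0 * SmoothFn.proj 1 : SmoothFn 2).comp ![f, g] := rfl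
  rw [h, op_comp, ← op_mul]
  congr 1
  funext i
  fin_cases i <;> rfl

theorem op_algebraMap (r : ℝ) : op (algebraMap ℝ (SmoothFn n) r) c = algebraMap ℝ C r := by
  have h : algebraMap ℝ (SmoothFn n) r = (r • (1 : SmoothFn 0)).comp ![] := by
    rw [Algebra.algebraMap_eq_smul_one]; rfl
  rw [h, op_comp, Algebra.algebraMap_eq_smul_one, ← op_const]
  congr 1
  funext i
  exact i.elim0

/-- The `ℝ`-algebra morphism `C^∞(ℝⁿ) → C`, `f ↦ Φ_f(c₁, …, c_n)`. -/
def evalHom : SmoothFn n →ₐ[ℝ] C where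
  toFun f := op f c
  map_one' := by simpa using op_algebraMap c 1
  map_mul' := op_mul' c
  map_zero' := by simpa using op_algebraMap c 0
  map_add' := op_add' c
  commutes' := op_algebraMap c

theorem evalHom_apply (f : SmoothFn n) : evalHom c f = op f c := rfl

end evalHom

end CInfRing

open CInfRing

/-- `ℝ` as a `C^∞`-ring. -/
instance : CInfRing ℝ where
  op f c := f.1 c
  op_comp _ _ _ := rfl
  op_proj _ _ := rfl
  op_add _ _ := rfl
  op_mul _ _ := rfl
  op_const _ := rfl

/-- `C^∞(ℝⁿ)` as a `C^∞`-ring. -/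
instance (n : ℕ) : CInfRing (SmoothFn n) where
  op f c := f.comp c
  op_comp _ _ _ := rfl
  op_proj _ _ := rfl
  op_add _ _ := rfl
  op_mul _ _ := rfl
  op_const _ := rfl

/-- Products of `C^∞`-rings, with pointwise operations. -/
instance {ι : Type v} (A : ι → Type u) [∀ i, CInfRing (A i)] : CInfRing (∀ i, A i) where
  op f c := fun i => op f fun j => c j i
  op_comp g f c := by funext i; exact op_comp g f _
  op_proj j c := by funext i; exact op_proj j _
  op_add a b := by
    funext i
    exact (congrArg (op _) (by funext j; fin_cases j <;> rfl)).trans (op_add (a i) (b i))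
  op_mul a b := by
    funext i
    exact (congrArg (op _) (by funext j; fin_cases j <;> rfl)).trans (op_mul (a i) (b i))
  op_const r := by
    funext i
    exact (congrArg (op _) (by funext j; exact j.elim0)).trans (op_const r)

/-! ### Quotients -/

/-- Hadamard's lemma: `f y - f x = ∑ᵢ (yᵢ - xᵢ) gᵢ(x, y)` with smooth `gᵢ`. -/
theorem SmoothFn.hadamard {n : ℕ} (f : SmoothFn n) :
    ∃ g : Fin n → SmoothFn (n + n),
      f.comp (fun i => SmoothFn.proj (Fin.natAdd n i)) -
        f.comp (fun i => SmoothFn.proj (Fin.castAdd n i)) =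
      ∑ i, (SmoothFn.proj (Fin.natAdd n i) - SmoothFn.proj (Fin.castAdd n i)) * g i := by
  classical
  let P := Fin (n + n) → ℝ
  let b : ContDiffBump (0 : ℝ) := ⟨2, 3, by norm_num, by norm_num⟩
  let pt : P → ℝ → (Fin n → ℝ) := fun p t i =>
    p (Fin.castAdd n i) + t * (p (Fin.natAdd n i) - p (Fin.castAdd n i))
  let χ : ℝ → ℝ := Set.indicator (Set.Icc 0 1) fun _ => 1
  let G : Fin n → P → ℝ → ℝ := fun i p t => b t * (f.pderiv i).1 (pt p (-t))
  have hpt : ContDiff ℝ ∞ (fun q : P × ℝ => pt q.1 (-q.2)) := by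
    refine contDiff_pi.2 fun i => ?_
    simp only [pt]
    have h1 : ∀ j : Fin (n + n), ContDiff ℝ ∞ (fun q : P × ℝ => q.1 j) := fun j =>
      (contDiff_apply ℝ ℝ j).comp contDiff_fst
    exact (h1 _).add (contDiff_snd.neg.mul ((h1 _).sub (h1 _)))
  have hG : ∀ i, ContDiff ℝ ∞ (fun q : P × ℝ => G i q.1 q.2) := fun i =>
    ((b.contDiff (n := ⊤)).comp contDiff_snd).mul ((f.pderiv i).smooth.comp hpt)
  have hχ : MeasureTheory.LocallyIntegrable χ MeasureTheory.volume := by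
    refine MeasureTheory.Integrable.locallyIntegrable ?_
    refine (MeasureTheory.integrable_indicator_iff measurableSet_Icc).2 ?_
    exact MeasureTheory.integrableOn_const (by simp) (by simp)
  let S : Fin n → P → ℝ := fun i p => ∫ t in (0 : ℝ)..1, (f.pderiv i).1 (pt p t)
  have hS : ∀ i, ContDiff ℝ ∞ (S i) := by
    intro i
    have := MeasureTheory.contDiffOn_convolution_right_with_param_comp (𝕜 := ℝ) (μ := MeasureTheory.volume)
      (n := ⊤) (ContinuousLinearMap.mul ℝ ℝ) (s := (Set.univ : Set P)) (v := fun _ => (0 : ℝ))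
      contDiffOn_const (f := χ) (g := G i) (k := Metric.closedBall 0 3) isOpen_univ
      (isCompact_closedBall _ _) (by
        intro p t _ ht
        have : b t = 0 := b.zero_of_le_dist (by rw [Metric.mem_closedBall, not_le] at ht; exact ht.le)
        simp [G, this]) hχ (hG i).contDiffOn
    rw [contDiffOn_univ] at this
    convert this using 2 with p
    simp only [S, MeasureTheory.convolution, ContinuousLinearMap.mul_apply', zero_sub]
    rw [intervalIntegral.integral_of_le zero_le_one, ← MeasureTheory.integral_Icc_eq_integral_Ioc,
      ← MeasureTheory.integral_indicator measurableSet_Icc]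
    congr 1
    funext t
    by_cases ht : t ∈ Set.Icc (0 : ℝ) 1
    · have hb : b (-t) = 1 := b.one_of_mem_closedBall (by
        simp only [Metric.mem_closedBall, dist_zero_right, norm_neg, Real.norm_eq_abs]
        rw [abs_of_nonneg ht.1]
        have : b.rIn = 2 := rfl
        linarith [ht.2])
      simp [χ, ht, G, hb]
    · simp [χ, ht]
  refine ⟨fun i => ⟨S i, SmoothFn.mem_iff.2 (hS i)⟩, ?_⟩
  ext p
  have hderiv : ∀ t : ℝ, HasDerivAt (fun t => f.1 (pt p t))
      (∑ i, (p (Fin.natAdd n i) - p (Fin.castAdd n i)) * (f.pderiv i).1 (pt p t)) t := by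
    intro t
    have h1 : HasDerivAt (pt p) (fun i => p (Fin.natAdd n i) - p (Fin.castAdd n i)) t := by
      rw [hasDerivAt_pi]
      intro i
      simpa [pt] using ((hasDerivAt_id t).mul_const
        (p (Fin.natAdd n i) - p (Fin.castAdd n i))).const_add (p (Fin.castAdd n i))
    have h2 : HasFDerivAt f.1 (fderiv ℝ f.1 (pt p t)) (pt p t) :=
      ((f.smooth.differentiable (by simp)) _).hasFDerivAt
    have h3 := h2.comp_hasDerivAt t h1
    have h4 : fderiv ℝ f.1 (pt p t) (fun i => p (Fin.natAdd n i) - p (Fin.castAdd n i)) =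
        ∑ i, (p (Fin.natAdd n i) - p (Fin.castAdd n i)) * (f.pderiv i).1 (pt p t) := by
      conv_lhs => rw [pi_eq_sum_univ' (fun i => p (Fin.natAdd n i) - p (Fin.castAdd n i)), map_sum]
      refine Finset.sum_congr rfl fun i _ => ?_
      rw [map_smul, smul_eq_mul]
      congr 2
    rw [h4] at h3
    exact h3
  have hc : ∀ i, Continuous fun t => (f.pderiv i).1 (pt p t) := fun i =>
    (f.pderiv i).smooth.continuous.comp (by
      refine continuous_pi fun j => ?_
      simp only [pt]
      fun_prop)
  have hint := intervalIntegral.integral_eq_sub_of_hasDerivAt (a := 0) (b := 1)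
    (fun t _ => hderiv t)
    (Continuous.intervalIntegrable (by fun_prop) _ _)
  have h1 : pt p 1 = fun i => p (Fin.natAdd n i) := by funext i; simp [pt]
  have h0 : pt p 0 = fun i => p (Fin.castAdd n i) := by funext i; simp [pt]
  rw [h1, h0, intervalIntegral.integral_finsetSum (fun i _ =>
    (Continuous.intervalIntegrable (by fun_prop) _ _))] at hint
  simp only [intervalIntegral.integral_const_mul] at hint
  have hl : (f.comp (fun i => SmoothFn.proj (Fin.natAdd n i)) -
        f.comp (fun i => SmoothFn.proj (Fin.castAdd n i)) : SmoothFn (n + n)).1 p =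
      f.1 (fun i => p (Fin.natAdd n i)) - f.1 (fun i => p (Fin.castAdd n i)) := rfl
  change (_ : SmoothFn (n + n)).1 p = (_ : SmoothFn (n + n)).1 p
  rw [hl, ← hint]
  rw [AddSubmonoidClass.coe_finsetSum, Finset.sum_apply]
  rfl

theorem CInfRing.op_sub_op_mem {C : Type u} [CInfRing C] (I : Ideal C) {n : ℕ} (f : SmoothFn n)
    (a b : Fin n → C) (h : ∀ i, b i - a i ∈ I) : op f b - op f a ∈ I := by
  obtain ⟨g, hg⟩ := f.hadamard
  have := congrArg (evalHom (Fin.append a b)) hg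
  simp only [map_sub, map_sum, map_mul, evalHom_apply, op_comp, op_proj, Fin.append_left,
    Fin.append_right] at this
  rw [this]
  exact I.sum_mem fun i _ => I.mul_mem_right _ (h i)

/-- The quotient of a `C^∞`-ring by an ideal of the underlying algebra is a `C^∞`-ring. -/
instance {C : Type u} [CInfRing C] (I : Ideal C) : CInfRing (C ⧸ I) where
  op f c := Ideal.Quotient.mk I (op f fun i => (c i).out)
  op_comp g f c := by
    rw [op_comp, Ideal.Quotient.eq]
    refine op_sub_op_mem I _ _ _ fun i => ?_
    rw [← Ideal.Quotient.eq, Ideal.Quotient.mk_out]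
  op_proj j c := by rw [op_proj, Ideal.Quotient.mk_out]
  op_add a b := by
    conv_rhs => rw [← Ideal.Quotient.mk_out a, ← Ideal.Quotient.mk_out b, ← map_add, ← op_add]
    congr 2; funext i; fin_cases i <;> rfl
  op_mul a b := by
    conv_rhs => rw [← Ideal.Quotient.mk_out a, ← Ideal.Quotient.mk_out b, ← map_mul, ← op_mul]
    congr 2; funext i; fin_cases i <;> rfl
  op_const r := congrArg (Ideal.Quotient.mk I)
    ((congrArg (op _) (by funext i; exact i.elim0)).trans (op_const r))

/-- The projection `C → C ⧸ I`. -/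
def mkHom {C : Type u} [CInfRing C] (I : Ideal C) : CInfHom C (C ⧸ I) where
  toAlgHom := Ideal.Quotient.mkₐ ℝ I
  map_op' f c := by
    change Ideal.Quotient.mk I _ = Ideal.Quotient.mk I _
    rw [Ideal.Quotient.eq]
    refine op_sub_op_mem I _ _ _ fun i => ?_
    rw [← Ideal.Quotient.eq]
    exact (Ideal.Quotient.mk_out _).symm

theorem mkHom_apply {C : Type u} [CInfRing C] (I : Ideal C) (c : C) :
    mkHom I c = Ideal.Quotient.mk I c := rfl

/-- A subalgebra that is closed under all operations is a `C^∞`-ring. -/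
@[reducible]
def CInfRing.ofSubalgebra {C : Type u} [CInfRing C] (S : Subalgebra ℝ C)
    (h : ∀ {n : ℕ} (f : SmoothFn n) (c : Fin n → C), (∀ i, c i ∈ S) → op f c ∈ S) :
    CInfRing S where
  op f c := ⟨op f fun i => (c i).1, h f _ fun i => (c i).2⟩
  op_comp g f c := Subtype.ext (op_comp g f _)
  op_proj j c := Subtype.ext (op_proj j _)
  op_add a b := Subtype.ext
    ((congrArg (op _) (by funext j; fin_cases j <;> rfl)).trans (op_add a.1 b.1))
  op_mul a b := Subtype.ext
    ((congrArg (op _) (by funext j; fin_cases j <;> rfl)).trans (op_mul a.1 b.1))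
  op_const r := Subtype.ext
    ((congrArg (op _) (by funext j; exact j.elim0)).trans (op_const r))

/-! ### `ℝ`-points and localizations -/

/-- The `ℝ`-points of `C`. -/
def RPoint (C : Type u) [CInfRing C] : Type u := CInfHom C ℝ

instance {C : Type u} [CInfRing C] : CoeFun (RPoint C) fun _ => C → ℝ := ⟨fun x => x.toAlgHom⟩

/-- The coarsest topology for which all evaluations `x ↦ x c` are continuous. -/
instance {C : Type u} [CInfRing C] : TopologicalSpace (RPoint C) :=
  TopologicalSpace.induced (fun x c => x c) inferInstance

section Loc

variable {C : Type u} [CInfRing C]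

theorem RPoint.continuous_eval (c : C) : Continuous fun x : RPoint C => x c :=
  (continuous_apply c).comp continuous_induced_dom

theorem RPoint.map_op (x : RPoint C) {n : ℕ} (f : SmoothFn n) (c : Fin n → C) :
    x (op f c) = f.1 fun i => x (c i) := CInfHom.map_op (D := ℝ) x f c

/-- The ideal of elements that vanish near the `ℝ`-point `x`, that is, the kernel of the
localization at `x`. -/
def germIdeal (x : RPoint C) : Ideal C where
  carrier := {c | ∃ d, x d ≠ 0 ∧ c * d = 0}
  zero_mem' := by
    rw [Set.mem_ofPred_eq]
    exact ⟨1, by simp [map_one], zero_mul _⟩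
  add_mem' := by
    intro a b ha hb
    rw [Set.mem_ofPred_eq] at *
    obtain ⟨d, hd, h⟩ := ha
    obtain ⟨e, he, h'⟩ := hb
    refine ⟨d * e, by rw [map_mul]; exact mul_ne_zero hd he, ?_⟩
    linear_combination e * h + d * h'
  smul_mem' := by
    intro a b hb
    rw [Set.mem_ofPred_eq] at *
    obtain ⟨d, hd, h⟩ := hb
    exact ⟨d, hd, by rw [smul_eq_mul]; linear_combination a * h⟩

theorem mem_germIdeal {x : RPoint C} {c : C} : c ∈ germIdeal x ↔ ∃ d, x d ≠ 0 ∧ c * d = 0 :=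
  Iff.of_eq Set.mem_ofPred_eq

/-- The localization of `C` at the `ℝ`-point `x`: the universal `C^∞`-ring under `C` in which all
`c` with `x c ≠ 0` become invertible, see `Loc.isUnit` and `Loc.existsUnique_lift`. -/
abbrev Loc (x : RPoint C) : Type u := C ⧸ germIdeal x

/-- The canonical morphism `C → Loc x`. -/
def toLoc (x : RPoint C) : CInfHom C (Loc x) := mkHom (germIdeal x)

theorem toLoc_eq_iff {x : RPoint C} {c d : C} : toLoc x c = toLoc x d ↔ c - d ∈ germIdeal x :=
  Ideal.Quotient.eq

/-- Near a point where `d` does not vanish, `d` is inverted by `Φ_h(d)` for a suitable `h`. -/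
theorem exists_local_inverse {a : ℝ} (ha : a ≠ 0) :
    ∃ (h : SmoothFn 1) (ε : ℝ), 0 < ε ∧ ∀ {C : Type u} [CInfRing C] (y : RPoint C) (d : C),
      |y d - a| < ε → d * op h ![d] - 1 ∈ germIdeal y := by
  have ha' : 0 < |a| := abs_pos.2 ha
  let β : ContDiffBump a := ⟨|a| / 4, |a| / 2, by linarith, by linarith⟩
  let β' : ContDiffBump a := ⟨|a| / 8, |a| / 4, by linarith, by linarith⟩
  have hinv : ContDiff ℝ ∞ fun t : ℝ => t⁻¹ * β t := by
    rw [contDiff_iff_contDiffAt]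
    intro t
    by_cases ht : t = 0
    · subst ht
      have : (fun t : ℝ => t⁻¹ * β t) =ᶠ[𝓝 0] fun _ => 0 := by
        filter_upwards [Metric.ball_mem_nhds (0 : ℝ) (half_pos ha')] with t ht
        have : β t = 0 := β.zero_of_le_dist (by
          rw [Metric.mem_ball, dist_zero_right, Real.norm_eq_abs] at ht
          rw [Real.dist_eq]
          change |a| / 2 ≤ _
          have := abs_sub_abs_le_abs_sub a t
          rw [abs_sub_comm] at this
          linarith)
        rw [this, mul_zero]
      exact contDiffAt_const.congr_of_eventuallyEq this
    · exact (contDiffAt_inv ℝ ht).mul β.contDiffAt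
  let h : SmoothFn 1 := ⟨fun z => (z 0)⁻¹ * β (z 0), SmoothFn.mem_iff.2
    (hinv.comp (contDiff_apply ℝ ℝ (0 : Fin 1)))⟩
  let b : SmoothFn 1 := ⟨fun z => β' (z 0), SmoothFn.mem_iff.2
    (β'.contDiff.comp (contDiff_apply ℝ ℝ (0 : Fin 1)))⟩
  refine ⟨h, |a| / 4, by linarith, fun y d hd => ?_⟩
  rw [mem_germIdeal]
  refine ⟨op b ![d], ?_, ?_⟩
  · rw [RPoint.map_op]
    exact (β'.pos_of_mem_ball (by rw [Metric.mem_ball, Real.dist_eq]; exact hd)).ne'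
  · have key : (SmoothFn.proj 0 * h - 1) * b = (0 : SmoothFn 1) := by
      ext z
      change (z 0 * ((z 0)⁻¹ * β (z 0)) - 1) * β' (z 0) = 0
      by_cases hz : dist (z 0) a < |a| / 4
      · have h1 : β (z 0) = 1 := β.one_of_mem_closedBall (Metric.mem_closedBall.2 hz.le)
        have h0 : z 0 ≠ 0 := by
          intro h0
          rw [h0, dist_zero_left, Real.norm_eq_abs] at hz
          linarith
        rw [h1, mul_one, mul_inv_cancel₀ h0, sub_self, zero_mul]
      · have h1 : β' (z 0) = 0 := β'.zero_of_le_dist (not_lt.1 hz)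
        rw [h1, mul_zero]
    have := congrArg (evalHom ![d]) key
    rw [map_mul, map_sub, map_mul, map_one, map_zero] at this
    simp only [evalHom_apply, op_proj] at this
    exact this

theorem Loc.mul_local_inverse {x : RPoint C} {d : C} (hd : x d ≠ 0) :
    ∃ e : C, ∀ᶠ y in 𝓝 x, toLoc y d * toLoc y e = 1 := by
  obtain ⟨h, ε, hε, H⟩ := exists_local_inverse hd
  refine ⟨op h ![d], ?_⟩
  have := (RPoint.continuous_eval d).continuousAt (x := x)
  filter_upwards [this (Metric.ball_mem_nhds _ hε)] with y hy
  have := H y d (by simpa [Real.dist_eq] using hy)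
  rw [← map_mul, ← map_one (toLoc y).toAlgHom]
  exact toLoc_eq_iff.2 this

theorem Loc.isUnit (x : RPoint C) {d : C} (hd : x d ≠ 0) : IsUnit (toLoc x d) := by
  obtain ⟨e, he⟩ := Loc.mul_local_inverse hd
  exact IsUnit.of_mul_eq_one _ he.self_of_nhds

/-- `Loc x` is the `C^∞`-ring obtained from `C` by inverting all `c` with `x c ≠ 0`. -/
theorem Loc.existsUnique_lift (x : RPoint C) {D : Type v} [CInfRing D] (φ : CInfHom C D)
    (hφ : ∀ c, x c ≠ 0 → IsUnit (φ c)) :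
    ∃! ψ : CInfHom (Loc x) D, ∀ c, ψ (toLoc x c) = φ c := by
  have hk : ∀ c ∈ germIdeal x, φ.toAlgHom c = 0 := by
    intro c hc
    obtain ⟨d, hd, h⟩ := mem_germIdeal.1 hc
    have := congrArg φ.toAlgHom h
    rw [map_mul, map_zero] at this
    exact (hφ d hd).mul_left_eq_zero.1 this
  refine ⟨⟨Ideal.Quotient.liftₐ _ φ.toAlgHom hk, ?_⟩, fun c => rfl, fun ψ hψ => ?_⟩
  · intro n f c
    obtain ⟨c, rfl⟩ : ∃ c' : Fin n → C, (fun i => toLoc x (c' i)) = c :=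
      ⟨fun i => (c i).out, funext fun i => Ideal.Quotient.mk_out _⟩
    rw [← CInfHom.map_op]
    exact φ.map_op f c
  · refine CInfHom.ext fun c => ?_
    obtain ⟨c, rfl⟩ := Ideal.Quotient.mk_surjective c
    exact hψ c

end Loc

open TopologicalSpace (Opens)

/-! ### `C^∞`-ringed spaces -/

/-- A `C^∞`-ringed space: a topological space with a sheaf of `C^∞`-rings. -/
structure CSpace where
  carrier : Type u
  [top : TopologicalSpace carrier]
  O : Opens carrier → Type u
  [ring : ∀ U, CInfRing (O U)]
  res : ∀ {U V : Opens carrier}, V ≤ U → CInfHom (O U) (O V)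
  res_self : ∀ {U : Opens carrier} (s : O U), res le_rfl s = s
  res_res : ∀ {U V W : Opens carrier} (h : V ≤ U) (h' : W ≤ V) (s : O U),
    res h' (res h s) = res (h'.trans h) s
  locality : ∀ {ι : Type u} {U : Opens carrier} (V : ι → Opens carrier) (hV : ∀ i, V i ≤ U),
    U ≤ iSup V → ∀ s t : O U, (∀ i, res (hV i) s = res (hV i) t) → s = t
  gluing : ∀ {ι : Type u} {U : Opens carrier} (V : ι → Opens carrier) (hV : ∀ i, V i ≤ U),
    U ≤ iSup V → ∀ s : ∀ i, O (V i),
      (∀ i j, res (inf_le_left : V i ⊓ V j ≤ V i) (s i) =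
        res (inf_le_right : V i ⊓ V j ≤ V j) (s j)) →
      ∃ t : O U, ∀ i, res (hV i) t = s i

attribute [instance] CSpace.top CSpace.ring

/-- An open subset of an open subset, as an open subset of the ambient space. -/
def imageOpens {X : Type u} [TopologicalSpace X] {U : Opens X} (V : Opens U) : Opens X :=
  ⟨Subtype.val '' (V : Set U), U.isOpen.isOpenMap_subtype_val _ V.isOpen⟩

theorem mem_imageOpens {X : Type u} [TopologicalSpace X] {U : Opens X} {V : Opens U} {x : X} :
    x ∈ imageOpens V ↔ ∃ h : x ∈ U, (⟨x, h⟩ : U) ∈ V := by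
  change x ∈ Subtype.val '' (V : Set U) ↔ _
  simp

theorem imageOpens_mono {X : Type u} [TopologicalSpace X] {U : Opens X} {V W : Opens U}
    (h : V ≤ W) : imageOpens V ≤ imageOpens W := Set.image_mono h

theorem imageOpens_inf {X : Type u} [TopologicalSpace X] {U : Opens X} (V W : Opens U) :
    imageOpens V ⊓ imageOpens W ≤ imageOpens (V ⊓ W) := by
  rintro x ⟨h1, h2⟩
  obtain ⟨h, h1⟩ := mem_imageOpens.1 h1
  obtain ⟨_, h2⟩ := mem_imageOpens.1 h2
  exact mem_imageOpens.2 ⟨h, h1, h2⟩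

theorem imageOpens_iSup {X : Type u} [TopologicalSpace X] {U : Opens X} {ι : Type u}
    {W : Opens U} {V : ι → Opens U} (h : W ≤ iSup V) :
    imageOpens W ≤ ⨆ i, imageOpens (V i) := by
  intro x hx
  obtain ⟨hU, hx⟩ := mem_imageOpens.1 hx
  obtain ⟨i, hi⟩ := Opens.mem_iSup.1 (h hx)
  exact Opens.mem_iSup.2 ⟨i, mem_imageOpens.2 ⟨hU, hi⟩⟩

/-- The preimage of an open set under a homeomorphism. -/
def preimageOpens {X Y : Type u} [TopologicalSpace X] [TopologicalSpace Y] (e : X ≃ₜ Y)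
    (V : Opens Y) : Opens X := ⟨e ⁻¹' V, V.isOpen.preimage e.continuous⟩

theorem preimageOpens_mono {X Y : Type u} [TopologicalSpace X] [TopologicalSpace Y] (e : X ≃ₜ Y)
    {V W : Opens Y} (h : V ≤ W) : preimageOpens e V ≤ preimageOpens e W := fun _ hx => h hx

namespace CSpace

/-- The open subspace `(U, O_X|_U)`. -/
def restrict (X : CSpace.{u}) (U : Opens X.carrier) : CSpace.{u} where
  carrier := U
  O V := X.O (imageOpens V)
  res h := X.res (imageOpens_mono h)
  res_self s := X.res_self s
  res_res _ _ s := X.res_res _ _ s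
  locality V hV h s t hst :=
    X.locality (fun i => imageOpens (V i)) (fun i => imageOpens_mono (hV i))
      (imageOpens_iSup h) s t hst
  gluing V hV h s hs :=
    X.gluing (fun i => imageOpens (V i)) (fun i => imageOpens_mono (hV i))
      (imageOpens_iSup h) s fun i j => by
        have := congrArg (X.res (imageOpens_inf (V i) (V j))) (hs i j)
        rwa [X.res_res, X.res_res] at this

/-- An isomorphism of `C^∞`-ringed spaces. -/
structure Iso (X Y : CSpace.{u}) where
  base : X.carrier ≃ₜ Y.carrier
  sec : ∀ V : Opens Y.carrier, CInfEquiv (Y.O V) (X.O (preimageOpens base V))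
  sec_res : ∀ {V W : Opens Y.carrier} (h : W ≤ V) (s : Y.O V),
    sec W (Y.res h s) = X.res (preimageOpens_mono base h) (sec V s)

end CSpace

/-! ### The spectrum -/

section Spec

variable {C : Type u} [CInfRing C]

/-- A family of elements of localizations is a section of the structure sheaf if it is locally of
the form `y ↦ π_y(c) π_y(d)⁻¹`. -/
def IsSection {U : Opens (RPoint C)} (s : ∀ x : U, Loc x.1) : Prop :=
  ∀ x : U, ∃ c d : C, ∀ᶠ y : U in 𝓝 x, y.1 d ≠ 0 ∧ s y * toLoc y.1 d = toLoc y.1 c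

theorem isSection_iff {U : Opens (RPoint C)} {s : ∀ x : U, Loc x.1} :
    IsSection s ↔ ∀ x : U, ∃ c : C, ∀ᶠ y : U in 𝓝 x, s y = toLoc y.1 c := by
  constructor
  · intro h x
    obtain ⟨c, d, H⟩ := h x
    obtain ⟨e, he⟩ := Loc.mul_local_inverse H.self_of_nhds.1
    refine ⟨c * e, ?_⟩
    filter_upwards [H, continuous_subtype_val.continuousAt.eventually he] with y hy hy'
    rw [map_mul, ← hy.2, mul_assoc, hy', mul_one]
  · intro h x
    obtain ⟨c, H⟩ := h x
    refine ⟨c, 1, ?_⟩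
    filter_upwards [H] with y hy
    exact ⟨by simp [map_one], by rw [map_one, mul_one, hy]⟩

theorem IsSection.op {U : Opens (RPoint C)} {n : ℕ} (f : SmoothFn n)
    {s : Fin n → ∀ x : U, Loc x.1} (h : ∀ i, IsSection (s i)) : IsSection (op f s) := by
  rw [isSection_iff]
  intro x
  choose c hc using fun i => isSection_iff.1 (h i) x
  refine ⟨CInfRing.op f c, ?_⟩
  filter_upwards [Filter.eventually_all.2 hc] with y hy
  rw [CInfHom.map_op]
  exact congrArg (CInfRing.op f) (funext hy)

variable (C)

/-- The `C^∞`-ring of sections of the structure sheaf of `Spec C` over `U`. -/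
def specSections (U : Opens (RPoint C)) : Subalgebra ℝ (∀ x : U, Loc x.1) where
  carrier := {s | IsSection s}
  mul_mem' {a b} ha hb := by
    rw [Set.mem_ofPred_eq] at *
    rw [← op_mul]
    exact IsSection.op _ fun i => by fin_cases i <;> assumption
  add_mem' {a b} ha hb := by
    rw [Set.mem_ofPred_eq] at *
    rw [← op_add]
    exact IsSection.op _ fun i => by fin_cases i <;> assumption
  algebraMap_mem' r := by
    rw [Set.mem_ofPred_eq, Algebra.algebraMap_eq_smul_one, ← op_const]
    exact IsSection.op _ fun i => i.elim0

variable {C}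

theorem mem_specSections {U : Opens (RPoint C)} {s : ∀ x : U, Loc x.1} :
    s ∈ specSections C U ↔ IsSection s := Iff.of_eq Set.mem_ofPred_eq

instance (U : Opens (RPoint C)) : CInfRing (specSections C U) :=
  CInfRing.ofSubalgebra _ fun f _ h => mem_specSections.2 <|
    IsSection.op f fun i => mem_specSections.1 (h i)

/-- Restriction of sections. -/
def specRes {U V : Opens (RPoint C)} (h : V ≤ U) :
    CInfHom (specSections C U) (specSections C V) where
  toFun s := ⟨fun x => s.1 ⟨x.1, h x.2⟩, mem_specSections.2 fun x => by
    obtain ⟨c, d, H⟩ := mem_specSections.1 s.2 ⟨x.1, h x.2⟩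
    have hc : Continuous fun y : V => (⟨y.1, h y.2⟩ : U) :=
      continuous_subtype_val.subtype_mk _
    exact ⟨c, d, hc.continuousAt.eventually H⟩⟩
  map_one' := rfl
  map_mul' _ _ := rfl
  map_zero' := rfl
  map_add' _ _ := rfl
  commutes' _ := rfl
  map_op' _ _ := rfl

variable (C)

/-- The spectrum of a `C^∞`-ring. -/
def Spec : CSpace.{u} where
  carrier := RPoint C
  O U := specSections C U
  res := specRes
  res_self _ := rfl
  res_res _ _ _ := rfl
  locality V hV h s t hst := by
    refine Subtype.ext (funext fun x => ?_)
    obtain ⟨i, hi⟩ := Opens.mem_iSup.1 (h x.2)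
    exact congrFun (congrArg Subtype.val (hst i)) ⟨x.1, hi⟩
  gluing {ι U} V hV h s hs := by
    have hcov : ∀ x : U, ∃ i, x.1 ∈ V i := fun x => Opens.mem_iSup.1 (h x.2)
    choose i hi using hcov
    have key : ∀ (x : U) (j : ι) (hj : x.1 ∈ V j),
        (s (i x)).1 ⟨x.1, hi x⟩ = (s j).1 ⟨x.1, hj⟩ := fun x j hj =>
      congrFun (congrArg Subtype.val (hs (i x) j)) ⟨x.1, hi x, hj⟩
    refine ⟨⟨fun x => (s (i x)).1 ⟨x.1, hi x⟩, mem_specSections.2 fun x => ?_⟩, fun j => ?_⟩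
    · obtain ⟨c, d, H⟩ := mem_specSections.1 (s (i x)).2 ⟨x.1, hi x⟩
      refine ⟨c, d, ?_⟩
      rw [Topology.IsInducing.subtypeVal.nhds_eq_comap, Filter.eventually_comap] at H
      have H' := H
      filter_upwards [continuous_subtype_val.continuousAt.eventually H',
        continuous_subtype_val.continuousAt.eventually ((V (i x)).isOpen.mem_nhds (hi x))]
        with y hy hy'
      have := hy ⟨y.1, hy'⟩ rfl
      refine ⟨this.1, ?_⟩
      rw [key y (i x) hy']
      exact this.2
    · exact Subtype.ext (funext fun x => key ⟨x.1, hV j x.2⟩ j x.2)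

/-- The canonical morphism from `C` to the sections of `Spec C` over `U`. -/
def toSections (U : Opens (RPoint C)) : CInfHom C (specSections C U) where
  toFun c := ⟨fun x => toLoc x.1 c, mem_specSections.2 <| isSection_iff.2 fun _ =>
    ⟨c, Filter.Eventually.of_forall fun _ => rfl⟩⟩
  map_one' := rfl
  map_mul' _ _ := rfl
  map_zero' := rfl
  map_add' _ _ := rfl
  commutes' _ := rfl
  map_op' f c := Subtype.ext (funext fun x => (toLoc x.1).map_op f c)

variable {C}

/-- An element of `C` as a section over `U` of the structure sheaf of `Spec C`. -/
def Spec.fn (U : Opens (Spec C).carrier) (c : C) : (Spec C).O U := toSections C U c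

end Spec

/-! ### Sheaves of modules -/

/-- A presheaf of `O_X`-modules. -/
structure PreMod (X : CSpace.{u}) where
  M : Opens X.carrier → Type u
  [grp : ∀ U, AddCommGroup (M U)]
  [mod : ∀ U, Module (X.O U) (M U)]
  res : ∀ {U V : Opens X.carrier}, V ≤ U → M U →+ M V
  res_smul : ∀ {U V : Opens X.carrier} (h : V ≤ U) (r : X.O U) (m : M U),
    res h (r • m) = X.res h r • res h m
  res_self : ∀ {U : Opens X.carrier} (m : M U), res le_rfl m = m
  res_res : ∀ {U V W : Opens X.carrier} (h : V ≤ U) (h' : W ≤ V) (m : M U),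
    res h' (res h m) = res (h'.trans h) m

attribute [instance] PreMod.grp PreMod.mod

namespace PreMod

variable {X Y : CSpace.{u}}

/-- The sheaf condition. -/
structure IsSheaf (E : PreMod X) : Prop where
  locality : ∀ {ι : Type u} {U : Opens X.carrier} (V : ι → Opens X.carrier) (hV : ∀ i, V i ≤ U),
    U ≤ iSup V → ∀ s t : E.M U, (∀ i, E.res (hV i) s = E.res (hV i) t) → s = t
  gluing : ∀ {ι : Type u} {U : Opens X.carrier} (V : ι → Opens X.carrier) (hV : ∀ i, V i ≤ U),
    U ≤ iSup V → ∀ s : ∀ i, E.M (V i),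
      (∀ i j, E.res (inf_le_left : V i ⊓ V j ≤ V i) (s i) =
        E.res (inf_le_right : V i ⊓ V j ≤ V j) (s j)) →
      ∃ t : E.M U, ∀ i, E.res (hV i) t = s i

/-- The restriction `E|_U`, a presheaf of `O_X|_U`-modules. -/
def restrict (E : PreMod X) (U : Opens X.carrier) : PreMod (X.restrict U) where
  M V := E.M (imageOpens V)
  grp V := E.grp (imageOpens V)
  mod V := E.mod (imageOpens V)
  res h := E.res (imageOpens_mono h)
  res_smul h r m := E.res_smul (imageOpens_mono h) r m
  res_self m := E.res_self m
  res_res h h' m := E.res_res (imageOpens_mono h) (imageOpens_mono h') m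

/-- An isomorphism of presheaves of `O_X`-modules. -/
structure Iso (E F : PreMod X) where
  app : ∀ U : Opens X.carrier, E.M U ≃ₗ[X.O U] F.M U
  app_res : ∀ {U V : Opens X.carrier} (h : V ≤ U) (m : E.M U),
    app V (E.res h m) = F.res h (app U m)

/-- An isomorphism between a presheaf `F` of modules on `Y` and a presheaf `E` of modules on `X`
over an isomorphism `i : X ≅ Y`. -/
structure IsoOver (i : CSpace.Iso X Y) (E : PreMod X) (F : PreMod Y) where
  app : ∀ V : Opens Y.carrier, F.M V ≃+ E.M (preimageOpens i.base V)
  app_smul : ∀ {V : Opens Y.carrier} (r : Y.O V) (m : F.M V),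
    app V (r • m) = i.sec V r • app V m
  app_res : ∀ {V W : Opens Y.carrier} (h : W ≤ V) (m : F.M V),
    app W (F.res h m) = E.res (preimageOpens_mono i.base h) (app V m)

/-! ### Stalks and sheafification -/

section Sheafify

variable (E : PreMod X)

/-- The open neighbourhoods of a point. -/
structure Nhd (X : CSpace.{u}) (x : X.carrier) where
  set : Opens X.carrier
  mem : x ∈ set

/-- Neighbourhoods are ordered by reverse inclusion. -/
instance (x : X.carrier) : Preorder (Nhd X x) where
  le U V := V.set ≤ U.set
  le_refl _ := le_rfl
  le_trans _ _ _ h h' := h'.trans h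

instance (x : X.carrier) : Nonempty (Nhd X x) := ⟨⟨⊤, trivial⟩⟩

instance (x : X.carrier) : IsDirectedOrder (Nhd X x) where
  directed U V := ⟨⟨U.set ⊓ V.set, U.mem, V.mem⟩, inf_le_left (a := U.set),
    inf_le_right (a := U.set)⟩

instance (x : X.carrier) : DecidableEq (Nhd X x) := Classical.decEq _

instance (x : X.carrier) : DirectedSystem (fun U : Nhd X x => E.M U.set)
    fun _ _ h => E.res h where
  map_self _ m := E.res_self m
  map_map _ _ _ h h' m := E.res_res h h' m

/-- The stalk of `E` at `x`, the direct limit of `E(U)` over open `U` containing `x`. -/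
abbrev Stalk (x : X.carrier) : Type u :=
  AddCommGroup.DirectLimit (fun U : Nhd X x => E.M U.set) fun _ _ h => E.res h

/-- The germ of a section at `x`. -/
def germ {U : Opens X.carrier} {x : X.carrier} (hx : x ∈ U) : E.M U →+ E.Stalk x :=
  AddCommGroup.DirectLimit.of (fun U : Nhd X x => E.M U.set) (fun _ _ h => E.res h) ⟨U, hx⟩

theorem germ_res {U V : Opens X.carrier} {x : X.carrier} (h : V ≤ U) (hx : x ∈ V) (m : E.M U) :
    E.germ hx (E.res h m) = E.germ (h hx) m :=
  AddCommGroup.DirectLimit.of_f (G := fun U : Nhd X x => E.M U.set) (f := fun _ _ h => E.res h)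
    (i := ⟨U, h hx⟩) (j := ⟨V, hx⟩) h m

theorem exists_germ {x : X.carrier} (z : E.Stalk x) :
    ∃ (U : Opens X.carrier) (hx : x ∈ U) (m : E.M U), E.germ hx m = z :=
  AddCommGroup.DirectLimit.induction_on z fun U m => ⟨U.set, U.mem, m, rfl⟩

theorem germ_eq {U V : Opens X.carrier} {x : X.carrier} {hx : x ∈ U} {hx' : x ∈ V} {m : E.M U}
    {m' : E.M V} (h : E.germ hx m = E.germ hx' m') :
    ∃ (W : Opens X.carrier) (hU : W ≤ U) (hV : W ≤ V), x ∈ W ∧ E.res hU m = E.res hV m' := by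
  have hxx : x ∈ U ⊓ V := ⟨hx, hx'⟩
  have h0 : E.germ hxx
      (E.res inf_le_left m - E.res inf_le_right m') = 0 := by
    rw [map_sub, germ_res, germ_res, h, sub_self]
  obtain ⟨⟨W, hW⟩, hle, h1⟩ := AddCommGroup.DirectLimit.of.zero_exact
    (G := fun U : Nhd X x => E.M U.set) (f := fun _ _ h => E.res h) ⟨U ⊓ V, hx, hx'⟩ _ h0
  refine ⟨W, le_trans hle inf_le_left, le_trans hle inf_le_right, hW, ?_⟩
  rw [map_sub, sub_eq_zero] at h1
  exact (E.res_res _ _ _).symm.trans (h1.trans (E.res_res _ _ _))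

/-- Multiplication of germs at `x` by a function defined near `x`. -/
def stalkSMul {U : Opens X.carrier} {x : X.carrier} (hx : x ∈ U) (r : X.O U) :
    E.Stalk x →+ E.Stalk x :=
  AddCommGroup.DirectLimit.lift _ _ _
    (fun V => (E.germ (U := U ⊓ V.set) ⟨hx, V.mem⟩).comp <|
      (DistribSMul.toAddMonoidHom _ (X.res inf_le_left r)).comp (E.res inf_le_right))
    fun V W h m => by
      simp only [AddMonoidHom.comp_apply, DistribSMul.toAddMonoidHom_apply]
      rw [← E.germ_res (inf_le_inf_left U h : U ⊓ W.set ≤ U ⊓ V.set) ⟨hx, W.mem⟩, E.res_smul, E.res_res,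
        E.res_res, X.res_res]

theorem stalkSMul_germ' {U V : Opens X.carrier} {x : X.carrier} (hx : x ∈ U) (hx' : x ∈ V)
    (r : X.O U) (m : E.M V) :
    E.stalkSMul hx r (E.germ hx' m) =
      E.germ (U := U ⊓ V) ⟨hx, hx'⟩ (X.res (inf_le_left : U ⊓ V ≤ U) r • E.res inf_le_right m) :=
  AddCommGroup.DirectLimit.lift_of _ _ _ _ _

theorem stalkSMul_germ {U V : Opens X.carrier} {x : X.carrier} (hx : x ∈ U) (h : V ≤ U)
    (hx' : x ∈ V) (r : X.O U) (m : E.M V) :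
    E.stalkSMul hx r (E.germ hx' m) = E.germ hx' (X.res h r • m) := by
  rw [stalkSMul_germ', ← E.germ_res (inf_le_right : U ⊓ V ≤ V) ⟨hx, hx'⟩, E.res_smul, X.res_res]

/-- A germ at a point of `U` is represented on a neighbourhood inside `U`. -/
theorem exists_germ_le {U : Opens X.carrier} {x : X.carrier} (hx : x ∈ U) (z : E.Stalk x) :
    ∃ (V : Opens X.carrier) (_ : V ≤ U) (hx : x ∈ V) (m : E.M V), E.germ hx m = z := by
  obtain ⟨V, hV, m, rfl⟩ := E.exists_germ z
  exact ⟨U ⊓ V, inf_le_left, ⟨hx, hV⟩, E.res inf_le_right m, E.germ_res _ _ _⟩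

/-- Sections of the sheafification: families of germs that are locally the germs of a section. -/
def sheafSections (U : Opens X.carrier) : AddSubgroup (∀ x : U, E.Stalk x.1) where
  carrier := {s | ∀ x : U, ∃ (V : Opens X.carrier) (h : V ≤ U) (m : E.M V), x.1 ∈ V ∧
    ∀ y (hy : y ∈ V), s ⟨y, h hy⟩ = E.germ hy m}
  zero_mem' := by
    rw [Set.mem_ofPred_eq]
    exact fun x => ⟨U, le_rfl, 0, x.2, fun y hy => (map_zero (E.germ hy)).symm⟩
  add_mem' {a b} ha hb := by
    rw [Set.mem_ofPred_eq] at *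
    intro x
    obtain ⟨V, h, m, hx, H⟩ := ha x
    obtain ⟨V', h', m', hx', H'⟩ := hb x
    refine ⟨V ⊓ V', inf_le_left.trans h, E.res inf_le_left m + E.res inf_le_right m',
      ⟨hx, hx'⟩, fun y hy => ?_⟩
    rw [map_add, E.germ_res, E.germ_res, Pi.add_apply, H y hy.1, H' y hy.2]
  neg_mem' {a} ha := by
    rw [Set.mem_ofPred_eq] at *
    intro x
    obtain ⟨V, h, m, hx, H⟩ := ha x
    exact ⟨V, h, -m, hx, fun y hy => by rw [map_neg, Pi.neg_apply, H y hy]⟩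

theorem mem_sheafSections {U : Opens X.carrier} {s : ∀ x : U, E.Stalk x.1} :
    s ∈ E.sheafSections U ↔ ∀ x : U, ∃ (V : Opens X.carrier) (h : V ≤ U) (m : E.M V), x.1 ∈ V ∧
      ∀ y (hy : y ∈ V), s ⟨y, h hy⟩ = E.germ hy m := Iff.of_eq Set.mem_ofPred_eq

instance (U : Opens X.carrier) : SMul (X.O U) (E.sheafSections U) where
  smul r s := ⟨fun x => E.stalkSMul x.2 r (s.1 x), E.mem_sheafSections.2 fun x => by
    obtain ⟨V, h, m, hx, H⟩ := E.mem_sheafSections.1 s.2 x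
    exact ⟨V, h, X.res h r • m, hx, fun y hy => by rw [H y hy, E.stalkSMul_germ _ h hy]⟩⟩

theorem smul_sheafSections_apply {U : Opens X.carrier} (r : X.O U) (s : E.sheafSections U)
    (x : U) : (r • s).1 x = E.stalkSMul x.2 r (s.1 x) := rfl

instance (U : Opens X.carrier) : Module (X.O U) (E.sheafSections U) where
  one_smul s := Subtype.ext <| funext fun x => by
    obtain ⟨V, h, hx, m, H⟩ := E.exists_germ_le x.2 (s.1 x)
    rw [smul_sheafSections_apply, ← H, E.stalkSMul_germ _ h, map_one, one_smul]
  mul_smul r r' s := Subtype.ext <| funext fun x => by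
    obtain ⟨V, h, hx, m, H⟩ := E.exists_germ_le x.2 (s.1 x)
    rw [smul_sheafSections_apply, smul_sheafSections_apply, smul_sheafSections_apply, ← H,
      E.stalkSMul_germ _ h, E.stalkSMul_germ _ h, E.stalkSMul_germ _ h, map_mul, mul_smul]
  smul_zero r := Subtype.ext <| funext fun x => map_zero (E.stalkSMul x.2 r)
  smul_add r s t := Subtype.ext <| funext fun x => map_add (E.stalkSMul x.2 r) _ _
  add_smul r r' s := Subtype.ext <| funext fun x => by
    obtain ⟨V, h, hx, m, H⟩ := E.exists_germ_le x.2 (s.1 x)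
    change E.stalkSMul x.2 (r + r') (s.1 x) = E.stalkSMul x.2 r (s.1 x) +
      E.stalkSMul x.2 r' (s.1 x)
    rw [← H, E.stalkSMul_germ _ h, E.stalkSMul_germ _ h, E.stalkSMul_germ _ h, map_add, add_smul,
      map_add]
  zero_smul s := Subtype.ext <| funext fun x => by
    obtain ⟨V, h, hx, m, H⟩ := E.exists_germ_le x.2 (s.1 x)
    change E.stalkSMul x.2 0 (s.1 x) = 0
    rw [← H, E.stalkSMul_germ _ h, map_zero, zero_smul, map_zero]

/-- The sheafification of `E`. -/
def sheafify : PreMod X where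
  M U := E.sheafSections U
  res {U V} h :=
    { toFun := fun s => ⟨fun x => s.1 ⟨x.1, h x.2⟩, E.mem_sheafSections.2 fun x => by
        obtain ⟨W, hW, m, hx, H⟩ := E.mem_sheafSections.1 s.2 ⟨x.1, h x.2⟩
        exact ⟨V ⊓ W, inf_le_left, E.res inf_le_right m, ⟨x.2, hx⟩, fun y hy => by
          rw [E.germ_res, ← H y hy.2]⟩⟩
      map_zero' := rfl
      map_add' := fun _ _ => rfl }
  res_smul {U V} h r s := Subtype.ext <| funext fun x => by
    obtain ⟨W, hW, hx, m, H⟩ := E.exists_germ_le x.2 (s.1 ⟨x.1, h x.2⟩)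
    change E.stalkSMul (h x.2) r (s.1 ⟨x.1, h x.2⟩) =
      E.stalkSMul x.2 (X.res h r) (s.1 ⟨x.1, h x.2⟩)
    rw [← H, E.stalkSMul_germ _ (hW.trans h), E.stalkSMul_germ _ hW, X.res_res]
  res_self _ := rfl
  res_res _ _ _ := rfl

/-- The canonical morphism from a presheaf to its sheafification. -/
def toSheafify (U : Opens X.carrier) : E.M U →ₗ[X.O U] E.sheafify.M U where
  toFun m := (⟨fun x => E.germ x.2 m, E.mem_sheafSections.2 fun x =>
    ⟨U, le_rfl, m, x.2, fun _ _ => rfl⟩⟩ : E.sheafSections U)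
  map_add' m m' := Subtype.ext <| funext fun x => map_add (E.germ x.2) m m'
  map_smul' r m := Subtype.ext <| funext fun x => by
    change E.germ x.2 (r • m) = E.stalkSMul x.2 r (E.germ x.2 m)
    rw [E.stalkSMul_germ x.2 le_rfl, X.res_self]

theorem toSheafify_res {U V : Opens X.carrier} (h : V ≤ U) (m : E.M U) :
    E.toSheafify V (E.res h m) = E.sheafify.res h (E.toSheafify U m) :=
  Subtype.ext <| funext fun x => E.germ_res h x.2 m

theorem sheafify_isSheaf : E.sheafify.IsSheaf where
  locality V hV h s t hst := by
    refine Subtype.ext (funext fun x => ?_)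
    obtain ⟨i, hi⟩ := Opens.mem_iSup.1 (h x.2)
    exact congrFun (congrArg Subtype.val (hst i)) ⟨x.1, hi⟩
  gluing {ι U} V hV h s hs := by
    have hcov : ∀ x : U, ∃ i, x.1 ∈ V i := fun x => Opens.mem_iSup.1 (h x.2)
    choose i hi using hcov
    have key : ∀ (x : U) (j : ι) (hj : x.1 ∈ V j),
        (s (i x)).1 ⟨x.1, hi x⟩ = (s j).1 ⟨x.1, hj⟩ := fun x j hj =>
      congrFun (congrArg Subtype.val (hs (i x) j)) ⟨x.1, hi x, hj⟩
    refine ⟨⟨fun x => (s (i x)).1 ⟨x.1, hi x⟩, E.mem_sheafSections.2 fun x => ?_⟩, fun j => ?_⟩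
    · obtain ⟨W, hW, m, hx, H⟩ := E.mem_sheafSections.1 (s (i x)).2 ⟨x.1, hi x⟩
      exact ⟨W, hW.trans (hV _), m, hx, fun y hy =>
        (key ⟨y, hV _ (hW hy)⟩ (i x) (hW hy)).trans (H y hy)⟩
    · exact Subtype.ext (funext fun x => key ⟨x.1, hV j x.2⟩ j x.2)

end Sheafify

end PreMod

/-! ### Cotangent modules -/

section Omega

variable (C : Type u) [CInfRing C]

/-- The relations `d(Φ_f(c₁, …, c_n)) = ∑ᵢ Φ_{∂f/∂xᵢ}(c₁, …, c_n) dcᵢ` among the symbols `dc`. -/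
def omegaRel : Submodule C (C →₀ C) :=
  Submodule.span C {m | ∃ (n : ℕ) (f : SmoothFn n) (c : Fin n → C),
    m = Finsupp.single (op f c) 1 - ∑ i, Finsupp.single (c i) (op (f.pderiv i) c)}

/-- The cotangent module `Ω_C`, generated by symbols `dc` for `c ∈ C`. -/
abbrev Omega : Type u := (C →₀ C) ⧸ omegaRel C

variable {C}

/-- The universal derivation `d : C → Ω_C`. -/
def Omega.d (c : C) : Omega C := (omegaRel C).mkQ (Finsupp.single c 1)

variable {D : Type u} [CInfRing D]

/-- The map of free modules `∑ a dc ↦ ∑ φ(a) dφ(c)`. -/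
def Omega.freeMap (φ : CInfHom C D) : (C →₀ C) →ₛₗ[(φ.toAlgHom : C →+* D)] (D →₀ D) :=
  (Finsupp.lmapDomain D D φ).comp
    (Finsupp.mapRange.linearMap
      ({ toFun := φ, map_add' := map_add φ.toAlgHom, map_smul' := map_mul φ.toAlgHom } :
        C →ₛₗ[(φ.toAlgHom : C →+* D)] D))

theorem Omega.freeMap_single (φ : CInfHom C D) (c a : C) :
    Omega.freeMap φ (Finsupp.single c a) = Finsupp.single (φ c) (φ a) := by
  simp [Omega.freeMap, Finsupp.mapDomain_single]

theorem Omega.freeMap_mem (φ : CInfHom C D) :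
    omegaRel C ≤ (omegaRel D).comap (Omega.freeMap φ) := by
  rw [omegaRel, Submodule.span_le]
  intro m hm
  rw [Set.mem_ofPred_eq] at hm
  obtain ⟨n, f, c, rfl⟩ := hm
  refine Submodule.subset_span ?_
  rw [Set.mem_ofPred_eq]
  refine ⟨n, f, fun i => φ (c i), ?_⟩
  simp only [map_sub, map_sum, Omega.freeMap_single, CInfHom.map_op, map_one]

/-- The map `Ω_C → Ω_D` induced by `φ : C → D`. It maps `a dc` to `φ(a) dφ(c)`. -/
def Omega.map (φ : CInfHom C D) : Omega C →ₛₗ[(φ.toAlgHom : C →+* D)] Omega D :=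
  (omegaRel C).mapQ (omegaRel D) (Omega.freeMap φ) (Omega.freeMap_mem φ)

theorem Omega.map_d (φ : CInfHom C D) (c : C) : Omega.map φ (Omega.d c) = Omega.d (φ c) := by
  rw [Omega.map, Omega.d, Submodule.mkQ_apply, Submodule.mapQ_apply, Omega.freeMap_single, map_one]
  rfl

theorem Omega.induction {p : Omega C → Prop} (m : Omega C) (zero : p 0)
    (add : ∀ m m', p m → p m' → p (m + m')) (smul_d : ∀ a c : C, p (a • Omega.d c)) : p m := by
  obtain ⟨m, rfl⟩ := (omegaRel C).mkQ_surjective m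
  induction m using Finsupp.induction_linear with
  | zero => simpa using zero
  | add f g hf hg => simpa using add _ _ hf hg
  | single c a =>
    have h := smul_d a c
    rwa [Omega.d, ← map_smul, Finsupp.smul_single, smul_eq_mul, mul_one] at h

theorem Omega.map_id (φ : CInfHom C C) (h : ∀ c, φ c = c) (m : Omega C) : Omega.map φ m = m := by
  induction m using Omega.induction with
  | zero => exact map_zero _
  | add m m' hm hm' => rw [map_add, hm, hm']
  | smul_d a c =>
    rw [map_smulₛₗ, Omega.map_d, h]
    exact congrArg (· • _) (h a)

theorem Omega.map_comp {D' : Type u} [CInfRing D'] (φ : CInfHom C D) (ψ : CInfHom D D')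
    (χ : CInfHom C D') (h : ∀ c, ψ (φ c) = χ c) (m : Omega C) :
    Omega.map ψ (Omega.map φ m) = Omega.map χ m := by
  induction m using Omega.induction with
  | zero => simp
  | add m m' hm hm' => rw [map_add, map_add, map_add, hm, hm']
  | smul_d a c =>
    rw [map_smulₛₗ, map_smulₛₗ, map_smulₛₗ, Omega.map_d, Omega.map_d, Omega.map_d, h]
    exact congrArg (· • _) (h a)

end Omega

/-- The presheaf `U ↦ Ω_{O_X(U)}`. -/
def cotPre (X : CSpace.{u}) : PreMod X where
  M U := Omega (X.O U)
  res h := (Omega.map (X.res h)).toAddMonoidHom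
  res_smul h r m := (Omega.map (X.res h)).map_smulₛₗ r m
  res_self m := Omega.map_id _ (fun s => X.res_self s) m
  res_res h h' m := Omega.map_comp _ _ _ (fun s => X.res_res h h' s) m

/-- The cotangent sheaf `T*X`. -/
def cot (X : CSpace.{u}) : PreMod X := (cotPre X).sheafify

/-- The differential of a function, as a section of the cotangent sheaf. -/
def cot.d {X : CSpace.{u}} {U : Opens X.carrier} (s : X.O U) : (cot X).M U :=
  (cotPre X).toSheafify U (Omega.d s)

/-! ### Modules on spectra, coherent sheaves and vector bundles -/

section MSpec

variable (C : Type u) [CInfRing C] (M : Type u) [AddCommGroup M] [Module C M]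

instance (U : Opens (RPoint C)) : Algebra C (specSections C U) :=
  ((toSections C U).toAlgHom : C →+* specSections C U).toAlgebra

/-- Restriction of sections as a `C`-linear map. -/
def specResₗ {U V : Opens (RPoint C)} (h : V ≤ U) :
    specSections C U →ₗ[C] specSections C V where
  toFun := specRes h
  map_add' := map_add (specRes h).toAlgHom
  map_smul' c s := by
    rw [Algebra.smul_def, Algebra.smul_def]
    exact map_mul (specRes h).toAlgHom _ _

/-- The restriction map `O(U) ⊗_C M → O(V) ⊗_C M`. -/
def mspecRes {U V : Opens (RPoint C)} (h : V ≤ U) :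
    specSections C U ⊗[C] M →ₗ[C] specSections C V ⊗[C] M := LinearMap.rTensor M (specResₗ C h)

variable {C M} in
theorem mspecRes_smul {U V : Opens (RPoint C)} (h : V ≤ U) (r : specSections C U)
    (m : specSections C U ⊗[C] M) : mspecRes C M h (r • m) = specRes h r • mspecRes C M h m := by
  induction m using TensorProduct.induction_on with
  | zero => rw [smul_zero, map_zero, smul_zero]
  | add m m' hm hm' => rw [smul_add, map_add, map_add, smul_add, hm, hm']
  | tmul s m => exact congrArg (· ⊗ₜ[C] m) (map_mul (specRes h).toAlgHom r s)

/-- The presheaf `U ↦ O(U) ⊗_C M` on `Spec C`. -/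
def mspecPre : PreMod (Spec C) where
  M := fun U : Opens (RPoint C) => specSections C U ⊗[C] M
  grp := fun U : Opens (RPoint C) => inferInstanceAs (AddCommGroup (specSections C U ⊗[C] M))
  mod := fun U : Opens (RPoint C) =>
    inferInstanceAs (Module (specSections C U) (specSections C U ⊗[C] M))
  res := fun {U V : Opens (RPoint C)} h => (mspecRes C M h).toAddMonoidHom
  res_smul h r m := mspecRes_smul h r m
  res_self m := by
    induction m using TensorProduct.induction_on with
    | zero => exact map_zero _
    | add m m' hm hm' => exact (map_add _ m m').trans (congrArg₂ (· + ·) hm hm')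
    | tmul s m => rfl
  res_res := fun {U V W : Opens (RPoint C)} h h' m => by
    change mspecRes C M h' (mspecRes C M h m) = mspecRes C M (h'.trans h) m
    induction m using TensorProduct.induction_on with
    | zero => simp only [map_zero]
    | add m m' hm hm' => rw [map_add, map_add, map_add, hm, hm']
    | tmul s m => rfl

/-- The sheaf of modules `MSpec M` on `Spec C`, the sheafification of `U ↦ O(U) ⊗_C M`. -/
def MSpec : PreMod (Spec C) := (mspecPre C M).sheafify

end MSpec

section MSpecOf

variable {C : Type u} [CInfRing C] {M : Type u} [AddCommGroup M] [Module C M]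

/-- The section of `MSpec M` over `U` given by `1 ⊗ m`. -/
def MSpec.of (U : Opens (RPoint C)) (m : M) : (MSpec C M).M U :=
  (mspecPre C M).toSheafify U ((1 : specSections C U) ⊗ₜ[C] m : specSections C U ⊗[C] M)

end MSpecOf

section TensorVec

variable (X : CSpace.{u}) (W : Type) [AddCommGroup W] [Module ℝ W]

/-- The restriction map `O(U) ⊗_ℝ W → O(V) ⊗_ℝ W`. -/
def tensorRes {U V : Opens X.carrier} (h : V ≤ U) : X.O U ⊗[ℝ] W →ₗ[ℝ] X.O V ⊗[ℝ] W :=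
  LinearMap.rTensor W (X.res h).toLinearMap

/-- The module `O_X ⊗_ℝ W` for a finite-dimensional real vector space `W`, with sections
`O_X(U) ⊗_ℝ W`. -/
def tensorVec : PreMod X where
  M U := X.O U ⊗[ℝ] W
  grp U := inferInstanceAs (AddCommGroup (X.O U ⊗[ℝ] W))
  mod U := inferInstanceAs (Module (X.O U) (X.O U ⊗[ℝ] W))
  res h := (tensorRes X W h).toAddMonoidHom
  res_smul {U V} h r m := by
    change tensorRes X W h (r • m) = X.res h r • tensorRes X W h m
    induction m using TensorProduct.induction_on with
    | zero => rw [smul_zero, map_zero, smul_zero]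
    | add m m' hm hm' => rw [smul_add, map_add, map_add, smul_add, hm, hm']
    | tmul s m => exact congrArg (· ⊗ₜ[ℝ] m) (map_mul (X.res h).toAlgHom r s)
  res_self {U} m := by
    change tensorRes X W le_rfl m = m
    induction m using TensorProduct.induction_on with
    | zero => exact map_zero _
    | add m m' hm hm' => rw [map_add, hm, hm']
    | tmul s m => exact congrArg (· ⊗ₜ[ℝ] m) (X.res_self s)
  res_res {U V V'} h h' m := by
    change tensorRes X W h' (tensorRes X W h m) = tensorRes X W (h'.trans h) m
    induction m using TensorProduct.induction_on with
    | zero => simp only [map_zero]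
    | add m m' hm hm' => rw [map_add, map_add, map_add, hm, hm']
    | tmul s m => exact congrArg (· ⊗ₜ[ℝ] m) (X.res_res h h' s)

variable {X W} in
/-- The section `1 ⊗ w` of `O_X ⊗_ℝ W` over `U`. -/
def tensorVec.of (U : Opens X.carrier) (w : W) : (tensorVec X W).M U :=
  ((1 : X.O U) ⊗ₜ[ℝ] w : X.O U ⊗[ℝ] W)

end TensorVec

/-- A coherent sheaf: `X` is covered by open `U` with `(U, O_X|_U) ≅ Spec C`, identifying `E|_U`
with `MSpec M` for a finitely presented `C`-module `M`. -/
def IsCoherent {X : CSpace.{u}} (E : PreMod X) : Prop :=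
  E.IsSheaf ∧ ∀ x : X.carrier, ∃ U : Opens X.carrier, x ∈ U ∧
    ∃ (C : Type u) (_ : CInfRing C) (i : CSpace.Iso (X.restrict U) (Spec C))
      (M : Type u) (_ : AddCommGroup M) (_ : Module C M),
      Module.FinitePresentation C M ∧ Nonempty (PreMod.IsoOver i (E.restrict U) (MSpec C M))

/-- A vector bundle of rank `n`: a sheaf of modules locally isomorphic to `O_X ⊗_ℝ ℝⁿ`. -/
def IsVectorBundle {X : CSpace.{u}} (n : ℕ) (E : PreMod X) : Prop :=
  E.IsSheaf ∧ ∀ x : X.carrier, ∃ U : Opens X.carrier, x ∈ U ∧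
    Nonempty (PreMod.Iso (E.restrict U) (tensorVec (X.restrict U) (Fin n → ℝ)))

/-! ### Classes of `C^∞`-rings and `C^∞`-schemes -/

/-- `C` is generated by finitely many elements under the operations `Φ_f`. -/
def IsFG (C : Type u) [CInfRing C] : Prop :=
  ∃ (n : ℕ) (c : Fin n → C), ∀ a : C, ∃ f : SmoothFn n, a = op f c

/-- A fair ideal of `C^∞(ℝⁿ)`: a function lies in `I` if its germ at each point lies in the ideal
of germs of `I`. -/
def IsFairIdeal {n : ℕ} (I : Ideal (SmoothFn n)) : Prop :=
  ∀ f : SmoothFn n, (∀ p : Fin n → ℝ, ∃ g ∈ I, f.1 =ᶠ[𝓝 p] g.1) → f ∈ I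

/-- A fair `C^∞`-ring: one isomorphic to `C^∞(ℝⁿ)/I` with `I` fair. -/
def IsFair (C : Type u) [CInfRing C] : Prop :=
  ∃ (n : ℕ) (φ : CInfHom (SmoothFn n) C), Function.Surjective φ ∧
    IsFairIdeal (RingHom.ker φ.toAlgHom)

/-- A good ideal of `C^∞(ℝⁿ)`: one generated by finitely many functions and the ideal of all
functions that vanish to infinite order at each point of some closed set `Z`. -/
def IsGoodIdeal {n : ℕ} (I : Ideal (SmoothFn n)) : Prop :=
  ∃ (S : Finset (SmoothFn n)) (Z : Set (Fin n → ℝ)), IsClosed Z ∧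
    I = Ideal.span (↑S ∪ {g : SmoothFn n | ∀ z ∈ Z, ∀ k : ℕ, iteratedFDeriv ℝ k g.1 z = 0})

/-- A good `C^∞`-ring: one isomorphic to `C^∞(ℝⁿ)/I` with `I` good. -/
def IsGood (C : Type u) [CInfRing C] : Prop :=
  ∃ (n : ℕ) (φ : CInfHom (SmoothFn n) C), Function.Surjective φ ∧
    IsGoodIdeal (RingHom.ker φ.toAlgHom)

/-- A fair affine `C^∞`-scheme. -/
def IsFairAffine (X : CSpace.{u}) : Prop :=
  ∃ (C : Type u) (_ : CInfRing C), IsFair C ∧ Nonempty (CSpace.Iso X (Spec C))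

/-- A locally good `C^∞`-scheme. -/
def IsLocallyGood (X : CSpace.{u}) : Prop :=
  ∀ x : X.carrier, ∃ U : Opens X.carrier, x ∈ U ∧
    ∃ (C : Type u) (_ : CInfRing C), IsGood C ∧ Nonempty (CSpace.Iso (X.restrict U) (Spec C))

/-! ### Manifolds with corners -/

section Manifold

variable {E : Type} [NormedAddCommGroup E] [NormedSpace ℝ E] {H : Type} [TopologicalSpace H]
  (I : ModelWithCorners ℝ E H) (X : Type u) [TopologicalSpace X] [ChartedSpace H X]

/-- The algebra `C^∞(X)` of smooth functions on a manifold. -/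
def manFn : Subalgebra ℝ (X → ℝ) where
  carrier := {f | ContMDiff I 𝓘(ℝ, ℝ) ∞ f}
  mul_mem' hf hg := by
    rw [Set.mem_ofPred_eq] at *
    exact hf.mul hg
  add_mem' hf hg := by
    rw [Set.mem_ofPred_eq] at *
    exact hf.add hg
  algebraMap_mem' r := by
    rw [Set.mem_ofPred_eq]
    exact contMDiff_const (c := r)

variable {I X} in
theorem mem_manFn {f : X → ℝ} : f ∈ manFn I X ↔ ContMDiff I 𝓘(ℝ, ℝ) ∞ f :=
  Iff.of_eq Set.mem_ofPred_eq

/-- The `C^∞`-ring `C^∞(X)`. -/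
instance : CInfRing (manFn I X) :=
  CInfRing.ofSubalgebra _ fun f _ h => mem_manFn.2 <|
    f.smooth.contMDiff.comp (contMDiff_pi_space.2 fun i => mem_manFn.1 (h i))

variable {X} in
/-- Restriction of smooth functions to a smaller open set. -/
def manRes {U V : Opens X} (h : V ≤ U) : CInfHom (manFn I U) (manFn I V) where
  toFun f := ⟨fun x => f.1 ⟨x.1, h x.2⟩,
    mem_manFn.2 ((mem_manFn.1 f.2).comp (contMDiff_inclusion h))⟩
  map_one' := rfl
  map_mul' _ _ := rfl
  map_zero' := rfl
  map_add' _ _ := rfl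
  commutes' _ := rfl
  map_op' _ _ := rfl

/-- A manifold as a `C^∞`-ringed space, with `O(U) = C^∞(U)`. -/
def manSpace : CSpace.{u} where
  carrier := X
  O U := manFn I U
  res := manRes I
  res_self _ := rfl
  res_res _ _ _ := rfl
  locality V hV h s t hst := by
    refine Subtype.ext (funext fun x => ?_)
    obtain ⟨i, hi⟩ := Opens.mem_iSup.1 (h x.2)
    exact congrFun (congrArg Subtype.val (hst i)) ⟨x.1, hi⟩
  gluing {ι U} V hV h s hs := by
    have hcov : ∀ x : U, ∃ i, x.1 ∈ V i := fun x => Opens.mem_iSup.1 (h x.2)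
    choose i hi using hcov
    have key : ∀ (x : U) (j : ι) (hj : x.1 ∈ V j),
        (s (i x)).1 ⟨x.1, hi x⟩ = (s j).1 ⟨x.1, hj⟩ := fun x j hj =>
      congrFun (congrArg Subtype.val (hs (i x) j)) ⟨x.1, hi x, hj⟩
    refine ⟨⟨fun x => (s (i x)).1 ⟨x.1, hi x⟩, mem_manFn.2 fun x => ?_⟩, fun j => ?_⟩
    · refine ((contDiffWithinAt_localInvariantProp (I := I) (I' := 𝓘(ℝ, ℝ))
        ∞).liftPropAt_iff_comp_inclusion (hV (i x)) _ ⟨x.1, hi x⟩).2 ?_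
      have := mem_manFn.1 (s (i x)).2 ⟨x.1, hi x⟩
      have he : (fun y : U => (s (i y)).1 ⟨y.1, hi y⟩) ∘ Set.inclusion (hV (i x)) =
          (s (i x)).1 := funext fun y => key ⟨y.1, hV _ y.2⟩ (i x) y.2
      rw [he]
      exact this
    · exact Subtype.ext (funext fun x => key ⟨x.1, hV j x.2⟩ j x.2)

/-- Restriction of a smooth function on `X` to an open set. -/
def manFn.restrict {X : Type u} [TopologicalSpace X] [ChartedSpace H X] (f : manFn I X)
    (U : Opens X) : manFn I U :=
  ⟨fun x => f.1 x.1, mem_manFn.2 ((mem_manFn.1 f.2).comp contMDiff_subtype_val)⟩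

/-- Evaluation at a point of `X`, as an `ℝ`-point of `C^∞(X)`. -/
def manEval (x : X) : RPoint (manFn I X) :=
  { toFun := fun f => f.1 x
    map_one' := rfl
    map_mul' := fun _ _ => rfl
    map_zero' := rfl
    map_add' := fun _ _ => rfl
    commutes' := fun _ => rfl
    map_op' := fun _ _ => rfl : CInfHom (manFn I X) ℝ }

/-- The `C^∞`-scheme associated to a manifold `X`, the spectrum of `C^∞(X)`. -/
def manSpec : CSpace.{u} := Spec (manFn I X)

variable [IsManifold I ∞ X]

/-- The fibre `T_x^*X` of the cotangent bundle. -/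
abbrev CotFibre (x : X) : Type := TangentSpace I x →L[ℝ] Bundle.Trivial X ℝ x

variable {X}

/-- A family of cotangent vectors, as a map to the total space of the cotangent bundle. -/
def cotTotal {U : Opens X} (s : ∀ x : U, CotFibre I X x.1) (x : U) :
    Bundle.TotalSpace (E →L[ℝ] ℝ) (CotFibre I X) := ⟨x.1, s x⟩

variable {I} in
theorem contMDiff_cotTotal {U : Opens X} {s : ∀ x : U, CotFibre I X x.1} :
    ContMDiff I (I.prod 𝓘(ℝ, E →L[ℝ] ℝ)) ∞ (cotTotal I s) ↔
      ∀ x₀ : U, ContMDiffAt I 𝓘(ℝ, E →L[ℝ] ℝ) ∞ (fun x : U =>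
        (trivializationAt (E →L[ℝ] ℝ) (CotFibre I X) x₀.1 ⟨x.1, s x⟩).2) x₀ := by
  refine forall_congr' fun x₀ => ?_
  rw [Bundle.contMDiffAt_totalSpace]
  exact and_iff_right contMDiff_subtype_val.contMDiffAt

theorem eventually_cot_triv {U : Opens X} (x₀ : U) : ∀ᶠ x : U in 𝓝 x₀,
    x.1 ∈ (trivializationAt (E →L[ℝ] ℝ) (CotFibre I X) x₀.1).baseSet :=
  continuous_subtype_val.continuousAt.eventually <|
    (trivializationAt (E →L[ℝ] ℝ) (CotFibre I X) x₀.1).open_baseSet.mem_nhds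
      (FiberBundle.mem_baseSet_trivializationAt' x₀.1)

/-- The space `C^∞(T^*X|_U)` of smooth sections of the cotangent bundle over `U`. -/
def cotSections (U : Opens X) : Submodule (manFn I U) (∀ x : U, CotFibre I X x.1) where
  carrier := {s | ContMDiff I (I.prod 𝓘(ℝ, E →L[ℝ] ℝ)) ∞ (cotTotal I s)}
  zero_mem' := by
    rw [Set.mem_ofPred_eq, contMDiff_cotTotal]
    intro x₀
    refine (contMDiffAt_const (c := (0 : E →L[ℝ] ℝ))).congr_of_eventuallyEq ?_
    filter_upwards [eventually_cot_triv I x₀] with x hx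
    exact ((trivializationAt (E →L[ℝ] ℝ) (CotFibre I X) x₀.1).linear ℝ hx).map_zero
  add_mem' {a b} ha hb := by
    rw [Set.mem_ofPred_eq, contMDiff_cotTotal] at *
    intro x₀
    refine ((ha x₀).add (hb x₀)).congr_of_eventuallyEq ?_
    filter_upwards [eventually_cot_triv I x₀] with x hx
    exact ((trivializationAt (E →L[ℝ] ℝ) (CotFibre I X) x₀.1).linear ℝ hx).map_add _ _
  smul_mem' r a ha := by
    rw [Set.mem_ofPred_eq, contMDiff_cotTotal] at *
    intro x₀
    refine ((mem_manFn.1 r.2 x₀).smul (ha x₀)).congr_of_eventuallyEq ?_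
    filter_upwards [eventually_cot_triv I x₀] with x hx
    exact ((trivializationAt (E →L[ℝ] ℝ) (CotFibre I X) x₀.1).linear ℝ hx).map_smul _ _

variable {I} in
theorem mem_cotSections {U : Opens X} {s : ∀ x : U, CotFibre I X x.1} : s ∈ cotSections I U ↔
    ContMDiff I (I.prod 𝓘(ℝ, E →L[ℝ] ℝ)) ∞ (cotTotal I s) := Iff.of_eq Set.mem_ofPred_eq

variable (X)

/-- The sheaf `U ↦ C^∞(T^*X|_U)` on a manifold. -/
def manCot : PreMod (manSpace I X) where
  M := fun U : Opens X => cotSections I U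
  grp := fun U : Opens X => inferInstanceAs (AddCommGroup (cotSections I U))
  mod := fun U : Opens X => inferInstanceAs (Module (manFn I U) (cotSections I U))
  res := fun {U V : Opens X} h =>
    { toFun := fun s : cotSections I U => (⟨fun x => s.1 ⟨x.1, h x.2⟩,
        mem_cotSections.2 ((mem_cotSections.1 s.2).comp (contMDiff_inclusion h))⟩ :
          cotSections I V)
      map_zero' := rfl
      map_add' := fun _ _ => rfl }
  res_smul _ _ _ := rfl
  res_self _ := rfl
  res_res _ _ _ := rfl

variable {I X} in
/-- The value at `x` of a section of the cotangent bundle. -/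
def manCot.val {U : Opens X} (s : (manCot I X).M U) (x : U) : TangentSpace I x.1 →L[ℝ] ℝ :=
  (show cotSections I U from s).1 x

end Manifold

/-! ### The local models `ℝⁿ_k` -/

section Rnk

/-- `ℝⁿ_k = [0, ∞)^k × ℝ^{n-k}`. -/
abbrev Rnk (n k : ℕ) : Type := {x : EuclideanSpace ℝ (Fin n) // ∀ i : Fin n, i.val < k → 0 ≤ x i}

variable (n k : ℕ)

theorem Rnk.range_val : Set.range (Subtype.val : Rnk n k → EuclideanSpace ℝ (Fin n)) =
    {x | ∀ i : Fin n, i.val < k → 0 ≤ x i} := Subtype.range_val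

/-- The model with corners on `ℝⁿ_k` given by the inclusion into `ℝⁿ`. -/
def modelRnk : ModelWithCorners ℝ (EuclideanSpace ℝ (Fin n)) (Rnk n k) where
  toFun := Subtype.val
  invFun x := ⟨WithLp.toLp 2 fun i => if i.val < k then max (x i) 0 else x i, fun i hi => by
    simp [hi]⟩
  source := Set.univ
  target := {x | ∀ i : Fin n, i.val < k → 0 ≤ x i}
  map_source' x _ := x.property
  map_target' _ _ := Set.mem_univ _
  left_inv' x _ := by
    refine Subtype.ext (PiLp.ext fun i => ?_)
    by_cases hi : i.val < k
    · simp [hi, x.2 i hi]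
    · simp [hi]
  right_inv' x hx := by
    rw [Set.mem_ofPred_eq] at hx
    refine PiLp.ext fun i => ?_
    by_cases hi : i.val < k
    · simp [hi, hx i hi]
    · simp [hi]
  source_eq := rfl
  convex_range' := by
    simp only [instIsRCLikeNormedField, ↓reduceDIte]
    apply Convex.convex_isRCLikeNormedField
    rw [Rnk.range_val]
    intro x hx y hy a b ha hb _
    rw [Set.mem_ofPred_eq] at *
    intro i hi
    have := hx i hi
    have := hy i hi
    simp only [PiLp.add_apply, PiLp.smul_apply, smul_eq_mul]
    positivity
  nonempty_interior' := by
    rw [Rnk.range_val]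
    have ho : IsOpen {x : EuclideanSpace ℝ (Fin n) | ∀ i : Fin n, 0 < x i} := by
      simp only [Set.ofPred_forall]
      exact isOpen_iInter_of_finite fun i => isOpen_lt continuous_const (by fun_prop)
    refine ⟨WithLp.toLp 2 fun _ => 1, mem_interior.2 ⟨_, fun x hx => ?_, ho, ?_⟩⟩
    · rw [Set.mem_ofPred_eq] at *
      exact fun i _ => (hx i).le
    · rw [Set.mem_ofPred_eq]
      simp
  continuous_toFun := continuous_subtype_val
  continuous_invFun := by
    refine Continuous.subtype_mk ((PiLp.continuous_toLp 2 _).comp (continuous_pi fun i => ?_)) _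
    by_cases hi : i.val < k
    · simp only [hi, if_true]
      fun_prop
    · simp only [hi, if_false]
      fun_prop

variable {n k} in
/-- The restriction to `ℝⁿ_k` of a linear form on `ℝⁿ`. -/
def linearFn (l : EuclideanSpace ℝ (Fin n) →L[ℝ] ℝ) : manFn (modelRnk n k) (Rnk n k) :=
  ⟨fun x => l x.1, mem_manFn.2 (l.contDiff.contMDiff.comp (modelRnk n k).contMDiff)⟩

end Rnk

end CInf

end

/-! The comparisons of sheaves rest on one principle: a morphism from a presheaf to a sheaf that is
locally injective and locally surjective identifies the target with the sheafification
(`LocBij.isoSheafify`). What remains is to compute with differentials near a point.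

Spectra. The maps O(U) ⊗ Ω_C → Ω_{O(U)}, s ⊗ dc ↦ s dc, are locally surjective because sections of O
come locally from C. For local injectivity there is a derivation from O(U) to sections of MSpec Ω_C,
sending s at x to the germ of 1 ⊗ dc for any c with class s(x) in the localization. It is well
defined: if a d = 0 with d invertible near x, then Leibniz gives d · da = -a · dd, and a vanishes
near x. The linear map it induces on Ω_{O(U)} inverts the tensor map up to sheafification
(`lift_sectionDifferential`).

The presheaf is already a sheaf. Let c₁, …, c_n generate C. Then Spec C has the topology induced
from ℝⁿ, and partitions of unity represent every section over U by a function G that is smooth near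
the image of U. The crux is the chain rule ds = ∑ (∂ᵢG) dcᵢ in Ω_{O(U)} itself, although G is smooth
only on an open set Ω. If χ is smooth with nonvanishing locus Ω, then t χ(p) = 1 embeds Ω as a
closed submanifold of ℝⁿ⁺¹, and G becomes the restriction of a global smooth function in p and t =
1/χ(p) (`IsGradient.d_eq`). Hence the dcᵢ generate Ω_{O(U)}, and ∑ vᵢ dcᵢ = 0 exactly when v is the
gradient of a function representing 0 (`sum_smul_cotPre_d_eq_zero_iff`). Such functions can be
patched with a partition of unity, since derivatives of the partition multiply functions
representing 0; this is locality. Patching coefficients gives gluing.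

Coherence. For C = C^∞(ℝⁿ)/I the relations among the dxᵢ are the gradients of elements of I. Modulo
I the gradient is linear on I, so generators of I suffice, and functions flat along Z contribute
nothing because their partial derivatives are flat too. So Ω_C is finitely presented for good C
(`IsGood.finitePresentation_omega`).

Manifolds. Every ℝ-point of C^∞(X) is an evaluation (`manEval_surjective`), and localizations at
points are rings of germs, so Spec C^∞(X) is X with its smooth functions. In a chart to ℝⁿ_k a
smooth function is locally F(t₁, …, t_n) with F smooth on all of ℝⁿ, by Seeley's extension across
the walls of the quadrant (`IsTestOn.exists_contDiff_extension`). Therefore the dtᵢ generate the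
cotangent modules locally; as they are also a pointwise basis of the cotangent spaces, the map from
the cotangent presheaf to one-forms is locally bijective, and coordinate differentials give local
frames. -/

noncomputable section
namespace CInf
open CInfRing
open TopologicalSpace (Opens)

/-! ### Morphisms of presheaves of modules over an isomorphism of spaces -/

namespace PreMod

variable {X Y : CSpace.{u}}

/-- A morphism from a presheaf `F` of modules on `Y` to a presheaf `E` of modules on `X`, over an
isomorphism `i : X ≅ Y`. -/
structure HomOver (i : CSpace.Iso X Y) (E : PreMod X) (F : PreMod Y) where
  app : ∀ V : Opens Y.carrier, F.M V →+ E.M (preimageOpens i.base V)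
  app_smul : ∀ {V : Opens Y.carrier} (r : Y.O V) (m : F.M V),
    app V (r • m) = i.sec V r • app V m
  app_res : ∀ {V W : Opens Y.carrier} (h : W ≤ V) (m : F.M V),
    app W (F.res h m) = E.res (preimageOpens_mono i.base h) (app V m)

/-- Two sections of a sheaf that agree near every point are equal. -/
theorem IsSheaf.eq_of_local {E : PreMod X} (hE : E.IsSheaf) {U : Opens X.carrier} (s t : E.M U)
    (h : ∀ x ∈ U, ∃ (V : Opens X.carrier) (hV : V ≤ U), x ∈ V ∧ E.res hV s = E.res hV t) :
    s = t := by
  choose V hV hx hst using fun x : U => h x.1 x.2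
  exact hE.locality V hV (fun x hx' => Opens.mem_iSup.2 ⟨⟨x, hx'⟩, hx _⟩) s t hst

theorem IsSheaf.restrict {E : PreMod X} (hE : E.IsSheaf) (U : Opens X.carrier) :
    (E.restrict U).IsSheaf where
  locality V hV h s t hst :=
    hE.locality (fun i => imageOpens (V i)) (fun i => imageOpens_mono (hV i))
      (imageOpens_iSup h) s t hst
  gluing V hV h s hs :=
    hE.gluing (fun i => imageOpens (V i)) (fun i => imageOpens_mono (hV i))
      (imageOpens_iSup h) s fun i j => by
        have := congrArg (E.res (imageOpens_inf (V i) (V j))) (hs i j)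
        exact (E.res_res _ _ _).symm.trans (this.trans (E.res_res _ _ _))

theorem toSheafify_eq_iff (E : PreMod X) {U : Opens X.carrier} (m m' : E.M U) :
    E.toSheafify U m = E.toSheafify U m' ↔
      ∀ x ∈ U, ∃ (V : Opens X.carrier) (hV : V ≤ U), x ∈ V ∧ E.res hV m = E.res hV m' := by
  constructor
  · intro h x hx
    obtain ⟨W, hU, _, hxW, hW⟩ := E.germ_eq (congrFun (congrArg Subtype.val h) ⟨x, hx⟩)
    exact ⟨W, hU, hxW, hW⟩
  · intro h
    refine Subtype.ext (funext fun x => ?_)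
    obtain ⟨V, hV, hx, hm⟩ := h x.1 x.2
    change E.germ x.2 m = E.germ x.2 m'
    rw [← E.germ_res hV hx, hm, E.germ_res]

/-- Sections of the sheafification are locally sections of the presheaf. -/
theorem exists_toSheafify (E : PreMod X) {U : Opens X.carrier} (s : E.sheafify.M U)
    {x : X.carrier} (hx : x ∈ U) : ∃ (V : Opens X.carrier) (hV : V ≤ U) (m : E.M V), x ∈ V ∧
      E.sheafify.res hV s = E.toSheafify V m := by
  obtain ⟨V, hV, m, hxV, H⟩ := E.mem_sheafSections.1 (Subtype.property s) ⟨x, hx⟩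
  exact ⟨V, hV, m, hxV, Subtype.ext (funext fun y => H y.1 y.2)⟩

/-- Sections with equal germs agree locally, so locality gives injectivity. Local preimages of a
section of the sheafification then agree on overlaps and glue. -/
theorem IsSheaf.toSheafify_bijective {E : PreMod X} (hE : E.IsSheaf) (U : Opens X.carrier) :
    Function.Bijective (E.toSheafify U) := by
  refine ⟨fun m m' h => hE.eq_of_local _ _ ((E.toSheafify_eq_iff m m').1 h), fun s => ?_⟩
  choose V hV m hxV hm using fun x : U => E.exists_toSheafify s x.2
  have hcov : U ≤ iSup V := fun x hx' => Opens.mem_iSup.2 ⟨⟨x, hx'⟩, hxV _⟩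
  obtain ⟨t, ht⟩ := hE.gluing V hV hcov m fun x y => hE.eq_of_local _ _ <|
    (E.toSheafify_eq_iff _ _).1 <| by
      rw [toSheafify_res, toSheafify_res, ← hm, ← hm]
      rfl
  refine ⟨t, E.sheafify_isSheaf.locality V hV hcov _ _ fun x => ?_⟩
  rw [← toSheafify_res, ht, hm]

namespace HomOver

variable {i : CSpace.Iso X Y} {E : PreMod X} {F : PreMod Y} (α : HomOver i E F)

/-- Every open set of `X` is the preimage of an open set of `Y`. -/
theorem _root_.CInf.exists_preimageOpens {X Y : Type u} [TopologicalSpace X] [TopologicalSpace Y]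
    (e : X ≃ₜ Y) (U : Opens X) : ∃ V : Opens Y, U = preimageOpens e V :=
  ⟨preimageOpens e.symm U, by ext x; simp [preimageOpens]⟩

theorem _root_.CInf.preimageOpens_le_iff {X Y : Type u} [TopologicalSpace X] [TopologicalSpace Y]
    (e : X ≃ₜ Y) {V W : Opens Y} : preimageOpens e V ≤ preimageOpens e W ↔ V ≤ W := by
  refine ⟨fun h y hy => ?_, preimageOpens_mono e⟩
  have := @h (e.symm y) (by change e (e.symm y) ∈ V; simpa using hy)
  change e (e.symm y) ∈ W at this
  simpa using this

theorem _root_.CInf.preimageOpens_le_iSup {X Y : Type u} [TopologicalSpace X] [TopologicalSpace Y]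
    (e : X ≃ₜ Y) {ι : Type*} {U : Opens Y} {V : ι → Opens Y} (h : U ≤ iSup V) :
    preimageOpens e U ≤ ⨆ j, preimageOpens e (V j) := fun x hx => by
  obtain ⟨j, hj⟩ := Opens.mem_iSup.1 (h hx)
  exact Opens.mem_iSup.2 ⟨j, hj⟩

/-- A morphism of presheaves is locally bijective if it is locally injective and locally
surjective. -/
structure LocBij : Prop where
  inj : ∀ {V : Opens Y.carrier} (m : F.M V), α.app V m = 0 → ∀ y ∈ V,
    ∃ (W : Opens Y.carrier) (h : W ≤ V), y ∈ W ∧ F.res h m = 0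
  surj : ∀ {V : Opens Y.carrier} (e : E.M (preimageOpens i.base V)), ∀ y ∈ V,
    ∃ (W : Opens Y.carrier) (h : W ≤ V) (m : F.M W), y ∈ W ∧
      α.app W m = E.res (preimageOpens_mono i.base h) e

variable {α}

/-- Between sheaves, local injectivity upgrades to injectivity over every open set. Injectivity on
the overlaps is what makes local preimages compatible. -/
theorem LocBij.bijective (h : α.LocBij) (hE : E.IsSheaf) (hF : F.IsSheaf) (V : Opens Y.carrier) :
    Function.Bijective (α.app V) := by
  have inj : ∀ V, Function.Injective (α.app V) := fun V =>
    (injective_iff_map_eq_zero _).2 fun m hm => hF.eq_of_local _ _ fun y hy => by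
      obtain ⟨W, hW, hy, h0⟩ := h.inj m hm y hy
      exact ⟨W, hW, hy, by rw [h0, map_zero]⟩
  refine ⟨inj V, fun e => ?_⟩
  choose W hW m hyW hm using fun y : V => h.surj e y.1 y.2
  have hcov : V ≤ iSup W := fun x hx' => Opens.mem_iSup.2 ⟨⟨x, hx'⟩, hyW _⟩
  obtain ⟨t, ht⟩ := hF.gluing W hW hcov m fun x y => inj _ <| by
    rw [α.app_res, α.app_res, hm, hm]
    exact (E.res_res _ _ _).trans (E.res_res _ _ _).symm
  refine ⟨t, hE.locality (fun y => preimageOpens i.base (W y))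
    (fun y => preimageOpens_mono _ (hW y)) (preimageOpens_le_iSup _ hcov) _ _ fun y => ?_⟩
  rw [← α.app_res (hW y), ht, hm]

variable (α)

/-- Since the target is separated, the morphism sees only germs; this is why it factors through the
sheafification. -/
theorem app_eq_of_toSheafify_eq (hE : E.IsSheaf) {V : Opens Y.carrier} {m m' : F.M V}
    (h : F.toSheafify V m = F.toSheafify V m') : α.app V m = α.app V m' :=
  hE.eq_of_local _ _ fun x hx => by
    obtain ⟨W, hW, hxW, hm⟩ := (F.toSheafify_eq_iff m m').1 h (i.base x) hx
    exact ⟨preimageOpens i.base W, preimageOpens_mono _ hW, hxW, by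
      rw [← α.app_res hW, ← α.app_res hW, hm]⟩

/-- The images of local representatives of `s` glue. The conclusion quantifies over all local
representatives, not only the chosen ones, so that later arguments are free of choices. -/
theorem exists_extension (hE : E.IsSheaf) {V : Opens Y.carrier} (s : F.sheafify.M V) :
    ∃ e : E.M (preimageOpens i.base V), ∀ (W : Opens Y.carrier) (h : W ≤ V) (m : F.M W),
      F.sheafify.res h s = F.toSheafify W m →
        E.res (preimageOpens_mono i.base h) e = α.app W m := by
  choose W hW m hyW hm using fun y : V => F.exists_toSheafify s y.2
  have hcov : V ≤ iSup W := fun x hx' => Opens.mem_iSup.2 ⟨⟨x, hx'⟩, hyW _⟩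
  have key : ∀ {W₁ W₂ W₃ : Opens Y.carrier} (h₁ : W₁ ≤ V) (h₂ : W₂ ≤ V) (h₃₁ : W₃ ≤ W₁)
      (h₃₂ : W₃ ≤ W₂) (m₁ : F.M W₁) (m₂ : F.M W₂), F.sheafify.res h₁ s = F.toSheafify W₁ m₁ →
      F.sheafify.res h₂ s = F.toSheafify W₂ m₂ →
      E.res (preimageOpens_mono i.base h₃₁) (α.app W₁ m₁) =
        E.res (preimageOpens_mono i.base h₃₂) (α.app W₂ m₂) := by
    intro W₁ W₂ W₃ h₁ h₂ h₃₁ h₃₂ m₁ m₂ e₁ e₂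
    rw [← α.app_res h₃₁, ← α.app_res h₃₂]
    refine α.app_eq_of_toSheafify_eq hE ?_
    rw [toSheafify_res, toSheafify_res, ← e₁, ← e₂]
    rfl
  have hpre := preimageOpens_le_iSup i.base hcov
  obtain ⟨e, he⟩ := hE.gluing (fun y => preimageOpens i.base (W y))
    (fun y => preimageOpens_mono _ (hW y)) hpre (fun y => α.app _ (m y))
    fun x y => key (hW x) (hW y) inf_le_left inf_le_right _ _ (hm x) (hm y)
  refine ⟨e, fun W' h' m' hm' => hE.eq_of_local _ _ fun x hx => ?_⟩
  have hxV : i.base x ∈ V := h' hx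
  refine ⟨preimageOpens i.base (W' ⊓ W ⟨_, hxV⟩), preimageOpens_mono _ inf_le_left,
    ⟨hx, hyW ⟨_, hxV⟩⟩, ?_⟩
  rw [key h' (hW ⟨_, hxV⟩) inf_le_left inf_le_right m' _ hm' (hm ⟨_, hxV⟩), ← he, E.res_res,
    E.res_res]

/-- The value of the extension of a morphism to the sheafification. -/
def extendFun (hE : E.IsSheaf) {V : Opens Y.carrier} (s : F.sheafify.M V) :
    E.M (preimageOpens i.base V) := (α.exists_extension hE s).choose

theorem res_extendFun (hE : E.IsSheaf) {V W : Opens Y.carrier} (s : F.sheafify.M V) (h : W ≤ V)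
    (m : F.M W) (hm : F.sheafify.res h s = F.toSheafify W m) :
    E.res (preimageOpens_mono i.base h) (α.extendFun hE s) = α.app W m :=
  (α.exists_extension hE s).choose_spec W h m hm

/-- A uniqueness criterion that is tested only on small neighbourhoods `W ≤ W₀`, so that
representatives of auxiliary sections are available there. -/
theorem eq_extendFun (hE : E.IsSheaf) {V : Opens Y.carrier} (s : F.sheafify.M V)
    (e : E.M (preimageOpens i.base V))
    (h : ∀ y ∈ V, ∃ W₀ : Opens Y.carrier, y ∈ W₀ ∧ ∀ (W : Opens Y.carrier) (h : W ≤ V)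
      (m : F.M W), W ≤ W₀ → F.sheafify.res h s = F.toSheafify W m →
        E.res (preimageOpens_mono i.base h) e = α.app W m) : α.extendFun hE s = e := by
  refine hE.eq_of_local _ _ fun x hx => ?_
  obtain ⟨W, hW, m, hxW, hm⟩ := F.exists_toSheafify s (x := i.base x) hx
  obtain ⟨W₀, hxW₀, H⟩ := h _ hx
  have hm' : F.sheafify.res (inf_le_left.trans hW : W ⊓ W₀ ≤ V) s =
      F.toSheafify (W ⊓ W₀) (F.res inf_le_left m) := by
    rw [toSheafify_res, ← hm]; rfl
  exact ⟨preimageOpens i.base (W ⊓ W₀), preimageOpens_mono _ (inf_le_left.trans hW), ⟨hxW, hxW₀⟩,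
    (α.res_extendFun hE s _ _ hm').trans (H _ _ _ inf_le_right hm').symm⟩

/-- The extension of a morphism into a sheaf to the sheafification. -/
def extend (hE : E.IsSheaf) : HomOver i E F.sheafify where
  app V := AddMonoidHom.mk' (α.extendFun hE) fun s t => by
    refine α.eq_extendFun hE _ _ fun y hy => ?_
    obtain ⟨W, hW, m, hxW, hm⟩ := F.exists_toSheafify s hy
    refine ⟨W, hxW, fun W' h' m' hW' hm' => ?_⟩
    have hs : F.sheafify.res h' s = F.toSheafify W' (F.res hW' m) := by
      rw [toSheafify_res, ← hm]; rfl
    -- With `m'` representing s + t and `m` representing s, the difference represents t; no separate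
    -- choice for t is needed.
    have ht : F.sheafify.res h' t = F.toSheafify W' (m' - F.res hW' m) := by
      rw [map_sub, ← hm', map_add, hs, add_sub_cancel_left]
    rw [map_add, α.res_extendFun hE s _ _ hs, α.res_extendFun hE t _ _ ht, ← map_add,
      add_sub_cancel]
  app_smul {V} r s := by
    refine α.eq_extendFun hE _ _ fun y hy => ?_
    obtain ⟨W, hW, m, hxW, hm⟩ := F.exists_toSheafify s hy
    refine ⟨W, hxW, fun W' h' m' hW' hm' => ?_⟩
    have hs : F.sheafify.res h' s = F.toSheafify W' (F.res hW' m) := by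
      rw [toSheafify_res, ← hm]; rfl
    change E.res _ (_ • α.extendFun hE s) = _
    rw [E.res_smul, α.res_extendFun hE s _ _ hs, ← i.sec_res, ← α.app_smul]
    refine α.app_eq_of_toSheafify_eq hE ?_
    rw [map_smul, ← hs, ← hm', F.sheafify.res_smul]
  app_res {V W} h s := by
    refine α.eq_extendFun hE _ _ fun y hy => ⟨W, hy, fun W' h' m' _ hm' => ?_⟩
    rw [E.res_res]
    exact α.res_extendFun hE s (h'.trans h) m' hm'

theorem extend_toSheafify (hE : E.IsSheaf) {V : Opens Y.carrier} (m : F.M V) :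
    (α.extend hE).app V (F.toSheafify V m) = α.app V m := by
  have := α.res_extendFun hE (F.toSheafify V m) le_rfl m rfl
  rwa [E.res_self] at this

variable {α}

theorem LocBij.extend (h : α.LocBij) (hE : E.IsSheaf) : (α.extend hE).LocBij where
  inj {V} s hs y hy := by
    obtain ⟨W, hW, m, hyW, hm⟩ := F.exists_toSheafify s hy
    have h0 : α.app W m = 0 := by
      rw [← α.extend_toSheafify hE, ← hm, app_res, hs, map_zero]
    obtain ⟨W', hW', hy', h0'⟩ := h.inj m h0 y hyW
    refine ⟨W', hW'.trans hW, hy', ?_⟩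
    rw [← F.sheafify.res_res hW hW', hm, ← toSheafify_res, h0', map_zero]
  surj {V} e y hy := by
    obtain ⟨W, hW, m, hyW, hm⟩ := h.surj e y hy
    exact ⟨W, hW, F.toSheafify W m, hyW, by rw [α.extend_toSheafify, hm]⟩

/-- A morphism all of whose components are bijective is an isomorphism. -/
def toIsoOver (α : HomOver i E F) (h : ∀ V, Function.Bijective (α.app V)) : IsoOver i E F where
  app V := AddEquiv.ofBijective (α.app V) (h V)
  app_smul := α.app_smul
  app_res := α.app_res

/-- A locally bijective morphism into a sheaf exhibits it as the sheafification. -/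
def LocBij.isoSheafify (h : α.LocBij) (hE : E.IsSheaf) : IsoOver i E F.sheafify :=
  (α.extend hE).toIsoOver ((h.extend hE).bijective hE F.sheafify_isSheaf)

theorem LocBij.isoSheafify_toSheafify (h : α.LocBij) (hE : E.IsSheaf) {V : Opens Y.carrier}
    (m : F.M V) : (h.isoSheafify hE).app V (F.toSheafify V m) = α.app V m :=
  α.extend_toSheafify hE m

end HomOver

theorem IsSheaf.of_isoOver {i : CSpace.Iso X Y} {E : PreMod X} {F : PreMod Y}
    (β : IsoOver i E F) (hF : F.IsSheaf) : E.IsSheaf where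
  locality {ι U} V hV hcov s t hst := by
    obtain ⟨U, rfl⟩ := exists_preimageOpens i.base U
    choose V' hV' using fun j => exists_preimageOpens i.base (V j)
    obtain rfl : V = fun j => preimageOpens i.base (V' j) := funext hV'
    have hle : ∀ j, V' j ≤ U := fun j => (preimageOpens_le_iff i.base).1 (hV j)
    obtain ⟨s, rfl⟩ := (β.app U).surjective s
    obtain ⟨t, rfl⟩ := (β.app U).surjective t
    refine congrArg _ (hF.locality V' hle (fun y hy => ?_) s t fun j => ?_)
    · have : i.base.symm y ∈ preimageOpens i.base U := by
        change i.base (i.base.symm y) ∈ U; simpa using hy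
      obtain ⟨j, hj⟩ := Opens.mem_iSup.1 (hcov this)
      change i.base (i.base.symm y) ∈ V' j at hj
      exact Opens.mem_iSup.2 ⟨j, by simpa using hj⟩
    · refine (β.app _).injective ?_
      rw [β.app_res, β.app_res]
      exact hst j
  gluing {ι U} V hV hcov s hs := by
    obtain ⟨U, rfl⟩ := exists_preimageOpens i.base U
    choose V' hV' using fun j => exists_preimageOpens i.base (V j)
    obtain rfl : V = fun j => preimageOpens i.base (V' j) := funext hV'
    have hle : ∀ j, V' j ≤ U := fun j => (preimageOpens_le_iff i.base).1 (hV j)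
    choose s' hs' using fun j => (β.app _).surjective (s j)
    obtain ⟨t, ht⟩ := hF.gluing V' hle (fun y hy => by
        have : i.base.symm y ∈ preimageOpens i.base U := by
          change i.base (i.base.symm y) ∈ U; simpa using hy
        obtain ⟨j, hj⟩ := Opens.mem_iSup.1 (hcov this)
        change i.base (i.base.symm y) ∈ V' j at hj
        exact Opens.mem_iSup.2 ⟨j, by simpa using hj⟩) s' fun j k => by
      refine (β.app _).injective ?_
      rw [β.app_res, β.app_res, hs', hs']
      exact hs j k
    refine ⟨β.app U t, fun j => ?_⟩
    rw [← β.app_res (hle j), ht, hs']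

/-- The identity of a space. -/
def _root_.CInf.CSpace.Iso.refl (X : CSpace.{u}) : CSpace.Iso X X where
  base := Homeomorph.refl _
  sec V := ({ AlgEquiv.refl with map_op' := fun _ _ => rfl } : CInfEquiv (X.O V) (X.O V))
  sec_res _ _ := rfl

/-- An isomorphism over the identity. -/
def IsoOver.toIso {E F : PreMod X} (β : IsoOver (CSpace.Iso.refl X) E F) : Iso F E where
  app V := { (β.app V : F.M V ≃+ E.M V) with map_smul' := fun r m => β.app_smul r m }
  app_res h m := β.app_res h m

/-- The inverse of an isomorphism. -/
def Iso.symm {E F : PreMod X} (β : Iso E F) : Iso F E where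
  app V := (β.app V).symm
  app_res {U V} h m := by
    rw [LinearEquiv.symm_apply_eq, β.app_res, LinearEquiv.apply_symm_apply]

/-- Composition of an isomorphism over `i` with an isomorphism of modules. -/
def IsoOver.precomp {i : CSpace.Iso X Y} {E : PreMod X} {F F' : PreMod Y} (β : IsoOver i E F)
    (γ : Iso F' F) : IsoOver i E F' where
  app V := (γ.app V).toAddEquiv.trans (β.app V)
  app_smul {V} r m := by
    change β.app V (γ.app V (r • m)) = _ • β.app V (γ.app V m)
    rw [map_smul, β.app_smul]
  app_res {V W} h m := by
    change β.app W (γ.app W _) = E.res _ (β.app V (γ.app V m))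
    rw [γ.app_res, β.app_res]

end PreMod

/-! ### Derivations and cotangent modules -/

namespace SmoothFn

variable {n : ℕ}

theorem ext' {f g : SmoothFn n} (h : ∀ x, f.1 x = g.1 x) : f = g := Subtype.ext (funext h)

theorem differentiableAt (f : SmoothFn n) (x : Fin n → ℝ) : DifferentiableAt ℝ f.1 x :=
  f.smooth.differentiable (by simp) x

theorem pderiv_apply (f : SmoothFn n) (i : Fin n) (x : Fin n → ℝ) :
    (f.pderiv i).1 x = fderiv ℝ f.1 x (Pi.single i 1) := rfl

theorem pderiv_add (f g : SmoothFn n) (i : Fin n) :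
    (f + g).pderiv i = f.pderiv i + g.pderiv i := ext' fun x => by
  change fderiv ℝ (f.1 + g.1) x _ = fderiv ℝ f.1 x _ + fderiv ℝ g.1 x _
  rw [fderiv_add (f.differentiableAt x) (g.differentiableAt x)]
  rfl

theorem pderiv_sub (f g : SmoothFn n) (i : Fin n) :
    (f - g).pderiv i = f.pderiv i - g.pderiv i := ext' fun x => by
  change fderiv ℝ (f.1 - g.1) x _ = fderiv ℝ f.1 x _ - fderiv ℝ g.1 x _
  rw [fderiv_sub (f.differentiableAt x) (g.differentiableAt x)]
  rfl

theorem pderiv_mul (f g : SmoothFn n) (i : Fin n) :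
    (f * g).pderiv i = f * g.pderiv i + g * f.pderiv i := ext' fun x => by
  change fderiv ℝ (f.1 * g.1) x _ = f.1 x * fderiv ℝ g.1 x _ + g.1 x * fderiv ℝ f.1 x _
  rw [fderiv_mul (f.differentiableAt x) (g.differentiableAt x)]
  rfl

theorem fderiv_eq_sum (f : SmoothFn n) (x v : Fin n → ℝ) :
    fderiv ℝ f.1 x v = ∑ i, (f.pderiv i).1 x * v i := by
  conv_lhs => rw [pi_eq_sum_univ' v, map_sum]
  refine Finset.sum_congr rfl fun i _ => ?_
  rw [map_smul, smul_eq_mul, mul_comm, pderiv_apply]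

theorem coe_sum {ι : Type*} (s : Finset ι) (f : ι → SmoothFn n) (x : Fin n → ℝ) :
    (∑ i ∈ s, f i).1 x = ∑ i ∈ s, (f i).1 x := by
  rw [AddSubmonoidClass.coe_finsetSum, Finset.sum_apply]

theorem pderiv_comp {m : ℕ} (g : SmoothFn m) (f : Fin m → SmoothFn n) (i : Fin n) :
    (g.comp f).pderiv i = ∑ k, (g.pderiv k).comp f * (f k).pderiv i := ext' fun x => by
  have h : HasFDerivAt (fun x k => (f k).1 x)
      (ContinuousLinearMap.pi fun k => fderiv ℝ (f k).1 x) x :=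
    hasFDerivAt_pi.2 fun k => ((f k).differentiableAt x).hasFDerivAt
  have := ((g.differentiableAt (fun k => (f k).1 x)).hasFDerivAt.comp x h).fderiv
  change fderiv ℝ (g.1 ∘ fun x k => (f k).1 x) x _ = _
  rw [this, coe_sum]
  exact g.fderiv_eq_sum _ _

theorem pderiv_proj (i j : Fin n) :
    (proj j : SmoothFn n).pderiv i = if i = j then 1 else 0 := ext' fun x => by
  change fderiv ℝ (fun x : Fin n → ℝ => x j) x (Pi.single i 1) = _
  rw [(hasFDerivAt_apply j x).fderiv]
  rcases eq_or_ne i j with rfl | h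
  · simp
  · simp [h, h.symm]

end SmoothFn

section Der

variable {C : Type u} [CInfRing C]

theorem op_one {n : ℕ} (c : Fin n → C) : op (1 : SmoothFn n) c = 1 := map_one (evalHom c)

theorem op_zero {n : ℕ} (c : Fin n → C) : op (0 : SmoothFn n) c = 0 := map_zero (evalHom c)

theorem op_sub {n : ℕ} (f g : SmoothFn n) (c : Fin n → C) : op (f - g) c = op f c - op g c :=
  map_sub (evalHom c) f g

theorem op_sum {n : ℕ} {ι : Type*} (s : Finset ι) (f : ι → SmoothFn n) (c : Fin n → C) :
    op (∑ i ∈ s, f i) c = ∑ i ∈ s, op (f i) c := map_sum (evalHom c) f s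

variable {M : Type v} [AddCommGroup M] [Module C M]

/-- A derivation compatible with all the operations of a `C^∞`-ring. -/
def IsCInfDer (D : C → M) : Prop :=
  ∀ ⦃n : ℕ⦄ (f : SmoothFn n) (c : Fin n → C),
    D (op f c) = ∑ i, op (f.pderiv i) c • D (c i)

/-- Additivity is the chain rule for the operation x + y on ℝ², and the Leibniz rule below is the
one for xy. -/
theorem IsCInfDer.map_add {D : C → M} (hD : IsCInfDer D) (a b : C) : D (a + b) = D a + D b := by
  rw [← op_add, hD, Fin.sum_univ_two]
  simp [SmoothFn.pderiv_add, SmoothFn.pderiv_proj, op_one]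

theorem IsCInfDer.map_mul {D : C → M} (hD : IsCInfDer D) (a b : C) :
    D (a * b) = a • D b + b • D a := by
  rw [← op_mul, hD, Fin.sum_univ_two]
  simp [SmoothFn.pderiv_mul, SmoothFn.pderiv_proj, op_proj, add_comm]

theorem IsCInfDer.map_zero {D : C → M} (hD : IsCInfDer D) : D 0 = 0 := by
  simpa using hD.map_add 0 0

theorem Omega.isCInfDer_d : IsCInfDer (Omega.d : C → Omega C) := by
  intro n f c
  have h : Finsupp.single (op f c) 1 - ∑ i, Finsupp.single (c i) (op (f.pderiv i) c) ∈
      omegaRel C := Submodule.subset_span (by rw [Set.mem_ofPred_eq]; exact ⟨n, f, c, rfl⟩)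
  have h' := (Submodule.Quotient.mk_eq_zero _).2 h
  rw [← Submodule.mkQ_apply, _root_.map_sub, map_sum, sub_eq_zero] at h'
  refine h'.trans (Finset.sum_congr rfl fun i _ => ?_)
  rw [Omega.d, ← map_smul, Finsupp.smul_single, smul_eq_mul, mul_one]

/-- The linear map on the cotangent module induced by a derivation. -/
def Omega.lift (D : C → M) (hD : IsCInfDer D) : Omega C →ₗ[C] M :=
  (omegaRel C).liftQ (Finsupp.lift M C C D) <| by
    rw [omegaRel, Submodule.span_le]
    intro m hm
    rw [Set.mem_ofPred_eq] at hm
    obtain ⟨n, f, c, rfl⟩ := hm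
    rw [SetLike.mem_coe, LinearMap.mem_ker, _root_.map_sub, map_sum, sub_eq_zero]
    simp only [Finsupp.lift_apply, zero_smul, Finsupp.sum_single_index, one_smul]
    exact hD f c

theorem Omega.lift_d (D : C → M) (hD : IsCInfDer D) (c : C) : Omega.lift D hD (Omega.d c) = D c := by
  change Finsupp.lift M C C D (Finsupp.single c 1) = D c
  simp

theorem IsCInfDer.eq_of_mul_eq_zero {D : C → M} (hD : IsCInfDer D) {a d : C} (h : a * d = 0) :
    d • D a = - (a • D d) := by
  refine eq_neg_of_add_eq_zero_right ?_
  rw [← hD.map_mul, h, hD.map_zero]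

/-- A description of the relations among the differentials `dx_i` in terms of a relation `T a v`,
read as: `v` is the vector of partial derivatives of a function representing `a`. -/
theorem Omega.sum_smul_d_eq_zero_iff {n : ℕ} (x : Fin n → C) (T : C → (Fin n → C) → Prop)
    (total : ∀ a, ∃ v, T a v) (hx : ∀ i, T (x i) (Pi.single i 1))
    (hop : ∀ {m : ℕ} (f : SmoothFn m) (a : Fin m → C) (v : Fin m → Fin n → C),
      (∀ k, T (a k) (v k)) → T (op f a) (∑ k, op (f.pderiv k) a • v k))
    (hd : ∀ a v, T a v → Omega.d a = ∑ i, v i • Omega.d (x i)) (v : Fin n → C) :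
    ∑ i, v i • Omega.d (x i) = 0 ↔ T 0 v := by
  have hadd : ∀ a b v w, T a v → T b w → T (a + b) (v + w) := fun a b v w ha hb => by
    have := hop (SmoothFn.proj 0 + SmoothFn.proj 1 : SmoothFn 2) ![a, b] ![v, w]
      (by intro k; fin_cases k <;> assumption)
    rw [op_add, Fin.sum_univ_two] at this
    simpa [SmoothFn.pderiv_add, SmoothFn.pderiv_proj, op_one] using this
  have hmul : ∀ a b v w, T a v → T b w → T (a * b) (a • w + b • v) := fun a b v w ha hb => by
    have := hop (SmoothFn.proj 0 * SmoothFn.proj 1 : SmoothFn 2) ![a, b] ![v, w]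
      (by intro k; fin_cases k <;> assumption)
    rw [op_mul, Fin.sum_univ_two] at this
    simpa [SmoothFn.pderiv_mul, SmoothFn.pderiv_proj, op_proj, add_comm] using this
  have hzero : T 0 0 := by
    have := hop (0 : SmoothFn 0) ![] ![] (fun k => k.elim0)
    simpa [op_zero] using this
  have hsmul : ∀ a v, T 0 v → T 0 (a • v) := fun a v hv => by
    obtain ⟨w, hw⟩ := total a
    simpa using hmul a 0 w v hw hv
  -- The admissible gradients of 0. Modulo `N` the gradient of an element becomes unique, which
  -- turns `T` into a derivation with values in the quotient.
  let N : Submodule C (Fin n → C) :=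
    { carrier := {v | T 0 v}
      zero_mem' := by rw [Set.mem_ofPred_eq]; exact hzero
      add_mem' := fun {v w} hv hw => by
        rw [Set.mem_ofPred_eq] at *
        simpa using hadd 0 0 v w hv hw
      smul_mem' := fun a v hv => by
        rw [Set.mem_ofPred_eq] at *
        exact hsmul a v hv }
  have hN : ∀ {v}, v ∈ N ↔ T 0 v := Iff.of_eq Set.mem_ofPred_eq
  have huniq : ∀ {a v w}, T a v → T a w → N.mkQ v = N.mkQ w := by
    intro a v w hv hw
    rw [← sub_eq_zero, ← map_sub, Submodule.mkQ_apply, Submodule.Quotient.mk_eq_zero, hN]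
    -- Subtraction is expressed by the product with -1, whose gradient `u` need not be 0. It adds a
    -- term `a • u` to v - w; the same computation with w in place of v shows that this term lies in
    -- `N`.
    obtain ⟨u, hu⟩ := total (-1)
    have h1 := hadd _ _ _ _ hv (hmul _ _ _ _ hu hw)
    have h2 := hmul _ _ _ _ hu hw
    have h3 := hadd _ _ _ _ hw h2
    simp only [neg_mul, one_mul, neg_smul, one_smul, add_neg_cancel] at h1 h3
    have h4 := hadd _ _ _ _ h1 (hsmul (-1) _ h3)
    rw [add_zero] at h4
    convert h4 using 1
    module
  choose V hV using total
  have hD : IsCInfDer (fun a => N.mkQ (V a)) := by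
    intro m f a
    have := huniq (hV _) (hop f a (fun k => V (a k)) fun k => hV _)
    simp only [this, map_sum, map_smul]
  constructor
  · intro h
    -- The derivation into the quotient by `N` sends xᵢ to the i-th unit vector, so applying its
    -- linear extension to the relation gives the class of `v` itself.
    have h' := congrArg (Omega.lift _ hD) h
    rw [map_sum, map_zero] at h'
    simp only [map_smul, Omega.lift_d, huniq (hV _) (hx _)] at h'
    simp only [← map_smul, ← map_sum] at h'
    rw [Submodule.mkQ_apply, Submodule.Quotient.mk_eq_zero, hN] at h'
    convert h' using 1
    funext j
    simp [Finset.sum_apply, Pi.single_apply]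
  · intro h
    rw [← hd 0 v h, isCInfDer_d.map_zero]

end Der

/-! ### Cotangent modules of good rings -/

section Good

variable {C : Type u} [CInfRing C] {n : ℕ} (φ : CInfHom (SmoothFn n) C)

theorem SmoothFn.op_proj_eq (f : SmoothFn n) : op f (fun i => (SmoothFn.proj i : SmoothFn n)) = f :=
  rfl

theorem CInfHom.apply_eq_op (f : SmoothFn n) : φ f = op f fun i => φ (SmoothFn.proj i) := by
  conv_lhs => rw [← f.op_proj_eq]
  exact φ.map_op f _

theorem Omega.d_apply (f : SmoothFn n) :
    Omega.d (φ f) = ∑ i, φ (f.pderiv i) • Omega.d (φ (SmoothFn.proj i)) := by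
  rw [φ.apply_eq_op, Omega.isCInfDer_d]
  simp only [← φ.apply_eq_op]

variable {φ} in
-- The general criterion for relations, where `T a v` says that `v` is the image of the gradient of
-- some lift of `a`. Lifts of 0 are the elements of the kernel.
theorem Omega.sum_smul_d_eq_zero_iff_of_surjective (hφ : Function.Surjective φ) (v : Fin n → C) :
    ∑ i, v i • Omega.d (φ (SmoothFn.proj i)) = 0 ↔
      ∃ f : SmoothFn n, φ f = 0 ∧ ∀ i, φ (f.pderiv i) = v i := by
  refine (Omega.sum_smul_d_eq_zero_iff (fun i => φ (SmoothFn.proj i))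
    (fun a v => ∃ f : SmoothFn n, φ f = a ∧ ∀ i, φ (f.pderiv i) = v i) ?_ ?_ ?_ ?_ v)
  · intro a
    obtain ⟨f, rfl⟩ := hφ a
    exact ⟨_, f, rfl, fun i => rfl⟩
  · intro i
    refine ⟨_, rfl, fun j => ?_⟩
    rw [SmoothFn.pderiv_proj]
    rcases eq_or_ne j i with rfl | h
    · simp
    · simp [h]
  · intro m f a v h
    choose g hg hg' using h
    refine ⟨op f g, ?_, fun i => ?_⟩
    · rw [φ.map_op, funext hg]
    · change φ ((f.comp g).pderiv i) = _
      rw [SmoothFn.pderiv_comp, Finset.sum_apply]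
      refine (map_sum φ.toAlgHom _ _).trans (Finset.sum_congr rfl fun k _ => ?_)
      refine (map_mul φ.toAlgHom _ _).trans ?_
      change φ (op (f.pderiv k) g) * φ ((g k).pderiv i) = _
      rw [φ.map_op, funext hg, hg']
      rfl
  · rintro a v ⟨f, rfl, hf⟩
    rw [Omega.d_apply]
    simp only [hf]

variable {φ} in
theorem Omega.exists_eq_sum (hφ : Function.Surjective φ) (m : Omega C) :
    ∃ v : Fin n → C, m = ∑ i, v i • Omega.d (φ (SmoothFn.proj i)) := by
  induction m using Omega.induction with
  | zero => exact ⟨0, by simp⟩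
  | add m m' h h' =>
    obtain ⟨v, rfl⟩ := h
    obtain ⟨w, rfl⟩ := h'
    exact ⟨v + w, by simp [add_smul, Finset.sum_add_distrib]⟩
  | smul_d a c =>
    obtain ⟨f, rfl⟩ := hφ c
    exact ⟨fun i => a * φ (f.pderiv i), by rw [Omega.d_apply]; simp only [Finset.smul_sum, mul_smul]⟩

/-- The k-th derivative of a partial derivative is a contraction of the (k+1)-st derivative of `f`.
So functions that are flat at a point are stable under partial derivatives. -/
theorem iteratedFDeriv_pderiv_eq_zero (f : SmoothFn n) (i : Fin n) (z : Fin n → ℝ)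
    (h : ∀ k : ℕ, iteratedFDeriv ℝ k f.1 z = 0) (k : ℕ) :
    iteratedFDeriv ℝ k (f.pderiv i).1 z = 0 := by
  have hf : ContDiff ℝ ∞ (fderiv ℝ f.1) := f.smooth.fderiv_right (by simp)
  have h1 : (f.pderiv i).1 =
      (ContinuousLinearMap.apply ℝ ℝ (Pi.single i 1 : Fin n → ℝ)) ∘ fderiv ℝ f.1 := rfl
  rw [h1, ContinuousLinearMap.iteratedFDeriv_comp_left _ (hf.contDiffAt) (i := k)
    (by exact_mod_cast le_top)]
  have h2 : iteratedFDeriv ℝ k (fderiv ℝ f.1) z = 0 := by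
    rw [← norm_eq_zero, norm_iteratedFDeriv_fderiv, h, norm_zero]
  rw [h2]
  ext
  simp

/-- The kernel of Cⁿ → Ω_C consists of the gradients of elements of the ideal, and is spanned by
those of the finitely many non-flat generators. -/
theorem IsGood.finitePresentation_omega (hC : IsGood C) :
    Module.FinitePresentation C (Omega C) := by
  obtain ⟨n, φ, hφ, S, Z, -, hI⟩ := hC
  let L : (Fin n → C) →ₗ[C] Omega C :=
    Fintype.linearCombination C fun i => Omega.d (φ (SmoothFn.proj i))
  have hL : ∀ v, L v = ∑ i, v i • Omega.d (φ (SmoothFn.proj i)) := fun v =>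
    Fintype.linearCombination_apply ..
  refine Module.finitePresentation_of_surjective L (fun m => ?_) ?_
  · obtain ⟨v, rfl⟩ := Omega.exists_eq_sum hφ m
    exact ⟨v, hL v⟩
  · classical
    let g : SmoothFn n → Fin n → C := fun f i => φ (f.pderiv i)
    have hzero : ∀ f : SmoothFn n, φ f = 0 ↔ f ∈ RingHom.ker φ.toAlgHom := fun f =>
      RingHom.mem_ker.symm
    refine ⟨S.image g, le_antisymm (Submodule.span_le.2 ?_) ?_⟩
    · intro v hv
      rw [Finset.coe_image] at hv
      obtain ⟨f, hf, rfl⟩ := hv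
      rw [SetLike.mem_coe, LinearMap.mem_ker, hL,
        Omega.sum_smul_d_eq_zero_iff_of_surjective hφ]
      refine ⟨f, ?_, fun i => rfl⟩
      rw [hzero, hI]
      exact Ideal.subset_span (Or.inl hf)
    · intro v hv
      rw [LinearMap.mem_ker, hL, Omega.sum_smul_d_eq_zero_iff_of_surjective hφ] at hv
      obtain ⟨f, hf, hv⟩ := hv
      obtain rfl : v = g f := funext fun i => (hv i).symm
      rw [hzero, hI] at hf
      have key : ∀ f ∈ Ideal.span (↑S ∪ {g : SmoothFn n | ∀ z ∈ Z, ∀ k : ℕ,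
          iteratedFDeriv ℝ k g.1 z = 0}), φ f = 0 ∧ g f ∈ Submodule.span C (↑(S.image g)) := by
        intro f hf
        refine ⟨by rw [hzero, hI]; exact hf, ?_⟩
        induction hf using Submodule.span_induction with
        | mem f hf =>
          rcases hf with hf | hf
          · exact Submodule.subset_span (by rw [Finset.coe_image]; exact ⟨f, hf, rfl⟩)
          · rw [Set.mem_ofPred_eq] at hf
            -- The partial derivatives of a flat function are again flat, hence lie in the ideal and
            -- vanish in `C`.
            have : g f = 0 := funext fun i => by
              change φ (f.pderiv i) = 0
              rw [hzero, hI]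
              refine Ideal.subset_span (Or.inr ?_)
              rw [Set.mem_ofPred_eq]
              exact fun z hz k => iteratedFDeriv_pderiv_eq_zero f i z (hf z hz) k
            rw [this]
            exact Submodule.zero_mem _
        | zero =>
          have : g 0 = 0 := funext fun i => by
            have h0 : (0 : SmoothFn n).pderiv i = 0 := by
              simpa using SmoothFn.pderiv_sub (0 : SmoothFn n) 0 i
            change φ _ = 0
            rw [h0]
            exact map_zero φ.toAlgHom
          rw [this]
          exact Submodule.zero_mem _
        | add f f' _ _ h h' =>
          have : g (f + f') = g f + g f' := funext fun i => by
            change φ _ = φ _ + φ _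
            rw [SmoothFn.pderiv_add]
            exact map_add φ.toAlgHom _ _
          rw [this]
          exact Submodule.add_mem _ h h'
        | smul a f hf h =>
          have h0 : φ.toAlgHom f = 0 := by
            have : f ∈ RingHom.ker φ.toAlgHom := by rw [hI]; exact hf
            exact RingHom.mem_ker.1 this
          have : g (a • f) = φ a • g f := funext fun i => by
            -- In ∂ᵢ(a f) = a ∂ᵢf + f ∂ᵢa the second term dies because `f` is in the kernel: on the
            -- ideal the gradient is linear.
            change φ.toAlgHom _ = φ.toAlgHom _ * φ.toAlgHom _
            rw [smul_eq_mul, SmoothFn.pderiv_mul, map_add, map_mul, map_mul, h0, zero_mul,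
              add_zero]
          rw [this]
          exact Submodule.smul_mem _ _ h
      exact (key f hf).2

end Good

/-! ### The cotangent sheaf of a spectrum -/

section CotangentPresheaf

variable {X : CSpace.{u}} {U V : Opens X.carrier}

/-- The differential of a function, as a section of the cotangent presheaf. -/
def cotPre.d (s : X.O U) : (cotPre X).M U := (Omega.d s : Omega (X.O U))

theorem cotPre.res_d (h : V ≤ U) (s : X.O U) :
    (cotPre X).res h (cotPre.d s) = cotPre.d (X.res h s) := Omega.map_d (X.res h) s

theorem cotPre.isCInfDer_d : IsCInfDer (cotPre.d : X.O U → (cotPre X).M U) :=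
  Omega.isCInfDer_d

theorem cotPre.induction {p : (cotPre X).M U → Prop} (m : (cotPre X).M U) (zero : p 0)
    (add : ∀ m m', p m → p m' → p (m + m')) (smul_d : ∀ a c : X.O U, p (a • cotPre.d c)) : p m :=
  Omega.induction m zero add smul_d

/-- The linear map on sections of the cotangent presheaf induced by a derivation. -/
def cotPre.lift {M : Type v} [AddCommGroup M] [Module (X.O U) M] (D : X.O U → M)
    (hD : IsCInfDer D) : (cotPre X).M U →ₗ[X.O U] M := Omega.lift D hD

theorem cotPre.lift_d {M : Type v} [AddCommGroup M] [Module (X.O U) M] (D : X.O U → M)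
    (hD : IsCInfDer D) (s : X.O U) : cotPre.lift D hD (cotPre.d s) = D s := Omega.lift_d D hD s

theorem cot_isSheaf (X : CSpace.{u}) : (cot X).IsSheaf := (cotPre X).sheafify_isSheaf

end CotangentPresheaf

section Spectrum

variable {C : Type u} [CInfRing C]

theorem specSections_algebraMap (U : Opens (RPoint C)) (c : C) :
    algebraMap C (specSections C U) c = toSections C U c := rfl

/-- Sections of the structure sheaf come locally from `C`. -/
theorem exists_toSections {U : Opens (RPoint C)} (s : specSections C U) {x : RPoint C}
    (hx : x ∈ U) : ∃ (V : Opens (RPoint C)) (h : V ≤ U) (c : C), x ∈ V ∧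
      specRes h s = toSections C V c := by
  obtain ⟨c, hc⟩ := isSection_iff.1 (mem_specSections.1 s.2) ⟨x, hx⟩
  obtain ⟨W, hW, hWo, hxW⟩ := eventually_nhds_iff.1 hc
  refine ⟨imageOpens ⟨W, hWo⟩, fun y hy => (mem_imageOpens.1 hy).1, c,
    mem_imageOpens.2 ⟨hx, hxW⟩, Subtype.ext (funext fun y => ?_)⟩
  exact hW _ (mem_imageOpens.1 y.2).2

theorem exists_toSections_fin {U : Opens (RPoint C)} {n : ℕ} (s : Fin n → specSections C U)
    {x : RPoint C} (hx : x ∈ U) : ∃ (V : Opens (RPoint C)) (h : V ≤ U) (c : Fin n → C), x ∈ V ∧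
      ∀ i, specRes h (s i) = toSections C V (c i) := by
  choose V hV c hxV hc using fun i => exists_toSections (s i) hx
  refine ⟨⟨U ∩ ⋂ i, V i, U.isOpen.inter (isOpen_iInter_of_finite fun i => (V i).isOpen)⟩,
    fun y hy => hy.1, c, ⟨hx, Set.mem_iInter.2 hxV⟩, fun i => Subtype.ext (funext fun y => ?_)⟩
  exact congrFun (congrArg Subtype.val (hc i)) ⟨y.1, Set.mem_iInter.1 y.2.2 i⟩

/-- If `toLoc x c = toLoc x c'`, then `c` and `c'` agree near `x`. -/
theorem eventually_toLoc_eq {x : RPoint C} {c c' : C} (h : toLoc x c = toLoc x c') :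
    ∀ᶠ y in 𝓝 x, toLoc y c = toLoc y c' := by
  obtain ⟨d, hd, h⟩ := mem_germIdeal.1 (toLoc_eq_iff.1 h)
  filter_upwards [(RPoint.continuous_eval d).continuousAt.eventually_ne hd] with y hy
  exact toLoc_eq_iff.2 (mem_germIdeal.2 ⟨d, hy, h⟩)

theorem exists_opens_of_eventually {X : Type u} [TopologicalSpace X] {x : X} {p : X → Prop}
    (h : ∀ᶠ y in 𝓝 x, p y) : ∃ W : Opens X, x ∈ W ∧ ∀ y ∈ W, p y := by
  obtain ⟨W, hW, hWo, hxW⟩ := eventually_nhds_iff.1 h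
  exact ⟨⟨W, hWo⟩, hxW, hW⟩

theorem toSections_op (U : Opens (RPoint C)) {n : ℕ} (f : SmoothFn n) (c : Fin n → C) :
    toSections C U (op f c) = op f fun i => toSections C U (c i) := (toSections C U).map_op f c

theorem toSections_mul (U : Opens (RPoint C)) (c d : C) :
    toSections C U (c * d) = toSections C U c * toSections C U d :=
  map_mul (toSections C U).toAlgHom c d

theorem toSections_one (U : Opens (RPoint C)) : toSections C U 1 = 1 :=
  map_one (toSections C U).toAlgHom

theorem toSections_zero (U : Opens (RPoint C)) : toSections C U 0 = 0 :=
  map_zero (toSections C U).toAlgHom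

theorem toSections_eq_iff (U : Opens (RPoint C)) {c c' : C} :
    toSections C U c = toSections C U c' ↔ ∀ x ∈ U, toLoc x c = toLoc x c' :=
  ⟨fun h x hx => congrFun (congrArg Subtype.val h) ⟨x, hx⟩,
    fun h => Subtype.ext (funext fun x => h x.1 x.2)⟩

/-- The value in `Loc x` of a section of the structure sheaf of `Spec C`. -/
def Spec.val {U : Opens (Spec C).carrier} (s : (Spec C).O U) (x : RPoint C)
    (hx : x ∈ (U : Set (Spec C).carrier)) : Loc x :=
  (show specSections C U from s).1 ⟨x, hx⟩

theorem Spec.ext {U : Opens (Spec C).carrier} {s t : (Spec C).O U}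
    (h : ∀ x hx, Spec.val s x hx = Spec.val t x hx) : s = t :=
  Subtype.ext (funext fun x => h x.1 x.2)

theorem Spec.res_fn {U V : Opens (Spec C).carrier} (h : V ≤ U) (c : C) :
    (Spec C).res h (Spec.fn U c) = Spec.fn V c := rfl

theorem Spec.fn_op (U : Opens (Spec C).carrier) {n : ℕ} (f : SmoothFn n) (c : Fin n → C) :
    Spec.fn U (op f c) = op f fun i => Spec.fn U (c i) := toSections_op U f c

theorem Spec.fn_mul (U : Opens (Spec C).carrier) (c d : C) :
    Spec.fn U (c * d) = Spec.fn U c * Spec.fn U d := toSections_mul U c d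

theorem Spec.fn_one (U : Opens (Spec C).carrier) : Spec.fn U (1 : C) = 1 := toSections_one U

theorem Spec.fn_zero (U : Opens (Spec C).carrier) : Spec.fn U (0 : C) = 0 := toSections_zero U

theorem Spec.exists_fn {U : Opens (Spec C).carrier} (s : (Spec C).O U) {x : (Spec C).carrier}
    (hx : x ∈ U) : ∃ (V : Opens (Spec C).carrier) (h : V ≤ U) (c : C), x ∈ V ∧
      (Spec C).res h s = Spec.fn V c := exists_toSections (U := U) s hx

theorem Spec.exists_fn_fin {U : Opens (Spec C).carrier} {n : ℕ} (s : Fin n → (Spec C).O U)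
    {x : (Spec C).carrier} (hx : x ∈ U) : ∃ (V : Opens (Spec C).carrier) (h : V ≤ U)
      (c : Fin n → C), x ∈ V ∧ ∀ i, (Spec C).res h (s i) = Spec.fn V (c i) :=
  exists_toSections_fin (U := U) s hx

theorem Spec.fn_eq_iff {U : Opens (Spec C).carrier} {c c' : C} :
    Spec.fn U c = Spec.fn U c' ↔ ∀ x : RPoint C, x ∈ (U : Set (Spec C).carrier) →
      toLoc x c = toLoc x c' := toSections_eq_iff U

section MSpecPre

variable {M : Type u} [AddCommGroup M] [Module C M]

/-- The pure tensor `s ⊗ m`. -/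
def sectionTmul {U : Opens (RPoint C)} (s : specSections C U) (m : M) :
    specSections C U ⊗[C] M := s ⊗ₜ[C] m

theorem sectionTmul_res {U V : Opens (RPoint C)} (h : V ≤ U) (s : specSections C U) (m : M) :
    mspecRes C M h (sectionTmul s m) = sectionTmul (specRes h s) m := rfl

theorem smul_sectionTmul {U : Opens (RPoint C)} (r s : specSections C U) (m : M) :
    r • sectionTmul s m = sectionTmul (r * s) m := rfl

theorem sectionTmul_sum {U : Opens (RPoint C)} (s : specSections C U) {ι : Type*} (t : Finset ι)
    (m : ι → M) : sectionTmul s (∑ i ∈ t, m i) = ∑ i ∈ t, sectionTmul s (m i) :=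
  TensorProduct.tmul_sum _ _ _

theorem sectionTmul_add {U : Opens (RPoint C)} (s : specSections C U) (m m' : M) :
    sectionTmul s (m + m') = sectionTmul s m + sectionTmul s m' := TensorProduct.tmul_add _ _ _

theorem sectionTmul_zero {U : Opens (RPoint C)} (s : specSections C U) :
    sectionTmul s (0 : M) = 0 := TensorProduct.tmul_zero _ _

theorem zero_sectionTmul (U : Opens (RPoint C)) (m : M) :
    sectionTmul (0 : specSections C U) m = 0 := TensorProduct.zero_tmul _ _

theorem sectionTmul_smul {U : Opens (RPoint C)} (s : specSections C U) (c : C) (m : M) :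
    sectionTmul s (c • m) = sectionTmul (toSections C U c * s) m :=
  (TensorProduct.smul_tmul c s m).symm.trans (congrArg (· ⊗ₜ[C] m) (Algebra.smul_def c s))

theorem sectionTmul_induction {U : Opens (RPoint C)} {p : specSections C U ⊗[C] M → Prop}
    (m : specSections C U ⊗[C] M) (zero : p 0) (add : ∀ m m', p m → p m' → p (m + m'))
    (tmul : ∀ s (m : M), p (sectionTmul s m)) : p m :=
  TensorProduct.induction_on (motive := p) m zero tmul add

/-- The section `s ⊗ m` of `U ↦ O(U) ⊗_C M`. -/
def mspecTmul {U : Opens (Spec C).carrier} (s : (Spec C).O U) (m : M) : (mspecPre C M).M U :=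
  sectionTmul (U := U) s m

theorem mspecPre_res_tmul {U V : Opens (Spec C).carrier} (h : V ≤ U) (s : (Spec C).O U) (m : M) :
    (mspecPre C M).res h (mspecTmul s m) = mspecTmul ((Spec C).res h s) m :=
  sectionTmul_res (U := U) (V := V) h s m

theorem smul_mspecTmul {U : Opens (Spec C).carrier} (r s : (Spec C).O U) (m : M) :
    r • mspecTmul s m = mspecTmul (r * s) m := smul_sectionTmul (U := U) r s m

theorem mspecTmul_add {U : Opens (Spec C).carrier} (s : (Spec C).O U) (m m' : M) :
    mspecTmul s (m + m') = mspecTmul s m + mspecTmul s m' := sectionTmul_add (U := U) s m m'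

theorem mspecTmul_zero {U : Opens (Spec C).carrier} (s : (Spec C).O U) :
    mspecTmul s (0 : M) = 0 := sectionTmul_zero (U := U) s

theorem zero_mspecTmul (U : Opens (Spec C).carrier) (m : M) :
    mspecTmul (0 : (Spec C).O U) m = 0 := zero_sectionTmul U m

theorem mspecTmul_sum {U : Opens (Spec C).carrier} (s : (Spec C).O U) {ι : Type*} (t : Finset ι)
    (m : ι → M) : mspecTmul s (∑ i ∈ t, m i) = ∑ i ∈ t, mspecTmul s (m i) :=
  sectionTmul_sum (U := U) s t m

theorem mspecTmul_smul {U : Opens (Spec C).carrier} (s : (Spec C).O U) (c : C) (m : M) :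
    mspecTmul s (c • m) = mspecTmul (Spec.fn U c * s) m := sectionTmul_smul (U := U) s c m

theorem mspecPre_induction {U : Opens (Spec C).carrier} {p : (mspecPre C M).M U → Prop}
    (m : (mspecPre C M).M U) (zero : p 0) (add : ∀ m m', p m → p m' → p (m + m'))
    (tmul : ∀ s (m : M), p (mspecTmul s m)) : p m :=
  sectionTmul_induction (U := U) (p := p) m zero add tmul

theorem mspecPre_omega_induction {U : Opens (Spec C).carrier}
    {p : (mspecPre C (Omega C)).M U → Prop} (m : (mspecPre C (Omega C)).M U) (zero : p 0)
    (add : ∀ m m', p m → p m' → p (m + m')) (tmul : ∀ s (c : C), p (mspecTmul s (Omega.d c))) :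
    p m := by
  induction m using mspecPre_induction with
  | zero => exact zero
  | add m m' h h' => exact add _ _ h h'
  | tmul s m =>
    induction m using Omega.induction with
    | zero => rw [mspecTmul_zero]; exact zero
    | add m m' h h' => rw [mspecTmul_add]; exact add _ _ h h'
    | smul_d a c => rw [mspecTmul_smul]; exact tmul _ _

end MSpecPre

/-- The differential `1 ⊗ dc` depends locally only on the function defined by `c`. -/
theorem mspecTmul_d_congr {x : RPoint C} {c c' : C} (h : toLoc x c = toLoc x c') :
    ∃ W : Opens (Spec C).carrier, x ∈ (W : Set (Spec C).carrier) ∧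
      mspecTmul (1 : (Spec C).O W) (Omega.d c) = mspecTmul 1 (Omega.d c') := by
  obtain ⟨d, hd, h0⟩ := mem_germIdeal.1 (toLoc_eq_iff.1 h)
  obtain ⟨e, he⟩ := Loc.mul_local_inverse hd
  obtain ⟨W, hxW, hW⟩ : ∃ W : Opens (Spec C).carrier, x ∈ (W : Set (Spec C).carrier) ∧
      ∀ y ∈ (W : Set (Spec C).carrier), toLoc (C := C) y d * toLoc (C := C) y e = 1 ∧
        toLoc (C := C) y c = toLoc (C := C) y c' :=
    exists_opens_of_eventually (he.and (eventually_toLoc_eq h))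
  refine ⟨W, hxW, ?_⟩
  have h1 : (1 : (Spec C).O W) = Spec.fn W d * Spec.fn W e := by
    rw [← Spec.fn_mul, ← Spec.fn_one, Spec.fn_eq_iff]
    intro y hy
    rw [map_one, map_mul, (hW y hy).1]
  have h2 : Spec.fn W (c - c') = 0 := by
    rw [← Spec.fn_zero, Spec.fn_eq_iff]
    intro y hy
    rw [map_zero, map_sub, (hW y hy).2, sub_self]
  -- Write 1 = d e on `W` and move d across the tensor sign. By Leibniz d · d(c - c') = -(c - c') ·
  -- dd, and c - c' is zero on `W`.
  have h3 : mspecTmul (1 : (Spec C).O W) (Omega.d (c - c')) = 0 := by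
    rw [h1, ← mspecTmul_smul, Omega.isCInfDer_d.eq_of_mul_eq_zero h0, ← smul_neg, mspecTmul_smul,
      h2, zero_mul, zero_mspecTmul]
  have h4 : mspecTmul (1 : (Spec C).O W) (Omega.d c) =
      mspecTmul 1 (Omega.d (c - c')) + mspecTmul 1 (Omega.d c') := by
    rw [← mspecTmul_add, ← Omega.isCInfDer_d.map_add, sub_add_cancel]
  rw [h4, h3, zero_add]

/-- The germ of `1 ⊗ dc` at `x`. -/
def omegaGerm (x : (Spec C).carrier) (c : C) : (mspecPre C (Omega C)).Stalk x :=
  (mspecPre C (Omega C)).germ (U := ⊤) trivial (mspecTmul 1 (Omega.d c))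

theorem omegaGerm_eq (x : (Spec C).carrier) (c : C) {U : Opens (Spec C).carrier} (hx : x ∈ U) :
    (mspecPre C (Omega C)).germ hx (mspecTmul 1 (Omega.d c)) = omegaGerm x c := by
  rw [omegaGerm, ← (mspecPre C (Omega C)).germ_res (le_top : U ≤ ⊤) hx, mspecPre_res_tmul, map_one]

theorem omegaGerm_congr {x : RPoint C} {c c' : C} (h : toLoc x c = toLoc x c') :
    omegaGerm x c = omegaGerm x c' := by
  obtain ⟨W, hxW, hW⟩ := mspecTmul_d_congr h
  exact (omegaGerm_eq x c hxW).symm.trans ((congrArg _ hW).trans (omegaGerm_eq x c' hxW))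

/-- The representative chosen by `out` may be replaced by any other one. Near a point a single `c`
then serves at all points, which gives a section of the sheafification. -/
theorem sectionDifferential_aux {U : Opens (Spec C).carrier} {s : (Spec C).O U} {x : RPoint C}
    {hx : x ∈ (U : Set (Spec C).carrier)} {c : C} (h : Spec.val s x hx = toLoc x c) :
    omegaGerm x (Spec.val s x hx).out = omegaGerm x c :=
  omegaGerm_congr ((Ideal.Quotient.mk_out _).trans h)

/-- The section of `MSpec Ω_C` given by the differential of a section of the structure sheaf. -/
def sectionDifferential {U : Opens (Spec C).carrier} (s : (Spec C).O U) :
    (mspecPre C (Omega C)).sheafify.M U :=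
  (⟨fun x => omegaGerm x.1 (Spec.val s x.1 x.2).out,
    (mspecPre C (Omega C)).mem_sheafSections.2 fun x => by
      obtain ⟨V, hV, c, hxV, hc⟩ := Spec.exists_fn s x.2
      refine ⟨V, hV, mspecTmul 1 (Omega.d c), hxV, fun y hy => ?_⟩
      refine Eq.trans ?_ (omegaGerm_eq y c hy).symm
      exact sectionDifferential_aux (congrFun (congrArg Subtype.val hc) ⟨y, hy⟩)⟩ :
      (mspecPre C (Omega C)).sheafSections U)

theorem res_sectionDifferential {U V : Opens (Spec C).carrier} (h : V ≤ U) (s : (Spec C).O U) :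
    (mspecPre C (Omega C)).sheafify.res h (sectionDifferential s) =
      sectionDifferential ((Spec C).res h s) := rfl

theorem sectionDifferential_fn (U : Opens (Spec C).carrier) (c : C) :
    sectionDifferential (Spec.fn U c) =
      (mspecPre C (Omega C)).toSheafify U (mspecTmul 1 (Omega.d c)) :=
  Subtype.ext <| funext fun x =>
    (sectionDifferential_aux rfl).trans (omegaGerm_eq x.1 c x.2).symm

/-- The identity is local, and locally all arguments come from `C`, where it is a defining relation
of Ω_C. -/
theorem isCInfDer_sectionDifferential (U : Opens (Spec C).carrier) :
    IsCInfDer (sectionDifferential : (Spec C).O U → (mspecPre C (Omega C)).sheafify.M U) := by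
  intro n f s
  refine (mspecPre C (Omega C)).sheafify_isSheaf.eq_of_local _ _ fun x hx => ?_
  obtain ⟨V, hV, c, hxV, hc⟩ := Spec.exists_fn_fin s hx
  refine ⟨V, hV, hxV, ?_⟩
  rw [map_sum]
  simp only [PreMod.res_smul, res_sectionDifferential, CInfHom.map_op, hc]
  simp only [← Spec.fn_op, sectionDifferential_fn]
  simp only [← map_smul, ← map_sum]
  congr 1
  rw [Omega.isCInfDer_d, mspecTmul_sum]
  refine Finset.sum_congr rfl fun i _ => ?_
  rw [mspecTmul_smul, smul_mspecTmul]

theorem sectionsTensorToOmega_der (U : Opens (RPoint C)) :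
    IsCInfDer fun c => (Omega.d (toSections C U c) : Omega (specSections C U)) := by
  intro n f c
  simp only [toSections_op]
  rw [Omega.isCInfDer_d]
  refine Finset.sum_congr rfl fun i _ => ?_
  rw [← algebraMap_smul (specSections C U) (op (SmoothFn.pderiv f i) c),
    specSections_algebraMap, toSections_op]

/-- The map `O(U) ⊗_C Ω_C → Ω_{O(U)}`, in terms of sections of the spectrum. -/
def sectionsTensorToOmega (U : Opens (RPoint C)) :
    specSections C U ⊗[C] Omega C →ₗ[specSections C U] Omega (specSections C U) :=
  LinearMap.liftBaseChange (specSections C U) <|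
    Omega.lift (fun c => (Omega.d (toSections C U c) : Omega (specSections C U)))
      (sectionsTensorToOmega_der U)

theorem sectionsTensorToOmega_tmul {U : Opens (RPoint C)} (s : specSections C U) (c : C) :
    sectionsTensorToOmega U (sectionTmul s (Omega.d c)) = s • Omega.d (toSections C U c) := by
  rw [sectionsTensorToOmega, sectionTmul, LinearMap.liftBaseChange_tmul, Omega.lift_d]

/-- The map `O(U) ⊗_C Ω_C → Ω_{O(U)}`. -/
def tensorToOmega (U : Opens (Spec C).carrier) :
    (mspecPre C (Omega C)).M U →ₗ[(Spec C).O U] (cotPre (Spec C)).M U :=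
  sectionsTensorToOmega (C := C) U

theorem tensorToOmega_tmul {U : Opens (Spec C).carrier} (s : (Spec C).O U) (c : C) :
    tensorToOmega U (mspecTmul s (Omega.d c)) = s • cotPre.d (Spec.fn U c) :=
  sectionsTensorToOmega_tmul (U := U) s c

theorem tensorToOmega_res {U V : Opens (Spec C).carrier} (h : V ≤ U)
    (m : (mspecPre C (Omega C)).M U) :
    tensorToOmega V ((mspecPre C (Omega C)).res h m) =
      (cotPre (Spec C)).res h (tensorToOmega U m) := by
  induction m using mspecPre_omega_induction with
  | zero => simp only [map_zero]
  | add m m' h h' => simp only [map_add, h, h']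
  | tmul s c =>
    rw [tensorToOmega_tmul, mspecPre_res_tmul, tensorToOmega_tmul, PreMod.res_smul, cotPre.res_d,
      Spec.res_fn]

/-- Near a point a function `s` is defined by some `c`, so a ds is the image of a ⊗ dc. Only the
function under d has to come from `C`; the coefficient is kept. -/
theorem exists_tensorToOmega {U : Opens (Spec C).carrier} (m : (cotPre (Spec C)).M U)
    {x : (Spec C).carrier} (hx : x ∈ U) : ∃ (V : Opens (Spec C).carrier) (h : V ≤ U)
      (t : (mspecPre C (Omega C)).M V), x ∈ V ∧
        tensorToOmega V t = (cotPre (Spec C)).res h m := by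
  induction m using cotPre.induction with
  | zero => exact ⟨U, le_rfl, 0, hx, by rw [map_zero, map_zero]⟩
  | add m m' h h' =>
    obtain ⟨V, hV, t, hxV, ht⟩ := h
    obtain ⟨V', hV', t', hxV', ht'⟩ := h'
    refine ⟨V ⊓ V', inf_le_left.trans hV, (mspecPre C (Omega C)).res inf_le_left t +
      (mspecPre C (Omega C)).res inf_le_right t', ⟨hxV, hxV'⟩, ?_⟩
    rw [map_add, tensorToOmega_res, tensorToOmega_res, ht, ht', (cotPre (Spec C)).res_res,
      (cotPre (Spec C)).res_res, map_add]
  | smul_d a s =>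
    obtain ⟨V, hV, c, hxV, hc⟩ := Spec.exists_fn s hx
    refine ⟨V, hV, mspecTmul ((Spec C).res hV a) (Omega.d c), hxV, ?_⟩
    rw [tensorToOmega_tmul, PreMod.res_smul, cotPre.res_d, hc]

variable (C) in
/-- The morphism `O(U) ⊗_C Ω_C → T*(Spec C)(U)`. -/
def tensorToCot : PreMod.HomOver (CSpace.Iso.refl (Spec C)) (cot (Spec C))
    (mspecPre C (Omega C)) where
  app V := ((cotPre (Spec C)).toSheafify V).toAddMonoidHom.comp (tensorToOmega V).toAddMonoidHom
  app_smul {V} r m := (congrArg ((cotPre (Spec C)).toSheafify V)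
    ((tensorToOmega V).map_smul r m)).trans (((cotPre (Spec C)).toSheafify V).map_smul r _)
  app_res {V W} h m := (congrArg ((cotPre (Spec C)).toSheafify W) (tensorToOmega_res h m)).trans
    ((cotPre (Spec C)).toSheafify_res h _)

/-- A one-sided inverse up to sheafification: an element killed by `tensorToOmega` has zero image in
MSpec Ω_C and so vanishes locally. -/
theorem lift_sectionDifferential {U : Opens (Spec C).carrier} (m : (mspecPre C (Omega C)).M U) :
    cotPre.lift _ (isCInfDer_sectionDifferential U) (tensorToOmega U m) =
      (mspecPre C (Omega C)).toSheafify U m := by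
  induction m using mspecPre_omega_induction with
  | zero => rw [map_zero, map_zero, map_zero]
  | add m m' h h' => rw [map_add, map_add, map_add, h, h']
  | tmul s c =>
    rw [tensorToOmega_tmul, map_smul, cotPre.lift_d, sectionDifferential_fn, ← map_smul,
      smul_mspecTmul, mul_one]

theorem tensorToCot_locBij : (tensorToCot C).LocBij where
  inj {V} m hm y hy := by
    have hm' : (cotPre (Spec C)).toSheafify V (tensorToOmega V m) =
        (cotPre (Spec C)).toSheafify V 0 :=
      Eq.trans hm (map_zero ((cotPre (Spec C)).toSheafify V)).symm
    obtain ⟨W, hW, hyW, h⟩ := ((cotPre (Spec C)).toSheafify_eq_iff _ _).1 hm' y hy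
    have h' : tensorToOmega W ((mspecPre C (Omega C)).res hW m) = 0 :=
      (tensorToOmega_res hW m).trans (h.trans (map_zero _))
    have h0 := lift_sectionDifferential ((mspecPre C (Omega C)).res hW m)
    rw [h', map_zero] at h0
    obtain ⟨W', hW', hyW', h1⟩ := ((mspecPre C (Omega C)).toSheafify_eq_iff _ _).1
      (h0.symm.trans (map_zero _).symm) y hyW
    refine ⟨W', hW'.trans hW, hyW', ?_⟩
    rw [← (mspecPre C (Omega C)).res_res hW hW', h1, map_zero]
  surj {V} e y hy := by
    obtain ⟨W, hW, m, hyW, hm⟩ := (cotPre (Spec C)).exists_toSheafify (U := V) e hy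
    obtain ⟨W', hW', t, hyW', ht⟩ := exists_tensorToOmega m hyW
    refine ⟨W', hW'.trans hW, t, hyW', ?_⟩
    refine Eq.trans (congrArg ((cotPre (Spec C)).toSheafify W') ht) ?_
    refine ((cotPre (Spec C)).toSheafify_res hW' m).trans ?_
    rw [← hm]
    rfl

variable (C) in
/-- The isomorphism `T*(Spec C) ≅ MSpec Ω_C`. -/
def cotSpecIso : PreMod.Iso (cot (Spec C)) (MSpec C (Omega C)) :=
  (tensorToCot_locBij.isoSheafify (cot_isSheaf _)).toIso.symm

theorem cotSpecIso_d (U : Opens (Spec C).carrier) (c : C) :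
    (cotSpecIso C).app U (cot.d (Spec.fn U c)) = MSpec.of U (Omega.d c) := by
  refine ((tensorToCot_locBij.isoSheafify (cot_isSheaf _)).toIso.app U).symm_apply_eq.2 ?_
  refine Eq.trans ?_ (tensorToCot_locBij.isoSheafify_toSheafify (cot_isSheaf _)
    (mspecTmul 1 (Omega.d c))).symm
  refine congrArg ((cotPre (Spec C)).toSheafify U) ?_
  exact ((tensorToOmega_tmul 1 c).trans (one_smul _ _)).symm

end Spectrum

/-! ### Locally good schemes -/

section LocallyGood

variable {X Y : CSpace.{u}} (i : CSpace.Iso X Y)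

/-- The inverse of an isomorphism of `C^∞`-rings, as a morphism. -/
def CInfEquiv.symmHom {C D : Type u} [CInfRing C] [CInfRing D] (φ : CInfEquiv C D) :
    CInfHom D C where
  toAlgHom := φ.toAlgEquiv.symm
  map_op' f c := by
    refine φ.toAlgEquiv.symm_apply_eq.2 ?_
    refine Eq.trans ?_ (φ.map_op' f _).symm
    exact congrArg (op f) (funext fun k => (φ.toAlgEquiv.apply_symm_apply _).symm)

/-- An isomorphism of `C^∞`-rings, as a morphism. -/
def CInfEquiv.hom {C D : Type u} [CInfRing C] [CInfRing D] (φ : CInfEquiv C D) :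
    CInfHom C D where
  toAlgHom := φ.toAlgEquiv
  map_op' := φ.map_op'

theorem Omega.map_bijective {C D : Type u} [CInfRing C] [CInfRing D] (φ : CInfEquiv C D) :
    Function.Bijective (Omega.map φ.hom) := by
  have h1 : ∀ m, Omega.map φ.symmHom (Omega.map φ.hom m) = m := fun m => by
    rw [Omega.map_comp _ _ ⟨AlgHom.id ℝ C, fun _ _ => rfl⟩
      (fun c => φ.toAlgEquiv.symm_apply_apply c)]
    exact Omega.map_id _ (fun c => rfl) m
  have h2 : ∀ m, Omega.map φ.hom (Omega.map φ.symmHom m) = m := fun m => by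
    rw [Omega.map_comp _ _ ⟨AlgHom.id ℝ D, fun _ _ => rfl⟩
      (fun c => φ.toAlgEquiv.apply_symm_apply c)]
    exact Omega.map_id _ (fun c => rfl) m
  exact ⟨fun m m' h => by rw [← h1 m, h, h1], fun m => ⟨_, h2 m⟩⟩

/-- The morphism of cotangent presheaves given by an isomorphism of spaces. -/
def cotPreHom : PreMod.HomOver i (cotPre X) (cotPre Y) where
  app V := (Omega.map (i.sec V).hom).toAddMonoidHom
  app_smul r m := (Omega.map (i.sec _).hom).map_smulₛₗ r m
  app_res {V W} h m := by
    -- Both ways around the naturality square are induced by this one composite of ring morphisms.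
    let χ : CInfHom (Y.O V) (X.O (preimageOpens i.base W)) :=
      { toAlgHom := ((i.sec W).hom.toAlgHom).comp (Y.res h).toAlgHom
        map_op' := fun f c => by
          change (i.sec W).hom (Y.res h _) = _
          rw [CInfHom.map_op, CInfHom.map_op]
          rfl }
    exact (Omega.map_comp (Y.res h) (i.sec W).hom χ (fun c => rfl) m).trans
      (Omega.map_comp (i.sec V).hom (X.res (preimageOpens_mono i.base h)) χ
        (fun c => (i.sec_res h c).symm) m).symm

/-- The isomorphism of cotangent presheaves given by an isomorphism of spaces. -/
def cotPreIso : PreMod.IsoOver i (cotPre X) (cotPre Y) :=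
  (cotPreHom i).toIsoOver fun V => Omega.map_bijective (i.sec V)

/-- The morphism from the cotangent presheaf of `Y ≅ X|_U` to the restriction of `T*X`. -/
def cotRestrictHom {X : CSpace.{u}} (U : Opens X.carrier) (i : CSpace.Iso (X.restrict U) Y) :
    PreMod.HomOver i ((cot X).restrict U) (cotPre Y) where
  app V := ((cotPre X).toSheafify _).toAddMonoidHom.comp ((cotPreHom i).app V)
  app_smul {V} r m := (congrArg ((cotPre X).toSheafify _) ((cotPreHom i).app_smul r m)).trans
    (((cotPre X).toSheafify _).map_smul _ _)
  app_res {V W} h m := (congrArg ((cotPre X).toSheafify _) ((cotPreHom i).app_res h m)).trans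
    ((cotPre X).toSheafify_res _ _)

/-- Carries neighbourhoods found in the ambient space `X` over to `Y`, so that statements local on
`X` become local on `Y`. -/
theorem exists_imageOpens_le {X Y : Type u} [TopologicalSpace X] [TopologicalSpace Y]
    {U : Opens X} (e : U ≃ₜ Y) {V : Opens Y} {W : Opens X}
    (hW : W ≤ imageOpens (preimageOpens e V)) {y : Y} (hy : (e.symm y).1 ∈ W) :
    ∃ W' : Opens Y, W' ≤ V ∧ y ∈ W' ∧ imageOpens (preimageOpens e W') ≤ W := by
  refine ⟨preimageOpens e.symm ⟨Subtype.val ⁻¹' W, W.isOpen.preimage continuous_subtype_val⟩,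
    fun z hz => ?_, hy, fun z hz => ?_⟩
  · obtain ⟨_, hz'⟩ := mem_imageOpens.1 (hW hz)
    change e (e.symm z) ∈ V at hz'
    rwa [Homeomorph.apply_symm_apply] at hz'
  · obtain ⟨hzU, hz'⟩ := mem_imageOpens.1 hz
    change (e.symm (e ⟨z, hzU⟩)).1 ∈ W at hz'
    rwa [Homeomorph.symm_apply_apply] at hz'

theorem symm_mem_imageOpens {X Y : Type u} [TopologicalSpace X] [TopologicalSpace Y]
    {U : Opens X} (e : U ≃ₜ Y) {V : Opens Y} {y : Y} (hy : y ∈ V) :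
    (e.symm y).1 ∈ imageOpens (preimageOpens e V) :=
  mem_imageOpens.2 ⟨(e.symm y).2, by
    change e (e.symm y) ∈ V
    rwa [Homeomorph.apply_symm_apply]⟩

/-- On sections the isomorphism of spaces gives bijections of cotangent modules. What is left is
that a presheaf maps locally bijectively to its sheafification, with the neighbourhoods transported
along `i`. -/
theorem cotRestrictHom_locBij {X : CSpace.{u}} (U : Opens X.carrier)
    (i : CSpace.Iso (X.restrict U) Y) : (cotRestrictHom U i).LocBij where
  inj {V} m hm y hy := by
    have hm' : (cotPre X).toSheafify (imageOpens (U := U) (preimageOpens i.base V))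
        ((cotPreHom i).app V m) = (cotPre X).toSheafify _ 0 := Eq.trans hm (map_zero _).symm
    obtain ⟨W, hW, hyW, h⟩ := ((cotPre X).toSheafify_eq_iff _ _).1 hm' _
      (symm_mem_imageOpens (U := U) i.base hy)
    obtain ⟨W', hW'V, hyW', hW'⟩ := exists_imageOpens_le (U := U) i.base hW hyW
    refine ⟨W', hW'V, hyW', (cotPreIso i).app W' |>.injective ?_⟩
    refine ((cotPreHom i).app_res hW'V m).trans ?_
    refine ((cotPre X).res_res hW hW' _).symm.trans ?_
    rw [h, map_zero, map_zero, map_zero]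
    rfl
  surj {V} e y hy := by
    obtain ⟨W, hW, m, hyW, hm⟩ := (cotPre X).exists_toSheafify
      (U := imageOpens (U := U) (preimageOpens i.base V)) e
      (symm_mem_imageOpens (U := U) i.base hy)
    obtain ⟨W', hW'V, hyW', hW'⟩ := exists_imageOpens_le (U := U) i.base hW hyW
    obtain ⟨m', hm'⟩ := ((cotPreIso i).app W').surjective ((cotPre X).res hW' m)
    refine ⟨W', hW'V, m', hyW', ?_⟩
    refine Eq.trans (congrArg ((cotPre X).toSheafify _) hm') ?_
    refine ((cotPre X).toSheafify_res hW' m).trans ?_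
    rw [← hm]
    rfl

theorem IsLocallyGood.isCoherent_cot {X : CSpace.{u}} (hX : IsLocallyGood X) :
    IsCoherent (cot X) := by
  refine ⟨cot_isSheaf X, fun x => ?_⟩
  obtain ⟨U, hxU, C, hC, hg, ⟨i⟩⟩ := hX x
  refine ⟨U, hxU, C, hC, i, Omega C, inferInstance, inferInstance, hg.finitePresentation_omega,
    ⟨?_⟩⟩
  exact ((cotRestrictHom_locBij U i).isoSheafify ((cot_isSheaf X).restrict U)).precomp
    (cotSpecIso C).symm

end LocallyGood

/-! ### Germs of smooth functions on `ℝⁿ` -/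

section Germs

variable {n : ℕ}

theorem exists_smoothFn_bump {p : Fin n → ℝ} {W : Set (Fin n → ℝ)} (hW : W ∈ 𝓝 p) :
    ∃ b : SmoothFn n, (∀ᶠ q in 𝓝 p, b.1 q = 1) ∧ tsupport b.1 ⊆ W := by
  obtain ⟨ε, hε, hb⟩ := Metric.mem_nhds_iff.1 hW
  let β : ContDiffBump p := ⟨ε / 4, ε / 2, by linarith, by linarith⟩
  refine ⟨⟨β, SmoothFn.mem_iff.2 β.contDiff⟩, β.eventuallyEq_one, ?_⟩
  change tsupport β ⊆ W
  rw [β.tsupport_eq]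
  exact (Metric.closedBall_subset_ball (by change ε / 2 < ε; linarith)).trans hb

/-- A function that is smooth near `p` agrees near `p` with a globally smooth function. -/
theorem exists_smoothFn_eventuallyEq {G : (Fin n → ℝ) → ℝ} {p : Fin n → ℝ}
    {W : Set (Fin n → ℝ)} (hW : W ∈ 𝓝 p) (hG : ∀ q ∈ W, ContDiffAt ℝ ∞ G q) :
    ∃ f : SmoothFn n, f.1 =ᶠ[𝓝 p] G := by
  obtain ⟨b, hb, hbW⟩ := exists_smoothFn_bump hW
  refine ⟨⟨fun q => b.1 q * G q, SmoothFn.mem_iff.2 <| contDiff_iff_contDiffAt.2 fun q => ?_⟩, ?_⟩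
  · by_cases hq : q ∈ tsupport b.1
    · exact b.smooth.contDiffAt.mul (hG q (hbW hq))
    · refine (contDiffAt_const (c := (0 : ℝ))).congr_of_eventuallyEq ?_
      filter_upwards [(isClosed_tsupport _).isOpen_compl.mem_nhds hq] with r hr
      rw [image_eq_zero_of_notMem_tsupport hr, zero_mul]
  · filter_upwards [hb] with q hq
    rw [hq, one_mul]

/-- Smooth partitions of unity on open subsets of `ℝⁿ`, in terms of germs. -/
theorem exists_germ_partition {ι : Type*} (W : ι → Opens (Fin n → ℝ)) :
    ∃ η : ι → (Fin n → ℝ) → ℝ, ∀ p, (∃ j, p ∈ W j) → ∃ (F : Finset ι) (h : ι → SmoothFn n),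
      (∀ j ∈ F, p ∈ W j) ∧ (∀ᶠ q in 𝓝 p, ∑ j ∈ F, (h j).1 q = 1) ∧
        ∀ᶠ q in 𝓝 p, ∀ g : ι → ℝ, ∑ᶠ j, η j q * g j = ∑ j ∈ F, (h j).1 q * g j := by
  classical
  let Ω : Opens (Fin n → ℝ) := iSup W
  have hlc : LocallyCompactSpace Ω := Ω.isOpen.locallyCompactSpace
  obtain ⟨ρ, hρ⟩ := SmoothPartitionOfUnity.exists_isSubordinate 𝓘(ℝ, Fin n → ℝ) (M := Ω)
    isClosed_univ (fun j => Subtype.val ⁻¹' (W j : Set (Fin n → ℝ)))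
    (fun j => (W j).isOpen.preimage continuous_subtype_val)
    (fun x _ => Set.mem_iUnion.2 (Opens.mem_iSup.1 x.2))
  -- The extension by zero may fail to be smooth on the boundary of `Ω`; only its germs at points of
  -- `Ω` matter.
  let η : ι → (Fin n → ℝ) → ℝ := fun j q => if hq : q ∈ Ω then ρ j ⟨q, hq⟩ else 0
  have hη : ∀ j (x : Ω), η j x.1 = ρ j x := fun j x => by simp [η, x.2]
  have hsm : ∀ j, ∀ q ∈ Ω, ContDiffAt ℝ ∞ (η j) q := fun j q hq => by
    rw [← contMDiffAt_iff_contDiffAt]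
    refine (contMDiffAt_subtype_iff (U := Ω) (x := ⟨q, hq⟩)).1 ?_
    have : (fun x : Ω => η j x.1) = ρ j := funext (hη j)
    rw [this]
    exact (ρ j).contMDiff.contMDiffAt
  refine ⟨η, fun p hp => ?_⟩
  have hpΩ : p ∈ Ω := Opens.mem_iSup.2 hp
  choose h hh using fun j => exists_smoothFn_eventuallyEq (Ω.isOpen.mem_nhds hpΩ) (hsm j)
  -- These are the indices whose closed support contains `p`. Subordination puts `p` in `W j` for
  -- them, and near `p` all other members of the partition vanish.
  let F : Finset ι := ρ.fintsupport ⟨p, hpΩ⟩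
  have hF : ∀ᶠ q in 𝓝 p, ∀ hq : q ∈ Ω, ρ.finsupport ⟨q, hq⟩ ⊆ F := by
    have := ρ.eventually_finsupport_subset ⟨p, hpΩ⟩
    rw [Topology.IsInducing.subtypeVal.nhds_eq_comap, Filter.eventually_comap] at this
    filter_upwards [this] with q hq hqΩ
    exact hq ⟨q, hqΩ⟩ rfl
  have hall : ∀ᶠ q in 𝓝 p, ∀ j ∈ F, (h j).1 q = η j q :=
    (Filter.eventually_all_finset F).2 fun j _ => hh j
  have hzero : ∀ q, (∀ hq : q ∈ Ω, ρ.finsupport ⟨q, hq⟩ ⊆ F) → q ∈ Ω → ∀ j ∉ F, η j q = 0 := by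
    intro q h1 hq j hj
    have : j ∉ ρ.finsupport ⟨q, hq⟩ := fun hmem => hj (h1 hq hmem)
    rw [ρ.mem_finsupport, Function.mem_support, not_not] at this
    rw [← this]
    exact hη j ⟨q, hq⟩
  refine ⟨F, h, fun j hj => ?_, ?_, ?_⟩
  · exact hρ j ((ρ.mem_fintsupport_iff _ j).1 hj)
  · filter_upwards [hF, hall, Ω.isOpen.mem_nhds hpΩ] with q h1 h2 hq
    rw [Finset.sum_congr rfl h2, ← ρ.sum_eq_one (x := ⟨q, hq⟩) (Set.mem_univ _),
      finsum_eq_sum_of_support_subset]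
    · exact Finset.sum_congr rfl fun j _ => hη j ⟨q, hq⟩
    · intro j hj
      by_contra hjF
      exact hj ((hη j ⟨q, hq⟩).symm.trans (hzero q h1 hq j hjF))
  · filter_upwards [hF, hall, Ω.isOpen.mem_nhds hpΩ] with q h1 h2 hq g
    rw [finsum_eq_sum_of_support_subset (s := F)]
    · exact Finset.sum_congr rfl fun j hj => by rw [h2 j hj]
    · intro j hj
      by_contra hjF
      exact hj (by simp only [hzero q h1 hq j hjF, zero_mul])

end Germs

/-! ### Functions representing elements of localizations -/

section Rep

variable {C : Type u} [CInfRing C] {n : ℕ} (c : Fin n → C)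

/-- The point of `ℝⁿ` defined by an `ℝ`-point and the elements `c`. -/
def RPoint.coords (x : RPoint C) : Fin n → ℝ := fun i => x (c i)

theorem RPoint.continuous_coords : Continuous (RPoint.coords c) :=
  continuous_pi fun i => RPoint.continuous_eval (c i)

/-- Every element of `C` is Φ_f(c), whose evaluation is f composed with the coordinates. So
continuity of the coordinates already makes all evaluations continuous. -/
theorem RPoint.isInducing_coords (hgen : ∀ a : C, ∃ f : SmoothFn n, a = op f c) :
    Topology.IsInducing (RPoint.coords c) := by
  refine ⟨le_antisymm (RPoint.continuous_coords c).le_induced ?_⟩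
  refine continuous_iff_le_induced.1 ?_
  let : TopologicalSpace (RPoint C) := TopologicalSpace.induced (RPoint.coords c) inferInstance
  refine continuous_pi fun a => ?_
  obtain ⟨f, rfl⟩ := hgen a
  simp only [RPoint.map_op]
  exact f.smooth.continuous.comp continuous_induced_dom

/-- A bump function at the point, supported where `f` vanishes, annihilates `f` and supplies the
witness for the germ ideal. -/
theorem op_mem_germIdeal {x : RPoint C} {f : SmoothFn n}
    (hf : ∀ᶠ q in 𝓝 (RPoint.coords c x), f.1 q = 0) : op f c ∈ germIdeal x := by
  obtain ⟨b, hb, hbW⟩ := exists_smoothFn_bump hf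
  refine mem_germIdeal.2 ⟨op b c, ?_, ?_⟩
  · rw [RPoint.map_op]
    have : b.1 (RPoint.coords c x) = 1 := hb.self_of_nhds
    exact (this.trans_ne one_ne_zero :)
  · rw [← op_mul']
    have : f * b = 0 := SmoothFn.ext' fun q => by
      change f.1 q * b.1 q = 0
      by_cases hq : q ∈ tsupport b.1
      · have : f.1 q = 0 := hbW hq
        rw [this, zero_mul]
      · rw [image_eq_zero_of_notMem_tsupport hq, mul_zero]
    rw [this, op_zero]

theorem toLoc_op_congr {x : RPoint C} {f g : SmoothFn n}
    (h : f.1 =ᶠ[𝓝 (RPoint.coords c x)] g.1) : toLoc x (op f c) = toLoc x (op g c) := by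
  rw [toLoc_eq_iff, ← op_sub]
  refine op_mem_germIdeal c ?_
  filter_upwards [h] with q hq
  change f.1 q - g.1 q = 0
  rw [hq, sub_self]

/-- The element `z` of the localization at `x` is represented by the germ of the function `G`. -/
def RepAt (x : RPoint C) (G : (Fin n → ℝ) → ℝ) (z : Loc x) : Prop :=
  ∃ f : SmoothFn n, f.1 =ᶠ[𝓝 (RPoint.coords c x)] G ∧ toLoc x (op f c) = z

variable {c} {x : RPoint C} {G G' : (Fin n → ℝ) → ℝ} {z z' : Loc x}

theorem RepAt.unique (h : RepAt c x G z) (h' : RepAt c x G' z')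
    (hG : G =ᶠ[𝓝 (RPoint.coords c x)] G') : z = z' := by
  obtain ⟨f, hf, rfl⟩ := h
  obtain ⟨f', hf', rfl⟩ := h'
  exact toLoc_op_congr c (hf.trans (hG.trans hf'.symm))

theorem RepAt.congr (h : RepAt c x G z) (hG : G =ᶠ[𝓝 (RPoint.coords c x)] G') :
    RepAt c x G' z := by
  obtain ⟨f, hf, rfl⟩ := h
  exact ⟨f, hf.trans hG, rfl⟩

theorem RepAt.of_smoothFn (f : SmoothFn n) : RepAt c x f.1 (toLoc x (op f c)) :=
  ⟨f, Filter.EventuallyEq.rfl, rfl⟩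

theorem RepAt.op {m : ℕ} (f : SmoothFn m) {G : Fin m → (Fin n → ℝ) → ℝ} {z : Fin m → Loc x}
    (h : ∀ k, RepAt c x (G k) (z k)) :
    RepAt c x (fun q => f.1 fun k => G k q) (CInfRing.op f z) := by
  choose g hg hz using h
  refine ⟨f.comp g, ?_, ?_⟩
  · filter_upwards [Filter.eventually_all.2 hg] with q hq
    exact congrArg f.1 (funext hq)
  · rw [op_comp, CInfHom.map_op]
    exact congrArg _ (funext hz)

theorem RepAt.sum_mul {ι : Type*} (F : Finset ι) (h : ι → SmoothFn n)
    {g : ι → (Fin n → ℝ) → ℝ} {z : ι → Loc x} (hz : ∀ j ∈ F, RepAt c x (g j) (z j)) :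
    RepAt c x (fun q => ∑ j ∈ F, (h j).1 q * g j q)
      (∑ j ∈ F, toLoc x (CInfRing.op (h j) c) * z j) := by
  classical
  choose! f hf hz using hz
  refine ⟨∑ j ∈ F, h j * f j, ?_, ?_⟩
  · filter_upwards [(Filter.eventually_all_finset F).2 hf] with q hq
    rw [SmoothFn.coe_sum]
    exact Finset.sum_congr rfl fun j hj => congrArg ((h j).1 q * ·) (hq j hj)
  · rw [op_sum, map_sum]
    refine Finset.sum_congr rfl fun j hj => ?_
    rw [op_mul', map_mul, hz j hj]

/-- The partial derivative of a function on `ℝⁿ`. -/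
def partialDeriv (i : Fin n) (G : (Fin n → ℝ) → ℝ) (q : Fin n → ℝ) : ℝ :=
  fderiv ℝ G q (Pi.single i 1)

theorem partialDeriv_congr (i : Fin n) {p : Fin n → ℝ} (h : G =ᶠ[𝓝 p] G') :
    partialDeriv i G =ᶠ[𝓝 p] partialDeriv i G' := by
  filter_upwards [h.fderiv (𝕜 := ℝ)] with q hq
  rw [partialDeriv, partialDeriv, hq]

theorem RepAt.of_eventuallyEq {f : SmoothFn n} (hf : f.1 =ᶠ[𝓝 (RPoint.coords c x)] G) :
    RepAt c x G (toLoc x (CInfRing.op f c)) := ⟨f, hf, rfl⟩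

theorem RepAt.partialDeriv_of_eventuallyEq {f : SmoothFn n}
    (hf : f.1 =ᶠ[𝓝 (RPoint.coords c x)] G) (i : Fin n) :
    RepAt c x (partialDeriv i G) (toLoc x (CInfRing.op (f.pderiv i) c)) :=
  ⟨f.pderiv i, partialDeriv_congr i hf, rfl⟩

end Rep

/-! ### The cotangent presheaf of the spectrum of a finitely generated ring -/

theorem SmoothFn.pderiv_sum {n : ℕ} {ι : Type*} (s : Finset ι) (f : ι → SmoothFn n) (i : Fin n) :
    (∑ j ∈ s, f j).pderiv i = ∑ j ∈ s, (f j).pderiv i := by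
  classical
  induction s using Finset.induction_on with
  | empty => simpa using SmoothFn.pderiv_sub (0 : SmoothFn n) 0 i
  | insert j s hj ih => rw [Finset.sum_insert hj, Finset.sum_insert hj, SmoothFn.pderiv_add, ih]

section FinitelyGenerated

variable {C : Type u} [CInfRing C] {n : ℕ} (c : Fin n → C)

/-- Evaluation of sections in the localization at a point. -/
def sectionsEval {U : Opens (RPoint C)} (x : RPoint C) (hx : x ∈ U) :
    CInfHom (specSections C U) (Loc x) where
  toFun s := s.1 ⟨x, hx⟩
  map_one' := rfl
  map_mul' _ _ := rfl
  map_zero' := rfl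
  map_add' _ _ := rfl
  commutes' _ := rfl
  map_op' _ _ := rfl

/-- Evaluation of sections of the structure sheaf in the localization at a point. -/
def Spec.eval {U : Opens (Spec C).carrier} (x : RPoint C)
    (hx : x ∈ (U : Set (Spec C).carrier)) : CInfHom ((Spec C).O U) (Loc x) :=
  sectionsEval (U := U) x hx

theorem Spec.ext_eval {U : Opens (Spec C).carrier} {s t : (Spec C).O U}
    (h : ∀ x hx, Spec.eval x hx s = Spec.eval x hx t) : s = t := Spec.ext h

theorem Spec.eval_fn {U : Opens (Spec C).carrier} {x : RPoint C}
    (hx : x ∈ (U : Set (Spec C).carrier)) (a : C) : Spec.eval x hx (Spec.fn U a) = toLoc x a := rfl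

/-- The section `s` of the structure sheaf is represented by the function `G`. -/
def Represents {U : Opens (Spec C).carrier} (G : (Fin n → ℝ) → ℝ) (s : (Spec C).O U) : Prop :=
  ∀ (x : RPoint C) (hx : x ∈ (U : Set (Spec C).carrier)), RepAt c x G (Spec.eval x hx s)

/-- `G` needs only to have smooth germs along `U`. The function chosen at x still has the germ of
`G` at nearby points, so it defines the family of classes there as well. -/
theorem exists_sectionsRepresents {U : Opens (RPoint C)} {G : (Fin n → ℝ) → ℝ}
    (h : ∀ x ∈ U, ∃ f : SmoothFn n, f.1 =ᶠ[𝓝 (RPoint.coords c x)] G) :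
    ∃ s : specSections C U, ∀ (x : RPoint C) (hx : x ∈ U), RepAt c x G (s.1 ⟨x, hx⟩) := by
  choose f hf using h
  refine ⟨⟨fun x => toLoc x.1 (op (f x.1 x.2) c), mem_specSections.2 <| isSection_iff.2 fun x =>
    ⟨op (f x.1 x.2) c, ?_⟩⟩, fun x hx => ⟨f x hx, hf x hx, rfl⟩⟩
  have := ((RPoint.continuous_coords c).comp continuous_subtype_val).continuousAt.eventually
    (hf x.1 x.2).eventually_nhds
  filter_upwards [this] with y hy
  have hy' : (f x.1 x.2).1 =ᶠ[𝓝 (RPoint.coords c y.1)] G := hy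
  exact toLoc_op_congr c ((hf y.1 y.2).trans hy'.symm)

theorem exists_represents {U : Opens (Spec C).carrier} {G : (Fin n → ℝ) → ℝ}
    (h : ∀ x : RPoint C, x ∈ (U : Set (Spec C).carrier) →
      ∃ f : SmoothFn n, f.1 =ᶠ[𝓝 (RPoint.coords c x)] G) :
    ∃ s : (Spec C).O U, Represents c G s :=
  exists_sectionsRepresents c (U := U) h

variable {c}

theorem Represents.unique {U : Opens (Spec C).carrier} {G G' : (Fin n → ℝ) → ℝ}
    {s s' : (Spec C).O U} (h : Represents c G s) (h' : Represents c G' s')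
    (hG : ∀ x : RPoint C, x ∈ (U : Set (Spec C).carrier) →
      G =ᶠ[𝓝 (RPoint.coords c x)] G') : s = s' :=
  Spec.ext_eval fun x hx => (h x hx).unique (h' x hx) (hG x hx)

theorem Represents.exists_smoothFn {U : Opens (Spec C).carrier} {G : (Fin n → ℝ) → ℝ}
    {s : (Spec C).O U} (h : Represents c G s) (x : RPoint C)
    (hx : x ∈ (U : Set (Spec C).carrier)) : ∃ f : SmoothFn n, f.1 =ᶠ[𝓝 (RPoint.coords c x)] G ∧
      Spec.eval x hx s = toLoc x (op f c) := by
  obtain ⟨f, hf, h⟩ := h x hx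
  exact ⟨f, hf, h.symm⟩

theorem Represents.smoothFn (U : Opens (Spec C).carrier) (f : SmoothFn n) :
    Represents c f.1 (Spec.fn U (op f c)) := fun _ _ => RepAt.of_smoothFn f

theorem Represents.op {U : Opens (Spec C).carrier} {m : ℕ} (f : SmoothFn m)
    {G : Fin m → (Fin n → ℝ) → ℝ} {s : Fin m → (Spec C).O U} (h : ∀ k, Represents c (G k) (s k)) :
    Represents c (fun q => f.1 fun k => G k q) (CInfRing.op f s) := fun x hx => by
  rw [CInfHom.map_op]
  exact RepAt.op f fun k => h k x hx

/-- `a` is represented by a function with partial derivatives represented by `v`. -/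
def IsGradient (c : Fin n → C) {U : Opens (Spec C).carrier} (a : (Spec C).O U)
    (v : Fin n → (Spec C).O U) : Prop :=
  ∃ G, Represents c G a ∧ ∀ i, Represents c (partialDeriv i G) (v i)

theorem Represents.exists_isGradient {U : Opens (Spec C).carrier} {G : (Fin n → ℝ) → ℝ}
    {s : (Spec C).O U} (h : Represents c G s) : ∃ v, IsGradient c s v := by
  have : ∀ i, ∃ t : (Spec C).O U, Represents c (partialDeriv i G) t := fun i =>
    exists_represents c fun x hx => by
      obtain ⟨f, hf, -⟩ := h.exists_smoothFn x hx
      exact ⟨f.pderiv i, partialDeriv_congr i hf⟩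
  choose v hv using this
  exact ⟨v, G, h, hv⟩

theorem isGradient_fn (U : Opens (Spec C).carrier) (i : Fin n) :
    IsGradient c (Spec.fn U (c i)) (Pi.single i 1) := by
  refine ⟨(SmoothFn.proj i : SmoothFn n).1, ?_, fun j => ?_⟩
  · have := Represents.smoothFn (c := c) U (SmoothFn.proj i)
    rwa [op_proj] at this
  · have := Represents.smoothFn (c := c) U ((SmoothFn.proj i).pderiv j)
    have h : (Pi.single i 1 : Fin n → (Spec C).O U) j =
        Spec.fn U (CInfRing.op ((SmoothFn.proj i).pderiv j) c) := by
      rw [SmoothFn.pderiv_proj]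
      rcases eq_or_ne j i with rfl | h
      · rw [if_pos rfl, op_one, Pi.single_eq_same, Spec.fn_one]
      · rw [if_neg h, op_zero, Pi.single_eq_of_ne h, Spec.fn_zero]
    rw [h]
    exact this

theorem IsGradient.op {U : Opens (Spec C).carrier} {m : ℕ} (f : SmoothFn m)
    {a : Fin m → (Spec C).O U} {v : Fin m → Fin n → (Spec C).O U}
    (h : ∀ k, IsGradient c (a k) (v k)) :
    IsGradient c (CInfRing.op f a) (∑ k, CInfRing.op (f.pderiv k) a • v k) := by
  choose G hG hv using h
  refine ⟨_, Represents.op f hG, fun i x hx => ?_⟩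
  choose g hg hga using fun k => (hG k).exists_smoothFn x hx
  have hcomp : (f.comp g).1 =ᶠ[𝓝 (RPoint.coords c x)] fun q => f.1 fun k => G k q := by
    filter_upwards [Filter.eventually_all.2 hg] with q hq
    exact congrArg f.1 (funext hq)
  have h1 := RepAt.partialDeriv_of_eventuallyEq hcomp i
  have h2 : ∀ k, Spec.eval x hx (v k i) = toLoc x (CInfRing.op ((g k).pderiv i) c) := fun k =>
    (hv k i x hx).unique (RepAt.partialDeriv_of_eventuallyEq (hg k) i) Filter.EventuallyEq.rfl
  have h3 : Spec.eval x hx ((∑ k, CInfRing.op (f.pderiv k) a • v k) i) =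
      toLoc x (CInfRing.op ((f.comp g).pderiv i) c) := by
    rw [SmoothFn.pderiv_comp, op_sum, Finset.sum_apply, map_sum, map_sum]
    refine Finset.sum_congr rfl fun k _ => ?_
    rw [Pi.smul_apply, smul_eq_mul, map_mul, op_mul', map_mul, h2, CInfHom.map_op, op_comp,
      CInfHom.map_op]
    rw [CInfHom.map_op (toLoc x) (f.pderiv k)]
    exact congrArg (fun t => CInfRing.op (f.pderiv k) t * _) (funext hga)
  rw [h3]
  exact h1

/-- The chain rule for functions that are smooth on an open set: this expresses such a function as
the restriction of a smooth function to a closed submanifold. -/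
theorem IsGradient.d_eq {U : Opens (Spec C).carrier} {a : (Spec C).O U} {v : Fin n → (Spec C).O U}
    (h : IsGradient c a v) :
    cotPre.d a = ∑ i, v i • cotPre.d (Spec.fn U (c i)) := by
  obtain ⟨G, hG, hv⟩ := h
  -- The open set on which `G` is smooth; it contains the image of `U`.
  let Ω : Set (Fin n → ℝ) := {p | ∃ f : SmoothFn n, f.1 =ᶠ[𝓝 p] G}
  have hΩo : IsOpen Ω := by
    rw [isOpen_iff_mem_nhds]
    intro p hp
    rw [Set.mem_ofPred_eq] at hp
    obtain ⟨f, hf⟩ := hp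
    filter_upwards [hf.eventually_nhds] with q hq
    rw [Set.mem_ofPred_eq]
    exact ⟨f, hq⟩
  have hGΩ : ∀ p ∈ Ω, ContDiffAt ℝ ∞ G p := by
    intro p hp
    rw [Set.mem_ofPred_eq] at hp
    obtain ⟨f, hf⟩ := hp
    exact f.smooth.contDiffAt.congr_of_eventuallyEq hf.symm
  have hUΩ : ∀ x : RPoint C, x ∈ (U : Set (Spec C).carrier) → RPoint.coords c x ∈ Ω := by
    intro x hx
    rw [Set.mem_ofPred_eq]
    obtain ⟨f, hf, -⟩ := hG.exists_smoothFn x hx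
    exact ⟨f, hf⟩
  obtain ⟨χ, hχs, hχ, -⟩ := hΩo.exists_contDiff_support_eq (n := ⊤)
  have hχ0 : ∀ p, χ p ≠ 0 ↔ p ∈ Ω := fun p => by rw [← hχs, Function.mem_support]
  -- The cutoff is 1 near 1 and vanishes at distance at least 1/2 from 1, hence near 0. So G(p) β(t
  -- χ(p)) is smooth on all of ℝⁿ⁺¹: over points outside `Ω` the argument of β is near 0.
  let β : ContDiffBump (1 : ℝ) := ⟨1 / 4, 1 / 2, by norm_num, by norm_num⟩
  let tl : (Fin (n + 1) → ℝ) →L[ℝ] (Fin n → ℝ) :=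
    ContinuousLinearMap.pi fun i => ContinuousLinearMap.proj i.succ
  let f : SmoothFn (n + 1) := ⟨fun p => G (tl p) * β (p 0 * χ (tl p)), by
    refine SmoothFn.mem_iff.2 (contDiff_iff_contDiffAt.2 fun p => ?_)
    have h1 : ContDiff ℝ ∞ fun p : Fin (n + 1) → ℝ => p 0 * χ (tl p) :=
      (contDiff_apply ℝ ℝ 0).mul (hχ.comp tl.contDiff)
    by_cases hp : tl p ∈ Ω
    · exact ((hGΩ _ hp).comp p tl.contDiff.contDiffAt).mul (β.contDiff.comp h1).contDiffAt
    · refine (contDiffAt_const (c := (0 : ℝ))).congr_of_eventuallyEq ?_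
      have h0 : χ (tl p) = 0 := by rwa [← not_iff_not.2 (hχ0 _), not_not] at hp
      have : ∀ᶠ q in 𝓝 p, q 0 * χ (tl q) < 1 / 2 :=
        h1.continuous.continuousAt.eventually_lt_const (by simp [h0])
      filter_upwards [this] with q hq
      rw [β.zero_of_le_dist, mul_zero]
      rw [Real.dist_eq, abs_sub_comm]
      exact le_trans (by change (1 : ℝ) / 2 ≤ _; linarith) (le_abs_self _)⟩
  -- The extra coordinate t = 1/χ is a section over `U` because χ has no zeros on `Ω`.
  obtain ⟨e, he⟩ := exists_represents c (U := U) (G := fun q => (χ q)⁻¹) fun x hx =>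
    exists_smoothFn_eventuallyEq (hΩo.mem_nhds (hUΩ x hx)) fun q hq =>
      hχ.contDiffAt.inv ((hχ0 q).2 hq)
  let G' : Fin (n + 1) → (Fin n → ℝ) → ℝ :=
    Fin.cons (fun q => (χ q)⁻¹) fun i => (SmoothFn.proj i : SmoothFn n).1
  let s : Fin (n + 1) → (Spec C).O U := Fin.cons e fun i => Spec.fn U (c i)
  have hs : ∀ k, Represents c (G' k) (s k) := by
    intro k
    refine Fin.cases he (fun i => ?_) k
    have := Represents.smoothFn (c := c) U (SmoothFn.proj i)
    rwa [op_proj] at this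
  have hpt : ∀ q, tl (fun k => G' k q) = q := fun q => rfl
  have hpt0 : ∀ q, (fun k => G' k q) 0 = (χ q)⁻¹ := fun q => rfl
  -- Near the graph of 1/χ the cutoff is identically 1, so `f` does not depend on t to first order
  -- there. The derivative in t therefore drops out of the chain rule for Φ_f(e, c₁, …, c_n).
  have hfG : ∀ q ∈ Ω, f.1 =ᶠ[𝓝 fun k => G' k q] fun p => G (tl p) := by
    intro q hq
    have h1 : Continuous fun p : Fin (n + 1) → ℝ => p 0 * χ (tl p) :=
      (continuous_apply 0).mul (hχ.continuous.comp tl.continuous)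
    have h2 : (fun p : Fin (n + 1) → ℝ => p 0 * χ (tl p)) (fun k => G' k q) = 1 := by
      change (fun k => G' k q) 0 * χ (tl fun k => G' k q) = 1
      rw [hpt, hpt0, inv_mul_cancel₀ ((hχ0 q).2 hq)]
    have h3 := (h1.continuousAt (x := fun k => G' k q)).eventually (p := fun t => β t = 1)
      (by rw [h2]; exact β.eventuallyEq_one)
    filter_upwards [h3] with p hp
    change G (tl p) * β (p 0 * χ (tl p)) = _
    rw [hp, mul_one]
  have hderiv : ∀ q ∈ Ω, ∀ w, fderiv ℝ f.1 (fun k => G' k q) w = fderiv ℝ G q (tl w) := by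
    intro q hq w
    rw [(hfG q hq).fderiv_eq]
    have h1 : HasFDerivAt G (fderiv ℝ G q) (tl fun k => G' k q) :=
      ((hGΩ q hq).differentiableAt (by simp)).hasFDerivAt
    have h2 : HasFDerivAt (fun p => G (tl p)) ((fderiv ℝ G q).comp tl) fun k => G' k q :=
      h1.comp _ tl.hasFDerivAt
    rw [h2.fderiv]
    rfl
  have hnear : ∀ x : RPoint C, x ∈ (U : Set (Spec C).carrier) →
      ∀ᶠ q in 𝓝 (RPoint.coords c x), q ∈ Ω := fun x hx => hΩo.mem_nhds (hUΩ x hx)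
  have ha : a = CInfRing.op f s := by
    refine hG.unique (Represents.op f hs) fun x hx => ?_
    filter_upwards [hnear x hx] with q hq
    exact (hfG q hq).self_of_nhds.symm
  have hv0 : CInfRing.op (f.pderiv 0) s = 0 := by
    have hz := Represents.smoothFn (c := c) U (0 : SmoothFn n)
    rw [op_zero, Spec.fn_zero] at hz
    refine (Represents.op (f.pderiv 0) hs).unique hz fun x hx => ?_
    filter_upwards [hnear x hx] with q hq
    rw [SmoothFn.pderiv_apply, hderiv q hq]
    have : tl (Pi.single 0 1) = 0 := by
      funext i
      change (Pi.single 0 1 : Fin (n + 1) → ℝ) i.succ = 0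
      simp
    rw [this, map_zero]
    rfl
  have hvs : ∀ i : Fin n, CInfRing.op (f.pderiv i.succ) s = v i := by
    intro i
    refine (Represents.op (f.pderiv i.succ) hs).unique (hv i) fun x hx => ?_
    filter_upwards [hnear x hx] with q hq
    rw [SmoothFn.pderiv_apply, hderiv q hq, partialDeriv]
    congr 1
    funext j
    change (Pi.single i.succ 1 : Fin (n + 1) → ℝ) j.succ = _
    simp [Pi.single_apply]
  rw [ha, cotPre.isCInfDer_d, Fin.sum_univ_succ, hv0, zero_smul, zero_add]
  exact Finset.sum_congr rfl fun i _ => by rw [hvs]; rfl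

theorem isOpen_coe_rpoint (V : Opens (RPoint C)) : IsOpen (V : Set (RPoint C)) := V.isOpen

variable (hgen : ∀ a : C, ∃ f : SmoothFn n, a = op f c)

include hgen

/-- Open sets of the spectrum are preimages of open sets of ℝⁿ, so partitions of unity are taken
upstairs in ℝⁿ. -/
theorem exists_spec_partition {ι : Type*} (V : ι → Opens (Spec C).carrier) :
    ∃ η : ι → (Fin n → ℝ) → ℝ, ∀ x : RPoint C, (∃ j, x ∈ (V j : Set (Spec C).carrier)) →
      ∃ (F : Finset ι) (h : ι → SmoothFn n), (∀ j ∈ F, x ∈ (V j : Set (Spec C).carrier)) ∧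
        (∀ᶠ q in 𝓝 (RPoint.coords c x), ∑ j ∈ F, (h j).1 q = 1) ∧
          ∀ᶠ q in 𝓝 (RPoint.coords c x), ∀ g : ι → ℝ,
            ∑ᶠ j, η j q * g j = ∑ j ∈ F, (h j).1 q * g j := by
  choose W hWo hW using fun j =>
    (RPoint.isInducing_coords c hgen).isOpen_iff.1
    (isOpen_coe_rpoint (V j))
  have hmem : ∀ (x : RPoint C) j, x ∈ (V j : Set (Spec C).carrier) ↔ RPoint.coords c x ∈ W j :=
    fun x j => (Set.ext_iff.1 (hW j) x).symm
  obtain ⟨η, hη⟩ := exists_germ_partition fun j => (⟨W j, hWo j⟩ : Opens (Fin n → ℝ))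
  refine ⟨η, fun x ⟨j, hj⟩ => ?_⟩
  obtain ⟨F, h, hF, h1, h2⟩ := hη (RPoint.coords c x) ⟨j, (hmem x j).1 hj⟩
  exact ⟨F, h, fun k hk => (hmem x k).2 (hF k hk), h1, h2⟩

/-- Locally the section comes from smooth functions gⱼ, and G = ∑ ηⱼ gⱼ. At each x all relevant gⱼ
represent the same element, and the weights sum to 1. -/
theorem exists_represents_of_section {U : Opens (Spec C).carrier} (s : (Spec C).O U) :
    ∃ G, Represents c G s := by
  choose V hV a hxV ha using fun x : U => Spec.exists_fn s x.2
  choose g hg using fun x => hgen (a x)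
  obtain ⟨η, hη⟩ := exists_spec_partition hgen V
  refine ⟨fun q => ∑ᶠ j, η j q * (g j).1 q, fun x hx => ?_⟩
  obtain ⟨F, h, hF, h1, h2⟩ := hη x ⟨⟨x, hx⟩, hxV ⟨x, hx⟩⟩
  have hrep : ∀ j ∈ F, RepAt c x (g j).1 (Spec.eval x hx s) := fun j hj => by
    have : Spec.eval x hx s = toLoc x (op (g j) c) := by
      rw [← hg j]
      exact congrArg (Spec.eval x (hF j hj)) (ha j)
    rw [this]
    exact RepAt.of_smoothFn _
  have key := RepAt.sum_mul F h hrep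
  rw [← Finset.sum_mul, ← map_sum, ← op_sum] at key
  have hone : toLoc x (op (∑ j ∈ F, h j) c) = 1 := by
    rw [← map_one (toLoc x).toAlgHom, ← op_one c]
    refine toLoc_op_congr c ?_
    filter_upwards [h1] with q hq
    rw [SmoothFn.coe_sum, hq]
    rfl
  rw [hone, one_mul] at key
  refine key.congr ?_
  filter_upwards [h2] with q hq
  exact (hq fun j => (g j).1 q).symm

theorem exists_isGradient {U : Opens (Spec C).carrier} (s : (Spec C).O U) :
    ∃ v, IsGradient c s v := by
  obtain ⟨G, hG⟩ := exists_represents_of_section hgen s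
  exact hG.exists_isGradient

theorem exists_eq_sum_smul_d {U : Opens (Spec C).carrier} (m : (cotPre (Spec C)).M U) :
    ∃ v : Fin n → (Spec C).O U, m = ∑ i, v i • cotPre.d (Spec.fn U (c i)) := by
  induction m using cotPre.induction with
  | zero => exact ⟨0, by simp⟩
  | add m m' h h' =>
    obtain ⟨v, rfl⟩ := h
    obtain ⟨w, rfl⟩ := h'
    exact ⟨v + w, by simp [add_smul, Finset.sum_add_distrib]⟩
  | smul_d a s =>
    obtain ⟨v, hv⟩ := exists_isGradient hgen s
    exact ⟨a • v, by simp [hv.d_eq, Finset.smul_sum, mul_smul]⟩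

theorem sum_smul_cotPre_d_eq_zero_iff {U : Opens (Spec C).carrier} (v : Fin n → (Spec C).O U) :
    ∑ i, v i • cotPre.d (Spec.fn U (c i)) = 0 ↔ IsGradient c 0 v :=
  Omega.sum_smul_d_eq_zero_iff (fun i => Spec.fn U (c i)) (IsGradient c)
    (exists_isGradient hgen) (isGradient_fn U) (fun f _ _ h => IsGradient.op f h)
    (fun _ _ h => h.d_eq) v

/-- Let Gⱼ represent 0 on Vⱼ with gradient v. Then ∑ ηⱼ Gⱼ represents 0 on `U`, and in its gradient
∑ (ηⱼ ∂Gⱼ + Gⱼ ∂ηⱼ) the second terms represent 0 while the first sum to v. -/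
theorem cotPre_spec_eq_zero_of_local {U : Opens (Spec C).carrier} (m : (cotPre (Spec C)).M U)
    {ι : Type*} (V : ι → Opens (Spec C).carrier) (hV : ∀ j, V j ≤ U) (hcov : U ≤ iSup V)
    (hm : ∀ j, (cotPre (Spec C)).res (hV j) m = 0) : m = 0 := by
  obtain ⟨v, rfl⟩ := exists_eq_sum_smul_d hgen m
  rw [sum_smul_cotPre_d_eq_zero_iff hgen]
  have hj : ∀ j, IsGradient c 0 fun i => (Spec C).res (hV j) (v i) := fun j => by
    rw [← sum_smul_cotPre_d_eq_zero_iff hgen, ← hm j, map_sum]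
    simp only [PreMod.res_smul, cotPre.res_d, Spec.res_fn]
  choose G hG hGv using hj
  obtain ⟨η, hη⟩ := exists_spec_partition hgen V
  have key : ∀ (x : RPoint C) (hx : x ∈ (U : Set (Spec C).carrier)),
      ∃ f : SmoothFn n, f.1 =ᶠ[𝓝 (RPoint.coords c x)] (fun q => ∑ᶠ j, η j q * G j q) ∧
        toLoc x (op f c) = 0 ∧ ∀ i, toLoc x (op (f.pderiv i) c) = Spec.eval x hx (v i) := by
    intro x hx
    obtain ⟨j₀, hj₀⟩ := Opens.mem_iSup.1 (hcov hx)
    obtain ⟨F, h, hF, h1, h2⟩ := hη x ⟨j₀, hj₀⟩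
    have hg : ∀ j ∈ F, ∃ g : SmoothFn n, g.1 =ᶠ[𝓝 (RPoint.coords c x)] G j ∧
        toLoc x (op g c) = 0 ∧ ∀ i, toLoc x (op (g.pderiv i) c) = Spec.eval x hx (v i) := by
      intro j hj
      obtain ⟨g, hg, hg0⟩ := (hG j).exists_smoothFn x (hF j hj)
      refine ⟨g, hg, ?_, fun i => ?_⟩
      · rw [← hg0, map_zero]
      · exact (RepAt.partialDeriv_of_eventuallyEq hg i).unique (hGv j i x (hF j hj))
          Filter.EventuallyEq.rfl
    choose! g hg hg0 hgv using hg
    refine ⟨∑ j ∈ F, h j * g j, ?_, ?_, fun i => ?_⟩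
    · filter_upwards [h2, (Filter.eventually_all_finset F).2 hg] with q hq hq'
      rw [SmoothFn.coe_sum, hq]
      exact Finset.sum_congr rfl fun j hj => congrArg ((h j).1 q * ·) (hq' j hj)
    · rw [op_sum, map_sum]
      refine Finset.sum_eq_zero fun j hj => ?_
      rw [op_mul', map_mul, hg0 j hj, mul_zero]
    · have hone : toLoc x (op (∑ j ∈ F, h j) c) = 1 := by
        rw [← map_one (toLoc x).toAlgHom, ← op_one c]
        refine toLoc_op_congr c ?_
        filter_upwards [h1] with q hq
        rw [SmoothFn.coe_sum, hq]
        rfl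
      rw [SmoothFn.pderiv_sum, op_sum, map_sum]
      have : ∀ j ∈ F, toLoc x (op ((h j * g j).pderiv i) c) =
          toLoc x (op (h j) c) * Spec.eval x hx (v i) := fun j hj => by
        rw [SmoothFn.pderiv_mul, op_add', op_mul', op_mul', map_add, map_mul, map_mul, hg0 j hj,
          hgv j hj, zero_mul, add_zero]
      rw [Finset.sum_congr rfl this, ← Finset.sum_mul, ← map_sum, ← op_sum, hone, one_mul]
  refine ⟨fun q => ∑ᶠ j, η j q * G j q, fun x hx => ?_, fun i x hx => ?_⟩
  · obtain ⟨f, hf, hf0, -⟩ := key x hx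
    rw [map_zero, ← hf0]
    exact RepAt.of_eventuallyEq hf
  · obtain ⟨f, hf, -, hfv⟩ := key x hx
    rw [← hfv]
    exact RepAt.partialDeriv_of_eventuallyEq hf i

/-- To glue sⱼ = ∑ᵢ vⱼᵢ dcᵢ, average the coefficients with a partition of unity. The vⱼᵢ need not
agree on overlaps, but the sums sⱼ do, and so the average restricts to each of them. -/
theorem cotPre_spec_isSheaf_of_generators : (cotPre (Spec C)).IsSheaf where
  locality V hV hcov s t hst := sub_eq_zero.1 <|
    cotPre_spec_eq_zero_of_local hgen _ V hV hcov fun j => by rw [map_sub, hst j, sub_self]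
  gluing {ι U} V hV hcov s hs := by
    choose v hv using fun j => exists_eq_sum_smul_d hgen (s j)
    choose G hG using fun j i => exists_represents_of_section hgen (v j i)
    obtain ⟨η, hη⟩ := exists_spec_partition hgen V
    -- On the neighbourhood `W` a fixed finite set `F` of indices and fixed smooth weights compute
    -- the partition at every point, so identities can be written between sections over `W` and not
    -- only between germs.
    have key : ∀ (x : RPoint C), x ∈ (U : Set (Spec C).carrier) →
        ∃ (W : Opens (Spec C).carrier) (F : Finset ι) (h : ι → SmoothFn n),
          x ∈ (W : Set (Spec C).carrier) ∧ (∀ j ∈ F, W ≤ V j) ∧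
          (∑ j ∈ F, Spec.fn W (op (h j) c) = 1) ∧
          ∀ y (hy : y ∈ (W : Set (Spec C).carrier)), ∀ i (z : ι → Loc y),
            (∀ j ∈ F, RepAt c y (G j i) (z j)) →
            RepAt c y (fun q => ∑ᶠ j, η j q * G j i q)
              (∑ j ∈ F, Spec.eval y hy (Spec.fn W (op (h j) c)) * z j) := by
      intro x hx
      obtain ⟨j₀, hj₀⟩ := Opens.mem_iSup.1 (hcov hx)
      obtain ⟨F, h, hF, h1, h2⟩ := hη x ⟨j₀, hj₀⟩
      have hcont := (RPoint.continuous_coords c).continuousAt (x := x)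
      have e1 : ∀ᶠ y in 𝓝 x, ∀ j ∈ F, y ∈ (V j : Set (Spec C).carrier) :=
        (Filter.eventually_all_finset F).2 fun j hj => (V j).isOpen.mem_nhds (hF j hj)
      obtain ⟨W, hxW, hW⟩ : ∃ W : Opens (Spec C).carrier, x ∈ (W : Set (Spec C).carrier) ∧
          ∀ y : RPoint C, y ∈ (W : Set (Spec C).carrier) → _ :=
        exists_opens_of_eventually ((e1.and (hcont.eventually h1.eventually_nhds)).and
          (hcont.eventually h2.eventually_nhds))
      refine ⟨W, F, h, hxW, fun j hj y hy => (hW y hy).1.1 j hj, ?_, fun y hy i z hz => ?_⟩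
      · refine Spec.ext_eval fun y hy => ?_
        rw [map_sum, map_one]
        simp only [Spec.eval_fn]
        rw [← map_sum, ← op_sum, ← map_one (toLoc y).toAlgHom, ← op_one c]
        refine toLoc_op_congr c ?_
        filter_upwards [(hW y hy).1.2] with q hq
        rw [SmoothFn.coe_sum, hq]
        rfl
      · refine (RepAt.sum_mul F h hz).congr ?_
        filter_upwards [(hW y hy).2] with q hq
        exact (hq fun j => G j i q).symm
    have hex : ∀ i, ∃ a : (Spec C).O U, Represents c (fun q => ∑ᶠ j, η j q * G j i q) a := by
      intro i
      refine exists_represents c fun x hx => ?_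
      obtain ⟨W, F, h, hxW, hWV, -, H⟩ := key x hx
      choose! z hz using fun j (hj : j ∈ F) => (⟨_, hG j i x (hWV j hj hxW)⟩ :
        ∃ z, RepAt c x (G j i) z)
      obtain ⟨f, hf, -⟩ := H x hxW i z hz
      exact ⟨f, hf⟩
    choose a ha using hex
    refine ⟨∑ i, a i • cotPre.d (Spec.fn U (c i)), fun k => sub_eq_zero.1 ?_⟩
    choose W F h hxW hWV hone H using fun x : V k => key x.1 (hV k x.2)
    refine cotPre_spec_eq_zero_of_local hgen _ (fun x : V k => V k ⊓ W x) (fun x => inf_le_left)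
      (fun x hx => Opens.mem_iSup.2 ⟨⟨x, hx⟩, hx, hxW _⟩) fun x => ?_
    rw [map_sub, sub_eq_zero, (cotPre (Spec C)).res_res]
    have hcoef : ∀ i, (Spec C).res (inf_le_left.trans (hV k) : V k ⊓ W x ≤ U) (a i) =
        ∑ j ∈ (F x).attach, (Spec C).res inf_le_right (Spec.fn (W x) (op (h x j) c)) *
          (Spec C).res (inf_le_right.trans (hWV x j.1 j.2)) (v j i) := by
      classical
      intro i
      refine Spec.ext_eval fun y hy => ?_
      have hyW : y ∈ (W x : Set (Spec C).carrier) := hy.2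
      -- The value 0 outside `F x` is a dummy; the sum runs over `F x` only.
      let z : ι → Loc y := fun j => if hj : j ∈ F x then
        Spec.eval y (hWV x j hj hyW) (v j i) else 0
      have hz : ∀ j (hj : j ∈ F x), z j = Spec.eval y (hWV x j hj hyW) (v j i) := fun j hj =>
        dif_pos hj
      have := H x y hyW i z fun j hj => by rw [hz j hj]; exact hG j i y _
      refine ((ha i y (hV k hy.1)).unique this Filter.EventuallyEq.rfl).trans ?_
      rw [map_sum, ← Finset.sum_attach]
      refine Finset.sum_congr rfl fun j _ => ?_
      rw [map_mul, hz j.1 j.2]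
      rfl
    -- Restricted to the overlap, each inner sum is sⱼ, hence equals s_k. It can then be factored
    -- out of the average, whose weights sum to 1.
    have hsk : ∀ j : {j // j ∈ F x}, ∑ i, (Spec C).res (inf_le_right.trans (hWV x j.1 j.2) :
        V k ⊓ W x ≤ V j) (v j i) • cotPre.d (Spec.fn (V k ⊓ W x) (c i)) =
          (cotPre (Spec C)).res inf_le_left (s k) := by
      intro j
      have h1 := congrArg ((cotPre (Spec C)).res (le_inf inf_le_left
        (inf_le_right.trans (hWV x j.1 j.2)) : V k ⊓ W x ≤ V k ⊓ V j)) (hs k j.1)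
      rw [(cotPre (Spec C)).res_res, (cotPre (Spec C)).res_res] at h1
      rw [h1]
      conv_rhs => rw [hv j.1, map_sum]
      simp only [PreMod.res_smul, cotPre.res_d, Spec.res_fn]
    rw [map_sum]
    simp only [PreMod.res_smul, cotPre.res_d, Spec.res_fn, hcoef, Finset.sum_smul, mul_smul]
    rw [Finset.sum_comm]
    simp only [← Finset.smul_sum, hsk]
    rw [← Finset.sum_smul]
    have h1 : ∑ j ∈ (F x).attach, Spec.fn (V k ⊓ W x) (op (h x j.1) c) = 1 := by
      rw [Finset.sum_attach (F x) fun j => Spec.fn (V k ⊓ W x) (op (h x j) c)]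
      have := congrArg ((Spec C).res (inf_le_right : V k ⊓ W x ≤ W x)) (hone x)
      rw [map_sum, map_one] at this
      exact this
    rw [h1, one_smul]

end FinitelyGenerated

theorem IsFair.isFG {C : Type u} [CInfRing C] (h : IsFair C) : IsFG C := by
  obtain ⟨n, φ, hφ, -⟩ := h
  refine ⟨n, fun i => φ (SmoothFn.proj i), fun a => ?_⟩
  obtain ⟨f, rfl⟩ := hφ a
  exact ⟨f, φ.apply_eq_op f⟩

theorem IsFG.cotPre_isSheaf {C : Type u} [CInfRing C] (h : IsFG C) : (cotPre (Spec C)).IsSheaf := by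
  obtain ⟨n, c, hc⟩ := h
  exact cotPre_spec_isSheaf_of_generators hc

theorem IsFairAffine.cotPre_isSheaf {X : CSpace.{u}} (h : IsFairAffine X) :
    (cotPre X).IsSheaf := by
  obtain ⟨C, _, hC, ⟨i⟩⟩ := h
  exact PreMod.IsSheaf.of_isoOver (cotPreIso i) hC.isFG.cotPre_isSheaf

/-! ### Extension of smooth functions from quadrants -/

section Seeley

open Polynomial

/-- The polynomial with roots `1, 2, …, 2^(N-1)`. -/
def nodePoly (N : ℕ) : ℝ[X] := ∏ l ∈ Finset.range N, (X - C ((2 : ℝ) ^ l))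

theorem nodePoly_eval_of_lt {m N : ℕ} (h : m < N) : (nodePoly N).eval ((2 : ℝ) ^ m) = 0 := by
  rw [nodePoly, eval_prod]
  exact Finset.prod_eq_zero (Finset.mem_range.2 h) (by simp)

theorem nodePoly_eval_self_pos (N : ℕ) : 0 < (nodePoly N).eval ((2 : ℝ) ^ N) := by
  rw [nodePoly, eval_prod]
  refine Finset.prod_pos fun l hl => ?_
  have : (2 : ℝ) ^ l < 2 ^ N := pow_lt_pow_right₀ (by norm_num) (Finset.mem_range.1 hl)
  simpa using this

theorem nodePoly_natDegree_lt (N : ℕ) : (nodePoly N).natDegree < N + 1 := by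
  rw [nodePoly, natDegree_prod_of_monic _ _ fun l _ => monic_X_sub_C _]
  simp only [natDegree_X_sub_C, Finset.sum_const, Finset.card_range, smul_eq_mul, mul_one]
  exact N.lt_succ_self

/-- The correction at stage `N` of the moment problem. As a function of m, γ 2^(Km) `nodePoly
N`(2^m) is 0 for m < N and δ at m = N. A large `K` makes the total mass in the lower moments as
small as desired, since 2^(Km) / 2^(KN) ≤ 2^(-K). -/
theorem exists_hump (N : ℕ) (δ : ℝ) : ∃ (K : ℕ) (γ : ℝ),
    γ * 2 ^ (K * N) * (nodePoly N).eval ((2 : ℝ) ^ N) = δ ∧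
    ∀ m < N, |γ| * 2 ^ (K * m) * ∑ i ∈ Finset.range (N + 1), |(nodePoly N).coeff i| * 2 ^ (i * m) ≤
      (1 / 2) ^ N := by
  set q := (nodePoly N).eval ((2 : ℝ) ^ N) with hq
  have hq0 : 0 < q := nodePoly_eval_self_pos N
  set B := ∑ i ∈ Finset.range (N + 1), |(nodePoly N).coeff i| * (2 : ℝ) ^ (i * N) with hB
  -- 2^K must absorb the normalisation |δ| / q, the coefficient sum `B` and the wanted gain 2^N.
  obtain ⟨K, hK⟩ := pow_unbounded_of_one_lt (2 ^ N * (|δ| / q * B)) (one_lt_two (α := ℝ))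
  refine ⟨K, δ / q / 2 ^ (K * N), by field_simp, fun m hm => ?_⟩
  have h1 : ∑ i ∈ Finset.range (N + 1), |(nodePoly N).coeff i| * (2 : ℝ) ^ (i * m) ≤ B :=
    Finset.sum_le_sum fun i _ => by
      gcongr
      norm_num
  have h2 : (2 : ℝ) ^ (K * m) * 2 ^ K ≤ 2 ^ (K * N) := by
    rw [← pow_add]
    exact pow_le_pow_right₀ (by norm_num) (by nlinarith)
  have hab : |δ / q / 2 ^ (K * N)| = |δ| / q / 2 ^ (K * N) := by
    rw [abs_div, abs_div, abs_of_pos hq0, abs_of_pos (by positivity : (0 : ℝ) < 2 ^ (K * N))]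
  rw [hab]
  calc |δ| / q / 2 ^ (K * N) * 2 ^ (K * m) *
        ∑ i ∈ Finset.range (N + 1), |(nodePoly N).coeff i| * (2 : ℝ) ^ (i * m)
      ≤ |δ| / q / (2 ^ (K * m) * 2 ^ K) * 2 ^ (K * m) * B := by gcongr
    _ = (|δ| / q * B) / 2 ^ K := by field_simp
    _ ≤ (1 / 2) ^ N := by
      rw [one_div, inv_pow, div_le_iff₀ (by positivity), ← div_eq_inv_mul,
        le_div_iff₀ (by positivity)]
      linarith

/-- Seeley's coefficients. -/
theorem exists_seeley_coefficients : ∃ a s : ℕ × ℕ → ℝ, (∀ k, s k ≤ -1) ∧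
    ∀ w : ℕ, (Summable fun k => |a k * s k ^ w|) ∧ ∑' k, a k * s k ^ w = 1 := by
  choose K γ hδ hγ using exists_hump
  -- `u N m` is (-1)^m times the m-th moment of the first `N` stages. Stage `N` corrects the value
  -- at N to (-1)^N, which makes the N-th moment 1; later stages leave it alone because their
  -- polynomials vanish at 2^N.
  let u : ℕ → ℕ → ℝ := fun N => Nat.rec 0 (fun N v m => v m +
    γ N ((-1) ^ N - v N) * 2 ^ (K N ((-1) ^ N - v N) * m) * (nodePoly N).eval ((2 : ℝ) ^ m)) N
  let k : ℕ → ℕ := fun N => K N ((-1) ^ N - u N N)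
  let g : ℕ → ℝ := fun N => γ N ((-1) ^ N - u N N)
  have hu : ∀ N m, u (N + 1) m =
      u N m + g N * 2 ^ (k N * m) * (nodePoly N).eval ((2 : ℝ) ^ m) := fun N m => rfl
  have husum : ∀ N m, u N m =
      ∑ M ∈ Finset.range N, g M * 2 ^ (k M * m) * (nodePoly M).eval ((2 : ℝ) ^ m) := by
    intro N m
    induction N with
    | zero => rfl
    | succ N ih => rw [hu, Finset.sum_range_succ, ih]
  have hval : ∀ m, u (m + 1) m = (-1) ^ m := fun m => by
    rw [hu, hδ]
    ring
  let a : ℕ × ℕ → ℝ := fun p => g p.1 * (nodePoly p.1).coeff p.2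
  let s : ℕ × ℕ → ℝ := fun p => -2 ^ (k p.1 + p.2)
  have hterm : ∀ w p, a p * s p ^ w = (-1) ^ w * (g p.1 * 2 ^ (k p.1 * w) *
      ((nodePoly p.1).coeff p.2 * (2 ^ w) ^ p.2)) := by
    intro w p
    simp only [a, s]
    rw [neg_pow, ← pow_mul, ← pow_mul, add_mul, pow_add, mul_comm w p.2]
    ring
  have hz : ∀ w N, ∀ i ∉ Finset.range (N + 1), a (N, i) * s (N, i) ^ w = 0 := by
    intro w N i hi
    rw [Finset.mem_range, not_lt] at hi
    have : (nodePoly N).coeff i = 0 :=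
      coeff_eq_zero_of_natDegree_lt ((nodePoly_natDegree_lt N).trans_le hi)
    simp [a, this]
  have hsumN : ∀ w N, ∑' i, |a (N, i) * s (N, i) ^ w| = |g N| * 2 ^ (k N * w) *
      ∑ i ∈ Finset.range (N + 1), |(nodePoly N).coeff i| * 2 ^ (i * w) := by
    intro w N
    rw [tsum_eq_sum (s := Finset.range (N + 1)) fun i hi => by rw [hz w N i hi, abs_zero],
      Finset.mul_sum]
    refine Finset.sum_congr rfl fun i _ => ?_
    rw [hterm, abs_mul, abs_mul, abs_mul, abs_mul, abs_pow, abs_neg, abs_one, one_pow, one_mul,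
      abs_of_pos (by positivity : (0 : ℝ) < 2 ^ (k N * w)),
      abs_of_pos (by positivity : (0 : ℝ) < (2 ^ w) ^ i), ← pow_mul, mul_comm w i]
  have hsummable : ∀ w, Summable fun p => |a p * s p ^ w| := by
    intro w
    rw [summable_prod_of_nonneg fun p => abs_nonneg _]
    refine ⟨fun N => summable_of_ne_finset_zero (s := Finset.range (N + 1)) fun i hi => by
      rw [hz w N i hi, abs_zero], ?_⟩
    -- After dropping the stages N ≤ w, the bound (1/2)^N from `exists_hump` applies to the w-th
    -- moment.
    rw [← summable_nat_add_iff (w + 1)]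
    refine Summable.of_nonneg_of_le (fun N => tsum_nonneg fun _ => abs_nonneg _) (fun N => ?_)
      ((summable_nat_add_iff (w + 1)).2 summable_geometric_two)
    rw [hsumN]
    exact hγ (N + (w + 1)) _ w (by omega)
  refine ⟨a, s, fun p => ?_, fun w => ⟨hsummable w, ?_⟩⟩
  · simp only [s]
    have : (1 : ℝ) ≤ 2 ^ (k p.1 + p.2) := one_le_pow₀ (by norm_num)
    linarith
  · rw [(summable_abs_iff.1 (hsummable w)).tsum_prod]
    have hin : ∀ N, ∑' i, a (N, i) * s (N, i) ^ w =
        (-1) ^ w * (g N * 2 ^ (k N * w) * (nodePoly N).eval ((2 : ℝ) ^ w)) := by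
      intro N
      rw [tsum_eq_sum (s := Finset.range (N + 1)) fun i hi => hz w N i hi,
        eval_eq_sum_range' (nodePoly_natDegree_lt N), Finset.mul_sum, Finset.mul_sum]
      exact Finset.sum_congr rfl fun i _ => hterm w (N, i)
    simp only [hin]
    rw [tsum_eq_sum (s := Finset.range (w + 1)) fun N hN => ?_, ← Finset.mul_sum, ← husum, hval,
      ← mul_pow]
    · simp
    · rw [Finset.mem_range, not_lt] at hN
      rw [nodePoly_eval_of_lt (by omega), mul_zero, mul_zero]

variable {E : Type*} [NormedAddCommGroup E] [NormedSpace ℝ E]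

/-- Convexity gives the mean value inequality, so the remainder of the k-th term is at most 2 u_k ‖y
- x‖. Dominated convergence for sums then handles the difference quotients, also at boundary points
of `K`. -/
theorem hasFDerivWithinAt_tsum_of_convex {V : Type*} [NormedAddCommGroup V] [NormedSpace ℝ V]
    [CompleteSpace V] {ι : Type*} {K : Set E} (hK : Convex ℝ K)
    {f : ι → E → V} {f' : ι → E → E →L[ℝ] V} {u : ι → ℝ} (hu : Summable u)
    (hf : ∀ k, ∀ x ∈ K, HasFDerivWithinAt (f k) (f' k x) K x)
    (hf' : ∀ k, ∀ x ∈ K, ‖f' k x‖ ≤ u k) (hs : ∀ x ∈ K, Summable fun k => f k x) {x : E}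
    (hx : x ∈ K) : HasFDerivWithinAt (fun y => ∑' k, f k y) (∑' k, f' k x) K x := by
  rw [hasFDerivWithinAt_iff_tendsto]
  have hsum' : Summable fun k => f' k x := Summable.of_norm_bounded hu fun k => hf' k x hx
  have hbd : ∀ k, ∀ y ∈ K, ‖f k y - f k x - f' k x (y - x)‖ ≤ 2 * u k * ‖y - x‖ := by
    intro k y hy
    have h1 : ‖f k y - f k x‖ ≤ u k * ‖y - x‖ :=
      hK.norm_image_sub_le_of_norm_hasFDerivWithin_le (hf k) (hf' k) hx hy
    have h2 : ‖f' k x (y - x)‖ ≤ u k * ‖y - x‖ :=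
      (f' k x).le_of_opNorm_le (hf' k x hx) _
    calc _ ≤ ‖f k y - f k x‖ + ‖f' k x (y - x)‖ := norm_sub_le _ _
      _ ≤ _ := by linarith
  have hbd' : ∀ k, ∀ y ∈ K, ‖y - x‖⁻¹ * ‖f k y - f k x - f' k x (y - x)‖ ≤ 2 * u k := by
    intro k y hy
    rcases eq_or_ne y x with rfl | h
    · simpa using (norm_nonneg _).trans (hf' k y hx)
    · have : 0 < ‖y - x‖ := norm_pos_iff.2 (sub_ne_zero.2 h)
      rw [inv_mul_le_iff₀ this]
      linarith [hbd k y hy]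
  have hlim : Filter.Tendsto (fun y => ∑' k, ‖y - x‖⁻¹ * ‖f k y - f k x - f' k x (y - x)‖)
      (𝓝[K] x) (𝓝 (∑' _ : ι, (0 : ℝ))) := by
    refine tendsto_tsum_of_dominated_convergence (hu.mul_left 2)
      (fun k => hasFDerivWithinAt_iff_tendsto.1 (hf k x hx)) ?_
    filter_upwards [self_mem_nhdsWithin] with y hy k
    rw [Real.norm_of_nonneg (by positivity)]
    exact hbd' k y hy
  rw [tsum_zero] at hlim
  refine squeeze_zero' (Filter.Eventually.of_forall fun y => by positivity) ?_ hlim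
  filter_upwards [self_mem_nhdsWithin] with y hy
  have hsn : Summable fun k => ‖f k y - f k x - f' k x (y - x)‖ :=
    Summable.of_nonneg_of_le (fun _ => norm_nonneg _) (fun k => hbd k y hy)
      ((hu.mul_left 2).mul_right _)
  rw [tsum_mul_left]
  have hev : (∑' k, f' k x) (y - x) = ∑' k, f' k x (y - x) :=
    (ContinuousLinearMap.apply ℝ V (y - x)).map_tsum hsum'
  have hsv : Summable fun k => f' k x (y - x) :=
    (ContinuousLinearMap.apply ℝ V (y - x)).summable hsum'
  rw [hev, ← (hs y hy).tsum_sub (hs x hx), ← ((hs y hy).sub (hs x hx)).tsum_sub hsv]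
  gcongr
  exact norm_tsum_le_tsum_norm hsn

/-- Smooth functions on `D` that vanish outside of the ball of radius `R`. -/
structure IsTestOn {V : Type*} [NormedAddCommGroup V] [NormedSpace ℝ V] (D : Set E) (R : ℝ)
    (f : E → V) : Prop where
  contDiffOn : ContDiffOn ℝ ∞ f D
  eq_zero : ∀ p ∈ D, R < ‖p‖ → f p = 0

theorem IsTestOn.exists_bound [ProperSpace E] {V : Type*} [NormedAddCommGroup V] [NormedSpace ℝ V]
    {D : Set E} {R : ℝ} {f : E → V} (h : IsTestOn D R f) (hD : IsClosed D) :
    ∃ M, 0 ≤ M ∧ ∀ p ∈ D, ‖f p‖ ≤ M := by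
  obtain ⟨M, hM⟩ := ((isCompact_closedBall (0 : E) R).inter_left hD).exists_bound_of_continuousOn
    (h.contDiffOn.continuousOn.mono Set.inter_subset_left)
  refine ⟨max M 0, le_max_right _ _, fun p hp => ?_⟩
  rcases le_or_gt ‖p‖ R with h' | h'
  · exact (hM p ⟨hp, mem_closedBall_zero_iff.2 h'⟩).trans (le_max_left _ _)
  · rw [h.eq_zero p hp h', norm_zero]
    exact le_max_right _ _

theorem IsTestOn.fderivWithin {V : Type*} [NormedAddCommGroup V] [NormedSpace ℝ V]
    {D : Set E} {R : ℝ} {f : E → V} (h : IsTestOn D R f) (hD : UniqueDiffOn ℝ D) :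
    IsTestOn D R (_root_.fderivWithin ℝ f D) where
  contDiffOn := h.contDiffOn.fderivWithin hD (by simp)
  eq_zero p hp hR := by
    have : f =ᶠ[𝓝[D] p] fun _ => 0 := by
      filter_upwards [self_mem_nhdsWithin,
        mem_nhdsWithin_of_mem_nhds ((isOpen_lt continuous_const continuous_norm).mem_nhds hR)]
        with q hq hq'
      exact h.eq_zero q hq hq'
    rw [this.fderivWithin_eq (h.eq_zero p hp hR)]
    simp

theorem IsTestOn.clm_comp {V W : Type*} [NormedAddCommGroup V] [NormedSpace ℝ V]
    [NormedAddCommGroup W] [NormedSpace ℝ W] {D : Set E} {R : ℝ} {f : E → V} (h : IsTestOn D R f)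
    (L : V →L[ℝ] W) : IsTestOn D R fun p => L (f p) where
  contDiffOn := L.contDiff.comp_contDiffOn h.contDiffOn
  eq_zero p hp hR := by rw [h.eq_zero p hp hR, map_zero]

variable {n : ℕ} (j : Fin n)

/-- The projection to the `j`-th coordinate axis. -/
def coordProj : (Fin n → ℝ) →L[ℝ] (Fin n → ℝ) :=
  (ContinuousLinearMap.single ℝ (fun _ => ℝ) j).comp (ContinuousLinearMap.proj j)

/-- Multiplication of the `j`-th coordinate by `s`. -/
def coordScale (s : ℝ) : (Fin n → ℝ) →L[ℝ] (Fin n → ℝ) :=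
  (ContinuousLinearMap.id ℝ _ - coordProj j) + s • coordProj j

theorem coordScale_apply_self (s : ℝ) (p : Fin n → ℝ) : coordScale j s p j = s * p j := by
  simp [coordScale, coordProj]

variable {j} in
theorem coordScale_apply_of_ne {i : Fin n} (h : i ≠ j) (s : ℝ) (p : Fin n → ℝ) :
    coordScale j s p i = p i := by
  simp [coordScale, coordProj, h]

theorem coordScale_eq_self {s : ℝ} {p : Fin n → ℝ} (h : p j = 0) : coordScale j s p = p := by
  funext i
  rcases eq_or_ne i j with rfl | hi
  · rw [coordScale_apply_self, h, mul_zero]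
  · exact coordScale_apply_of_ne hi s p

/-- Reflections with factor at most -1 move points outward in the sup norm, so the extension
vanishes outside the same ball as `f`. -/
theorem norm_le_norm_coordScale {s : ℝ} (hs : s ≤ -1) (p : Fin n → ℝ) :
    ‖p‖ ≤ ‖coordScale j s p‖ := by
  refine (pi_norm_le_iff_of_nonneg (norm_nonneg _)).2 fun i => ?_
  refine le_trans ?_ (norm_le_pi_norm _ i)
  rcases eq_or_ne i j with rfl | hi
  · rw [coordScale_apply_self, norm_mul]
    refine le_mul_of_one_le_left (norm_nonneg _) ?_
    rw [Real.norm_eq_abs, abs_of_neg (by linarith)]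
    linarith
  · rw [coordScale_apply_of_ne hi]

/-- The quadrant in `ℝⁿ` on which the coordinates in `S` are nonnegative. -/
def quadrant (S : Finset (Fin n)) : Set (Fin n → ℝ) := {p | ∀ i ∈ S, 0 ≤ p i}

theorem mem_quadrant {S : Finset (Fin n)} {p : Fin n → ℝ} : p ∈ quadrant S ↔ ∀ i ∈ S, 0 ≤ p i :=
  Iff.of_eq Set.mem_ofPred_eq

theorem isClosed_quadrant (S : Finset (Fin n)) : IsClosed (quadrant S) := by
  rw [quadrant, Set.ofPred_forall]
  refine isClosed_iInter fun i => ?_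
  rw [Set.ofPred_forall]
  exact isClosed_iInter fun _ => isClosed_le continuous_const (continuous_apply i)

theorem convex_quadrant (S : Finset (Fin n)) : Convex ℝ (quadrant S) := by
  intro x hx y hy a b ha hb _
  rw [mem_quadrant] at *
  intro i hi
  have := hx i hi
  have := hy i hi
  simp only [Pi.add_apply, Pi.smul_apply, smul_eq_mul]
  positivity

theorem uniqueDiffOn_quadrant (S : Finset (Fin n)) : UniqueDiffOn ℝ (quadrant S) := by
  refine uniqueDiffOn_convex (convex_quadrant S) ⟨fun _ => 1, ?_⟩
  have ho : IsOpen {x : Fin n → ℝ | ∀ i : Fin n, 0 < x i} := by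
    simp only [Set.ofPred_forall]
    exact isOpen_iInter_of_finite fun i => isOpen_lt continuous_const (continuous_apply i)
  refine mem_interior.2 ⟨_, fun x hx => ?_, ho, ?_⟩
  · rw [Set.mem_ofPred_eq] at hx
    exact mem_quadrant.2 fun i _ => (hx i).le
  · rw [Set.mem_ofPred_eq]
    simp

variable (a s : ℕ × ℕ → ℝ) {V : Type*} [NormedAddCommGroup V] [NormedSpace ℝ V]

/-- The extension of `f` by weighted reflections in the `j`-th coordinate. -/
def seeleySum (w : ℕ) (f : (Fin n → ℝ) → V) (p : Fin n → ℝ) : V :=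
  ∑' k, (a k * s k ^ w) • f (coordScale j (s k) p)

/-- Seeley's extension of `f` to negative values of the `j`-th coordinate. -/
def seeleyExt (w : ℕ) (f : (Fin n → ℝ) → V) (p : Fin n → ℝ) : V :=
  if 0 ≤ p j then f p else seeleySum j a s w f p

variable {a s} (hs : ∀ k, s k ≤ -1) (hsum : ∀ w : ℕ, Summable fun k => |a k * s k ^ w|)
  (hone : ∀ w : ℕ, ∑' k, a k * s k ^ w = 1)

include hs in
variable {j} in
theorem coordScale_mem_quadrant {S : Finset (Fin n)} {p : Fin n → ℝ}
    (hp : p ∈ quadrant (S.erase j)) (hpj : p j ≤ 0) (k : ℕ × ℕ) :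
    coordScale j (s k) p ∈ quadrant S := by
  refine mem_quadrant.2 fun i hi => ?_
  rcases eq_or_ne i j with rfl | hij
  · rw [coordScale_apply_self]
    nlinarith [hs k]
  · rw [coordScale_apply_of_ne hij]
    exact mem_quadrant.1 hp i (Finset.mem_erase.2 ⟨hij, hi⟩)

include hsum hone in
-- On the wall all reflected points coincide with p and the weights sum to 1. That this holds for
-- every `w` is what makes all derivatives match across the wall.
theorem seeleySum_eq_self (w : ℕ) (f : (Fin n → ℝ) → V) {p : Fin n → ℝ} (hp : p j = 0) :
    seeleySum j a s w f p = f p := by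
  simp only [seeleySum, coordScale_eq_self j hp]
  rw [(summable_abs_iff.1 (hsum w)).tsum_smul_const, hone, one_smul]

include hsum hone in
theorem seeleyExt_of_nonpos (w : ℕ) (f : (Fin n → ℝ) → V) {p : Fin n → ℝ} (hp : p j ≤ 0) :
    seeleyExt j a s w f p = seeleySum j a s w f p := by
  rw [seeleyExt]
  split_ifs with h
  · rw [seeleySum_eq_self j hsum hone w f (le_antisymm hp h)]
  · rfl

include hs hsum in
theorem summable_seeley [CompleteSpace V] {S : Finset (Fin n)} {R : ℝ} {f : (Fin n → ℝ) → V}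
    (h : IsTestOn (quadrant S) R f) (w : ℕ) {p : Fin n → ℝ} (hp : p ∈ quadrant (S.erase j))
    (hpj : p j ≤ 0) : Summable fun k => (a k * s k ^ w) • f (coordScale j (s k) p) := by
  obtain ⟨M, -, hM⟩ := h.exists_bound (isClosed_quadrant S)
  refine Summable.of_norm_bounded ((hsum w).mul_right M) fun k => ?_
  rw [norm_smul, Real.norm_eq_abs]
  gcongr
  exact hM _ (coordScale_mem_quadrant hs hp hpj k)

include hs hsum in
-- With P the projection to the j-th axis, the reflection is (id - P) + s P. Differentiating f
-- composed with it gives Df ∘ (id - P) with the old weights and Df ∘ P with an extra factor s, that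
-- is, with weight w + 1.
theorem hasFDerivWithinAt_seeleySum [CompleteSpace V] {S : Finset (Fin n)} {R : ℝ}
    {f : (Fin n → ℝ) → V} (h : IsTestOn (quadrant S) R f) (w : ℕ) {p : Fin n → ℝ}
    (hp : p ∈ quadrant (S.erase j)) (hpj : p j ≤ 0) :
    HasFDerivWithinAt (seeleySum j a s w f)
      (seeleySum j a s w (fun q => (fderivWithin ℝ f (quadrant S) q).comp
          (ContinuousLinearMap.id ℝ _ - coordProj j)) p +
        seeleySum j a s (w + 1) (fun q => (fderivWithin ℝ f (quadrant S) q).comp (coordProj j)) p)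
      {q | q ∈ quadrant (S.erase j) ∧ q j ≤ 0} p := by
  set K := {q : Fin n → ℝ | q ∈ quadrant (S.erase j) ∧ q j ≤ 0} with hK
  have hmem : ∀ q, q ∈ K ↔ q ∈ quadrant (S.erase j) ∧ q j ≤ 0 := fun q =>
    Iff.of_eq Set.mem_ofPred_eq
  have hKc : Convex ℝ K := (convex_quadrant _).inter
    (convex_halfSpace_le (f := fun q : Fin n → ℝ => q j) ⟨fun _ _ => rfl, fun _ _ => rfl⟩ 0)
  have hD := h.fderivWithin (uniqueDiffOn_quadrant S)
  obtain ⟨M, hM0, hM⟩ := hD.exists_bound (isClosed_quadrant S)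
  set Q := ContinuousLinearMap.id ℝ (Fin n → ℝ) - coordProj j with hQ
  have hsc : ∀ t, coordScale j t = Q + t • coordProj j := fun t => rfl
  have key := hasFDerivWithinAt_tsum_of_convex hKc
    (f := fun k q => (a k * s k ^ w) • f (coordScale j (s k) q))
    (f' := fun k q => (a k * s k ^ w) •
      (fderivWithin ℝ f (quadrant S) (coordScale j (s k) q)).comp (coordScale j (s k)))
    (u := fun k => |a k * s k ^ w| * (M * ‖Q‖) + |a k * s k ^ (w + 1)| * (M * ‖coordProj j‖))
    (((hsum w).mul_right _).add ((hsum (w + 1)).mul_right _)) (fun k q hq => ?_) (fun k q hq => ?_)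
    (fun q hq => summable_seeley j hs hsum h w ((hmem q).1 hq).1 ((hmem q).1 hq).2)
    ((hmem p).2 ⟨hp, hpj⟩)
  · refine key.congr_fderiv ?_
    have h1 := summable_seeley j hs hsum
      (hD.clm_comp (ContinuousLinearMap.precomp V Q)) w hp hpj
    have h2 := summable_seeley j hs hsum
      (hD.clm_comp (ContinuousLinearMap.precomp V (coordProj j))) (w + 1) hp hpj
    refine Eq.trans ?_ (h1.tsum_add h2)
    refine tsum_congr fun k => ?_
    rw [hsc, ContinuousLinearMap.comp_add, ContinuousLinearMap.comp_smul, smul_add, smul_smul,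
      mul_assoc, ← pow_succ]
    rfl
  · have hm := coordScale_mem_quadrant hs ((hmem q).1 hq).1 ((hmem q).1 hq).2 k
    refine HasFDerivWithinAt.const_smul ?_ _
    exact ((h.contDiffOn.differentiableOn (by simp)) _ hm).hasFDerivWithinAt.comp q
      (coordScale j (s k)).hasFDerivWithinAt fun q' hq' =>
        coordScale_mem_quadrant hs ((hmem q').1 hq').1 ((hmem q').1 hq').2 k
  · have hm := hM _ (coordScale_mem_quadrant hs ((hmem q).1 hq).1 ((hmem q).1 hq).2 k)
    rw [hsc, ContinuousLinearMap.comp_add, ContinuousLinearMap.comp_smul, smul_add, smul_smul,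
      mul_assoc, ← pow_succ]
    refine (norm_add_le _ _).trans (add_le_add ?_ ?_)
    · rw [norm_smul, Real.norm_eq_abs]
      gcongr
      exact (ContinuousLinearMap.opNorm_comp_le _ _).trans (by rw [← hsc]; gcongr)
    · rw [norm_smul, Real.norm_eq_abs]
      gcongr
      exact (ContinuousLinearMap.opNorm_comp_le _ _).trans (by rw [← hsc]; gcongr)

include hs hsum hone in
variable {j} in
-- The larger quadrant is the union of two closed pieces along the wall, and both one-sided
-- derivatives are given by the same expression. The derivative is again a sum of Seeley extensions,
-- so the argument can be iterated.
theorem hasFDerivWithinAt_seeleyExt [CompleteSpace V] {S : Finset (Fin n)} (hj : j ∈ S) {R : ℝ}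
    {f : (Fin n → ℝ) → V} (h : IsTestOn (quadrant S) R f) (w : ℕ) {p : Fin n → ℝ}
    (hp : p ∈ quadrant (S.erase j)) :
    HasFDerivWithinAt (seeleyExt j a s w f)
      (seeleyExt j a s w (fun q => (fderivWithin ℝ f (quadrant S) q).comp
          (ContinuousLinearMap.id ℝ _ - coordProj j)) p +
        seeleyExt j a s (w + 1) (fun q => (fderivWithin ℝ f (quadrant S) q).comp (coordProj j)) p)
      (quadrant (S.erase j)) p := by
  have hsplit : quadrant (S.erase j) =
      quadrant S ∪ {q | q ∈ quadrant (S.erase j) ∧ q j ≤ 0} := by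
    ext q
    rw [Set.mem_union, Set.mem_ofPred_eq, mem_quadrant, mem_quadrant]
    constructor
    · intro hq
      rcases le_total 0 (q j) with h0 | h0
      · refine Or.inl fun i hi => ?_
        rcases eq_or_ne i j with rfl | hij
        · exact h0
        · exact hq i (Finset.mem_erase.2 ⟨hij, hi⟩)
      · exact Or.inr ⟨hq, h0⟩
    · rintro (hq | hq)
      · exact fun i hi => hq i (Finset.mem_of_mem_erase hi)
      · exact hq.1
  rw [hsplit]
  refine HasFDerivWithinAt.union ?_ ?_
  · by_cases hpS : p ∈ quadrant S
    · rw [seeleyExt, if_pos (mem_quadrant.1 hpS j hj), seeleyExt,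
        if_pos (mem_quadrant.1 hpS j hj), ← ContinuousLinearMap.comp_add, sub_add_cancel,
        ContinuousLinearMap.comp_id]
      exact ((h.contDiffOn.differentiableOn (by simp)) _ hpS).hasFDerivWithinAt.congr
        (fun q hq => if_pos (mem_quadrant.1 hq j hj)) (if_pos (mem_quadrant.1 hpS j hj))
    -- A point outside a closed piece imposes no condition on the derivative within it.
    · exact .of_notMem_closure (by rwa [(isClosed_quadrant S).closure_eq])
  · rcases le_or_gt (p j) 0 with hpj | hpj
    · rw [seeleyExt_of_nonpos j hsum hone _ _ hpj, seeleyExt_of_nonpos j hsum hone _ _ hpj]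
      refine (hasFDerivWithinAt_seeleySum j hs hsum h w hp hpj).congr (fun q hq => ?_)
        (seeleyExt_of_nonpos j hsum hone _ _ hpj)
      rw [Set.mem_ofPred_eq] at hq
      exact seeleyExt_of_nonpos j hsum hone _ _ hq.2
    · refine .of_notMem_closure fun hc => ?_
      have : closure {q | q ∈ quadrant (S.erase j) ∧ q j ≤ 0} ⊆ {q | q j ≤ 0} :=
        closure_minimal (fun q hq => by rw [Set.mem_ofPred_eq] at *; exact hq.2)
          (isClosed_le (continuous_apply j) continuous_const)
      have := this hc
      rw [Set.mem_ofPred_eq] at this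
      linarith

include hs hsum hone in
variable {j} in
-- Induction on the order of differentiability. It must range over all value spaces, test functions
-- and weights, because the derivative is made of extensions of other functions with values in E →L
-- V and with w + 1.
theorem contDiffOn_seeleyExt {S : Finset (Fin n)} (hj : j ∈ S) (m : ℕ) :
    ∀ {V : Type} [NormedAddCommGroup V] [NormedSpace ℝ V] [CompleteSpace V] {R : ℝ}
      {f : (Fin n → ℝ) → V} (_ : IsTestOn (quadrant S) R f) (w : ℕ),
      ContDiffOn ℝ m (seeleyExt j a s w f) (quadrant (S.erase j)) := by
  induction m with
  | zero =>
    intro V _ _ _ R f h w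
    rw [Nat.cast_zero, contDiffOn_zero]
    exact fun p hp => (hasFDerivWithinAt_seeleyExt hs hsum hone hj h w hp).continuousWithinAt
  | succ m ih =>
    intro V _ _ _ R f h w
    have hd := fun p hp => hasFDerivWithinAt_seeleyExt hs hsum hone hj h w (p := p) hp
    rw [Nat.cast_add, Nat.cast_one]
    refine contDiffOn_succ_of_fderivWithin (fun p hp => (hd p hp).differentiableWithinAt)
      (by simp) ?_
    have hD := h.fderivWithin (uniqueDiffOn_quadrant S)
    have h1 : IsTestOn (quadrant S) R fun q => (fderivWithin ℝ f (quadrant S) q).comp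
        (ContinuousLinearMap.id ℝ _ - coordProj j) :=
      hD.clm_comp (ContinuousLinearMap.precomp V (ContinuousLinearMap.id ℝ _ - coordProj j))
    have h2 : IsTestOn (quadrant S) R fun q => (fderivWithin ℝ f (quadrant S) q).comp
        (coordProj j) := hD.clm_comp (ContinuousLinearMap.precomp V (coordProj j))
    exact ((ih h1 w).add (ih h2 (w + 1))).congr
      fun p hp => (hd p hp).fderivWithin (uniqueDiffOn_quadrant _ p hp)

/-- One wall is removed at a time: the Seeley extension across the wall xⱼ = 0 is a test function on
the quadrant without that condition, and without conditions the quadrant is ℝⁿ. -/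
theorem IsTestOn.exists_contDiff_extension (S : Finset (Fin n)) : ∀ {R : ℝ}
    {f : (Fin n → ℝ) → ℝ} (_ : IsTestOn (quadrant S) R f),
    ∃ F : SmoothFn n, ∀ p ∈ quadrant S, F.1 p = f p := by
  obtain ⟨a, s, hs, H⟩ := exists_seeley_coefficients
  induction S using Finset.strongInduction with
  | H S ih =>
    intro R f h
    rcases S.eq_empty_or_nonempty with rfl | ⟨j, hj⟩
    · refine ⟨⟨f, SmoothFn.mem_iff.2 (contDiffOn_univ.1 (h.contDiffOn.mono fun p _ =>
        mem_quadrant.2 (by simp)))⟩, fun _ _ => rfl⟩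
    · have hsum := fun w => (H w).1
      have hone := fun w => (H w).2
      have ht : IsTestOn (quadrant (S.erase j)) R (seeleyExt j a s 0 f) := by
        refine ⟨contDiffOn_infty.2 fun m => contDiffOn_seeleyExt hs hsum hone hj m h 0,
          fun p hp hR => ?_⟩
        rcases le_total (p j) 0 with hpj | hpj
        · rw [seeleyExt_of_nonpos j hsum hone _ _ hpj, seeleySum]
          refine (tsum_congr fun k => ?_).trans tsum_zero
          rw [h.eq_zero _ (coordScale_mem_quadrant hs hp hpj k)
            (hR.trans_le (norm_le_norm_coordScale j (hs k) p)), smul_zero]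
        · rw [seeleyExt, if_pos hpj]
          refine h.eq_zero p (mem_quadrant.2 fun i hi => ?_) hR
          rcases eq_or_ne i j with rfl | hij
          · exact hpj
          · exact mem_quadrant.1 hp i (Finset.mem_erase.2 ⟨hij, hi⟩)
      obtain ⟨F, hF⟩ := ih _ (Finset.erase_ssubset hj) ht
      refine ⟨F, fun p hp => ?_⟩
      rw [hF p (mem_quadrant.2 fun i hi => mem_quadrant.1 hp i (Finset.mem_of_mem_erase hi)),
        seeleyExt, if_pos (mem_quadrant.1 hp j hj)]

end Seeley

/-! ### The spectrum of the ring of smooth functions on a manifold -/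

section ManifoldPoints

variable {E : Type} [NormedAddCommGroup E] [NormedSpace ℝ E] {H : Type}
  [TopologicalSpace H] {I : ModelWithCorners ℝ E H} {X : Type u} [TopologicalSpace X]
  [ChartedSpace H X]

/-- The extension by zero of a function on an open set. -/
def extendFn {U : Opens X} (g : manFn I U) : X → ℝ := Function.extend Subtype.val g.1 0

theorem extendFn_apply {U : Opens X} (g : manFn I U) {x : X} (hx : x ∈ U) :
    extendFn g x = g.1 ⟨x, hx⟩ := Subtype.val_injective.extend_apply g.1 0 ⟨x, hx⟩

theorem contMDiffAt_extendFn {U : Opens X} (g : manFn I U) {x : X} (hx : x ∈ U) :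
    ContMDiffAt I 𝓘(ℝ, ℝ) ∞ (extendFn g) x := by
  refine (contMDiffAt_subtype_iff (U := U) (x := ⟨x, hx⟩)).1 ?_
  exact (mem_manFn.1 g.2 ⟨x, hx⟩).congr_of_eventuallyEq
    (Filter.Eventually.of_forall fun y => extendFn_apply g y.2)

theorem manEval_apply (p : X) (f : manFn I X) : manEval I X p f = f.1 p := rfl

/-- A nowhere vanishing smooth function is a unit, and a morphism to ℝ cannot kill a unit. -/
theorem RPoint.apply_ne_zero_of_forall {x : RPoint (manFn I X)} {g : manFn I X}
    (hg : ∀ p, g.1 p ≠ 0) : x g ≠ 0 := by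
  intro h0
  let g' : manFn I X := ⟨fun p => (g.1 p)⁻¹, mem_manFn.2 fun p =>
    ((contDiffAt_inv ℝ (hg p)).contMDiffAt).comp p (mem_manFn.1 g.2 p)⟩
  have h1 : g * g' = 1 := Subtype.ext (funext fun p => mul_inv_cancel₀ (hg p))
  have h2 := congrArg x h1
  rw [map_mul, map_one, h0, zero_mul] at h2
  exact zero_ne_one h2

variable [FiniteDimensional ℝ E] [IsManifold I ∞ X] [T2Space X]

theorem exists_manFn_bump {p : X} {U : Set X} (hU : U ∈ 𝓝 p) :
    ∃ f : manFn I X, f.1 =ᶠ[𝓝 p] 1 ∧ tsupport f.1 ⊆ U := by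
  obtain ⟨f, -, hf⟩ := (SmoothBumpFunction.nhds_basis_tsupport (I := I) p).mem_iff.1 hU
  exact ⟨⟨f, mem_manFn.2 f.contMDiff⟩, f.eventuallyEq_one, hf⟩

/-- A function that is smooth near a point has the germ of a smooth function. -/
theorem exists_manFn_germ {p : X} {U : Set X} (hU : IsOpen U) (hp : p ∈ U) {g : X → ℝ}
    (hg : ∀ q ∈ U, ContMDiffAt I 𝓘(ℝ, ℝ) ∞ g q) : ∃ f : manFn I X, f.1 =ᶠ[𝓝 p] g := by
  obtain ⟨b, hb, hbU⟩ := exists_manFn_bump (I := I) (hU.mem_nhds hp)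
  refine ⟨⟨fun q => b.1 q * g q, mem_manFn.2 (contMDiff_of_tsupport fun q hq => ?_)⟩, ?_⟩
  · exact (mem_manFn.1 b.2 q).mul (hg q (hbU (closure_mono (Function.support_mul_subset_left _ _) hq)))
  · filter_upwards [hb] with q hq
    rw [hq, Pi.one_apply, one_mul]

theorem exists_manFn_extendFn {U : Opens X} (g : manFn I U) {x : X} (hx : x ∈ U) :
    ∃ f : manFn I X, f.1 =ᶠ[𝓝 x] extendFn g :=
  exists_manFn_germ U.isOpen hx fun _ hq => contMDiffAt_extendFn g hq

/-- The localization at p is a ring of germs: a function nonzero at p is nonzero nearby, and bump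
functions give the annihilators in the other direction. -/
theorem toLoc_manEval_eq_iff {p : X} {f g : manFn I X} :
    toLoc (manEval I X p) f = toLoc (manEval I X p) g ↔ f.1 =ᶠ[𝓝 p] g.1 := by
  rw [toLoc_eq_iff, mem_germIdeal]
  constructor
  · rintro ⟨d, hd, h⟩
    have hc : Continuous d.1 := (mem_manFn.1 d.2).continuous
    filter_upwards [hc.continuousAt.eventually_ne hd] with q hq
    have := congrFun (congrArg Subtype.val h) q
    exact sub_eq_zero.1 ((mul_eq_zero.1 this).resolve_right hq)
  · intro h
    obtain ⟨V, hV, hVo, hpV⟩ := mem_nhds_iff.1 h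
    obtain ⟨b, hb, hbV⟩ := exists_manFn_bump (I := I) (hVo.mem_nhds hpV)
    refine ⟨b, ?_, Subtype.ext (funext fun q => ?_)⟩
    · rw [manEval_apply, hb.self_of_nhds]
      exact one_ne_zero
    · change (f.1 q - g.1 q) * b.1 q = 0
      by_cases hq : q ∈ V
      · rw [show f.1 q = g.1 q from hV hq, sub_self, zero_mul]
      · rw [image_eq_zero_of_notMem_tsupport fun h => hq (hbV h), mul_zero]

/-- The condition h ≥ m off the m-th compact set is convex in the value of h, and locally it is met
by constants. A partition of unity yields a smooth h, and each sublevel set lies in one of the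
compact sets. -/
theorem exists_smooth_exhaustion [SigmaCompactSpace X] :
    ∃ h : manFn I X, ∀ a : ℝ, IsCompact {p | h.1 p ≤ a} := by
  have : LocallyCompactSpace X := Manifold.locallyCompact_of_finiteDimensional I
  let K : CompactExhaustion X := default
  obtain ⟨h, hh⟩ := exists_contMDiffMap_forall_mem_convex_of_local_const (n := ⊤) I
    (t := fun p : X => {y : ℝ | ∀ m : ℕ, p ∉ K m → (m : ℝ) ≤ y})
    (fun p y hy z hz a b ha hb hab => by
      rw [Set.mem_ofPred_eq] at *
      intro m hm
      have h1 := hy m hm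
      have h2 := hz m hm
      calc (m : ℝ) = a * m + b * m := by rw [← add_mul, hab, one_mul]
        _ ≤ a • y + b • z := by simp only [smul_eq_mul]; gcongr)
    (fun p => by
      -- Near p all points lie in the compact set of index `K.find p + 1`, so a point there can only
      -- be outside sets of smaller index.
      refine ⟨(K.find p + 1 : ℕ), ?_⟩
      have h1 : interior (K (K.find p + 1)) ∈ 𝓝 p :=
        isOpen_interior.mem_nhds (K.subset_interior_succ _ (K.mem_find p))
      filter_upwards [h1] with q hq
      intro m hm
      have : ¬ K.find p + 1 ≤ m := fun hle => hm (K.subset hle (interior_subset hq))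
      exact_mod_cast (by omega : m ≤ K.find p + 1))
  refine ⟨⟨h, mem_manFn.2 h.contMDiff⟩, fun a => ?_⟩
  obtain ⟨m, hm⟩ := exists_nat_gt a
  refine (K.isCompact m).of_isClosed_subset
    (isClosed_le h.contMDiff.continuous continuous_const) fun p hp => ?_
  rw [Set.mem_ofPred_eq] at hp
  by_contra hpm
  have := hh p
  rw [Set.mem_ofPred_eq] at this
  have h2 : (m : ℝ) ≤ h p := this m hpm
  exact absurd (h2.trans hp) (not_le.2 hm)

/-- If x is no evaluation, each p has some f_p with f_p(p) ≠ x(f_p). Take a proper h; finitely many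
f_p suffice on the compact set h ≤ x(h). Then (h - x(h))² + ∑ (f_p - x(f_p))² has no zeros, yet x
sends it to 0. -/
theorem manEval_surjective [SigmaCompactSpace X] : Function.Surjective (manEval I X) := by
  intro x
  by_contra! hx
  have hne : ∀ p, ∃ f : manFn I X, f.1 p ≠ x f := fun p => by
    by_contra! h
    exact hx p (CInfHom.ext h)
  choose f hf using hne
  obtain ⟨h, hh⟩ := exists_smooth_exhaustion (I := I) (X := X)
  have hcont : ∀ f : manFn I X, Continuous f.1 := fun f => (mem_manFn.1 f.2).continuous
  obtain ⟨t, -, ht⟩ := (hh (x h)).elim_nhds_subcover (fun p => {q | (f p).1 q ≠ x (f p)})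
    fun p _ => (hcont (f p)).continuousAt.eventually_ne (hf p)
  let cst : ℝ → manFn I X := fun r => algebraMap ℝ _ r
  have hcst : ∀ r, x (cst r) = r := fun r => x.commutes r
  let sq : manFn I X → manFn I X := fun f => (f - cst (x f)) * (f - cst (x f))
  have hsq : ∀ f, x (sq f) = 0 := fun f => by rw [map_mul, map_sub, hcst, sub_self, zero_mul]
  have hsqv : ∀ (f : manFn I X) q, (sq f).1 q = (f.1 q - x f) * (f.1 q - x f) := fun f q => rfl
  have key := RPoint.apply_ne_zero_of_forall (x := x) (g := sq h + ∑ p ∈ t, sq (f p)) fun q => by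
    have hval : (sq h + ∑ p ∈ t, sq (f p)).1 q = (sq h).1 q + ∑ p ∈ t, (sq (f p)).1 q := by
      change (sq h).1 q + (∑ p ∈ t, sq (f p)).1 q = _
      rw [AddSubmonoidClass.coe_finsetSum, Finset.sum_apply]
    rw [hval]
    have hn : ∀ g : manFn I X, 0 ≤ (sq g).1 q := fun g => mul_self_nonneg _
    have hns : 0 ≤ ∑ p ∈ t, (sq (f p)).1 q := Finset.sum_nonneg fun p _ => hn _
    refine ne_of_gt ?_
    by_cases hq : h.1 q ≤ x h
    · obtain ⟨p, hp, hpq⟩ := Set.mem_iUnion₂.1 (ht hq)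
      rw [Set.mem_ofPred_eq] at hpq
      have h1 : 0 < (sq (f p)).1 q := by
        rw [hsqv]
        exact mul_self_pos.2 (sub_ne_zero.2 hpq)
      have h2 := Finset.single_le_sum (f := fun p => (sq (f p)).1 q) (fun p _ => hn (f p)) hp
      linarith [hn h]
    · have h1 : 0 < (sq h).1 q := by
        rw [hsqv]
        exact mul_self_pos.2 (sub_ne_zero.2 (not_le.1 hq).ne')
      linarith
  refine key ?_
  rw [map_add, map_sum, hsq, zero_add]
  exact Finset.sum_eq_zero fun p _ => hsq _

theorem manEval_isInducing : Topology.IsInducing (manEval I X) := by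
  refine Topology.isInducing_iff_nhds.2 fun p => le_antisymm ?_ ?_
  · refine Filter.map_le_iff_le_comap.1 ?_
    refine Continuous.continuousAt (f := manEval I X) (continuous_induced_rng.2 ?_)
    exact continuous_pi fun f => (mem_manFn.1 f.2).continuous
  · intro U hU
    obtain ⟨b, hb, hbU⟩ := exists_manFn_bump (I := I) hU
    refine Filter.mem_comap.2 ⟨{x | x b ≠ 0},
      (RPoint.continuous_eval b).continuousAt.eventually_ne ?_, fun q hq => ?_⟩
    · rw [manEval_apply, hb.self_of_nhds]
      exact one_ne_zero
    · by_contra hqU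
      exact hq (image_eq_zero_of_notMem_tsupport (f := b.1) fun h => hqU (hbU h))

theorem manEval_injective : Function.Injective (manEval I X) := manEval_isInducing.injective

variable (I X)

/-- The points of a manifold are the `ℝ`-points of its ring of smooth functions. -/
def manHomeo [SigmaCompactSpace X] : X ≃ₜ RPoint (manFn I X) :=
  (Equiv.ofBijective (manEval I X)
    ⟨manEval_injective, manEval_surjective⟩).toHomeomorphOfIsInducing manEval_isInducing

end ManifoldPoints

section LocValue

variable {C : Type u} [CInfRing C]

/-- The value at `x` of an element of the localization at `x`. -/
def Loc.value (x : RPoint C) : CInfHom (Loc x) ℝ := (Loc.existsUnique_lift x x fun _ h => by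
  exact isUnit_iff_ne_zero.2 h).choose

theorem Loc.value_toLoc (x : RPoint C) (c : C) : Loc.value x (toLoc x c) = x c :=
  (Loc.existsUnique_lift x x fun _ h => by exact isUnit_iff_ne_zero.2 h).choose_spec.1 c

end LocValue

/-! ### Sections of the spectrum of C^∞(X) as smooth functions on open subsets of X -/

section ManifoldSections

variable {E : Type} [NormedAddCommGroup E] [NormedSpace ℝ E] [FiniteDimensional ℝ E] {H : Type}
  [TopologicalSpace H] {I : ModelWithCorners ℝ E H} {X : Type u} [TopologicalSpace X]
  [ChartedSpace H X] [IsManifold I ∞ X] [T2Space X] [SigmaCompactSpace X]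

omit [SigmaCompactSpace X] in
theorem exists_toSections_manFn {V : Opens (RPoint (manFn I X))}
    (s : specSections (manFn I X) V) {p : X} (hp : manEval I X p ∈ V) :
    ∃ c : manFn I X, ∀ᶠ q in 𝓝 p, ∃ hq : manEval I X q ∈ V,
      s.1 ⟨manEval I X q, hq⟩ = toLoc (manEval I X q) c := by
  obtain ⟨c, hc⟩ := isSection_iff.1 (mem_specSections.1 s.2) ⟨_, hp⟩
  rw [Topology.IsInducing.subtypeVal.nhds_eq_comap, Filter.eventually_comap] at hc
  have hcont : ContinuousAt (manEval I X) p := manEval_isInducing.continuous.continuousAt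
  refine ⟨c, ?_⟩
  filter_upwards [hcont.eventually hc, hcont.eventually (V.isOpen.mem_nhds hp)] with q hq hqV
  exact ⟨hqV, hq ⟨_, hqV⟩ rfl⟩

/-- The smooth function given by the values of a section. -/
def sectionValue (V : Opens (RPoint (manFn I X))) :
    CInfHom (specSections (manFn I X) V) (manFn I (preimageOpens (manHomeo I X) V)) where
  toFun s := ⟨fun p => Loc.value (manEval I X p.1) (s.1 ⟨manEval I X p.1, p.2⟩),
    mem_manFn.2 fun p => by
      obtain ⟨c, hc⟩ := exists_toSections_manFn s p.2
      refine ((contMDiffAt_subtype_iff (U := preimageOpens (manHomeo I X) V)).2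
        (mem_manFn.1 c.2 p.1)).congr_of_eventuallyEq ?_
      filter_upwards [continuous_subtype_val.continuousAt.eventually hc] with q ⟨hq, h⟩
      rw [h, Loc.value_toLoc]
      rfl⟩
  map_one' := Subtype.ext (funext fun p => map_one (Loc.value (manEval I X p.1)).toAlgHom)
  map_mul' _ _ := Subtype.ext (funext fun p => map_mul (Loc.value (manEval I X p.1)).toAlgHom _ _)
  map_zero' := Subtype.ext (funext fun p => map_zero (Loc.value (manEval I X p.1)).toAlgHom)
  map_add' _ _ := Subtype.ext (funext fun p => map_add (Loc.value (manEval I X p.1)).toAlgHom _ _)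
  commutes' r := Subtype.ext (funext fun p => (Loc.value (manEval I X p.1)).commutes r)
  map_op' f c := Subtype.ext (funext fun p => (Loc.value (manEval I X p.1)).map_op f _)

theorem sectionValue_apply {V : Opens (RPoint (manFn I X))} (s : specSections (manFn I X) V)
    (p : X) (hp : manEval I X p ∈ V) : (sectionValue V s).1 ⟨p, hp⟩ =
      Loc.value (manEval I X p) (s.1 ⟨manEval I X p, hp⟩) := rfl

theorem sectionValue_toSections {V : Opens (RPoint (manFn I X))} (c : manFn I X) :
    sectionValue V (toSections _ V c) =
      manFn.restrict I c (preimageOpens (manHomeo I X) V) :=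
  Subtype.ext (funext fun p => Loc.value_toLoc (manEval I X p.1) c)

/-- Values on a neighbourhood determine a germ, hence an element of the localization. Conversely a
smooth function on an open set has at each point the germ of a global one, and these germs form a
section. -/
theorem sectionValue_bijective (V : Opens (RPoint (manFn I X))) :
    Function.Bijective (sectionValue (I := I) (X := X) V) := by
  constructor
  · intro s s' h
    refine Subtype.ext (funext fun ⟨x, hx⟩ => ?_)
    obtain ⟨p, rfl⟩ := manEval_surjective x
    obtain ⟨c, hc⟩ := exists_toSections_manFn s hx
    obtain ⟨c', hc'⟩ := exists_toSections_manFn s' hx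
    obtain ⟨_, h1⟩ := hc.self_of_nhds
    obtain ⟨_, h2⟩ := hc'.self_of_nhds
    rw [h1, h2, toLoc_manEval_eq_iff]
    filter_upwards [hc, hc'] with q ⟨hq, e1⟩ ⟨_, e2⟩
    have := congrFun (congrArg Subtype.val h) ⟨q, hq⟩
    rwa [sectionValue_apply, sectionValue_apply, e1, e2, Loc.value_toLoc, Loc.value_toLoc] at this
  · intro g
    choose c hc using fun p : preimageOpens (manHomeo I X) V => exists_manFn_extendFn g p.2
    have hsurj : ∀ x : V, ∃ p : preimageOpens (manHomeo I X) V, manEval I X p.1 = x.1 := fun x => by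
      obtain ⟨p, hp⟩ := manEval_surjective x.1
      exact ⟨⟨p, by change manEval I X p ∈ V; rw [hp]; exact x.2⟩, hp⟩
    choose p hp using hsurj
    have key : ∀ (x : V) (q : X) (hq : manEval I X q = x.1), ∀ f : manFn I X,
        f.1 =ᶠ[𝓝 q] extendFn g → toLoc x.1 (c (p x)) = toLoc x.1 f := by
      rintro ⟨_, hx⟩ q rfl f hf
      obtain hpq : (p ⟨_, hx⟩).1 = q := manEval_injective (hp ⟨_, hx⟩)
      rw [toLoc_manEval_eq_iff]
      have := hc (p ⟨_, hx⟩)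
      rw [hpq] at this
      exact this.trans hf.symm
    refine ⟨⟨fun x => toLoc x.1 (c (p x)), mem_specSections.2 <| isSection_iff.2 fun x =>
      ⟨c (p x), ?_⟩⟩, Subtype.ext (funext fun q => ?_)⟩
    · have h1 : ∀ᶠ q in 𝓝 (p x).1, (c (p x)).1 =ᶠ[𝓝 q] extendFn g :=
        (hc (p x)).eventually_nhds
      have h2 : (manHomeo I X).symm x.1 = (p x).1 := by
        rw [Homeomorph.symm_apply_eq]
        exact (hp x).symm
      have h3 := ((manHomeo I X).symm.continuous.comp continuous_subtype_val).continuousAt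
        (x := x)
      have h4 := h3.eventually (p := fun q => (c (p x)).1 =ᶠ[𝓝 q] extendFn g) (by
        rw [Function.comp_apply, h2]
        exact h1)
      filter_upwards [h4] with y hy
      exact key y _ ((manHomeo I X).apply_symm_apply y.1) _ hy
    · rw [sectionValue_apply (hp := q.2)]
      have := key ⟨manEval I X q.1, q.2⟩ q.1 rfl (c q) (hc q)
      refine (congrArg _ this).trans ?_
      rw [Loc.value_toLoc, manEval_apply, (hc q).self_of_nhds, extendFn_apply g q.2]

/-- The identification of the sections of the spectrum with smooth functions. -/
def sectionValueEquiv (V : Opens (RPoint (manFn I X))) :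
    CInfEquiv (specSections (manFn I X) V) (manFn I (preimageOpens (manHomeo I X) V)) where
  toAlgEquiv := AlgEquiv.ofBijective (sectionValue V).toAlgHom (sectionValue_bijective V)
  map_op' f c := (sectionValue V).map_op f c

variable (I X)

/-- A manifold is isomorphic to the spectrum of its ring of smooth functions. -/
def manIso : CSpace.Iso (manSpace I X) (manSpec I X) where
  base := manHomeo I X
  sec V := sectionValueEquiv (I := I) (X := X) V
  sec_res _ _ := rfl

theorem manIso_base (p : X) : (manIso I X).base p = manEval I X p := rfl

theorem manIso_sec_fn (V : Opens (manSpec I X).carrier) (f : manFn I X) :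
    (manIso I X).sec V (Spec.fn V f) =
      manFn.restrict I f (preimageOpens (manIso I X).base V) := sectionValue_toSections f

end ManifoldSections

/-! ### Cotangent vectors in charts, and local coordinates -/

section Cotangent

variable {E : Type} [NormedAddCommGroup E] [NormedSpace ℝ E] {H : Type}
  [TopologicalSpace H] {I : ModelWithCorners ℝ E H} {X : Type u} [TopologicalSpace X]
  [ChartedSpace H X]

variable (I) in
/-- The differential at `x` of a function on a manifold, as a cotangent vector. -/
def cotDiff (f : X → ℝ) (x : X) : E →L[ℝ] ℝ := mfderiv I 𝓘(ℝ, ℝ) f x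

theorem cotDiff_congr {f g : X → ℝ} {x : X} (h : f =ᶠ[𝓝 x] g) : cotDiff I f x = cotDiff I g x :=
  h.mfderiv_eq

/-- Definitional, because charts on ℝ are trivial. It reduces differentials on the manifold to
derivatives within the range of the model, so that boundary points need no special treatment. -/
theorem hasMFDerivAt_iff_hasFDerivWithinAt {f : X → ℝ} {x : X} {L : E →L[ℝ] ℝ} :
    HasMFDerivAt I 𝓘(ℝ, ℝ) f x L ↔ ContinuousAt f x ∧
      HasFDerivWithinAt (fun p => f ((extChartAt I x).symm p)) L (Set.range I)
        (extChartAt I x x) := Iff.rfl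

theorem cotDiff_comp {m : ℕ} (F : SmoothFn m) {g : Fin m → X → ℝ} {x : X}
    (hg : ∀ k, MDifferentiableAt I 𝓘(ℝ, ℝ) (g k) x) :
    cotDiff I (fun q => F.1 fun k => g k q) x =
      ∑ k, (F.pderiv k).1 (fun k => g k x) • cotDiff I (g k) x := by
  have h := fun k => hasMFDerivAt_iff_hasFDerivWithinAt.1 (hg k).hasMFDerivAt
  have hp : HasFDerivWithinAt (fun p k => g k ((extChartAt I x).symm p))
      (ContinuousLinearMap.pi fun k => cotDiff I (g k) x) (Set.range I) (extChartAt I x x) :=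
    hasFDerivWithinAt_pi.2 fun k => (h k).2
  have hx : (fun k => g k ((extChartAt I x).symm (extChartAt I x x))) = fun k => g k x := by
    rw [extChartAt_to_inv]
  have hF : HasFDerivAt F.1 (fderiv ℝ F.1 fun k => g k x)
      (fun k => g k ((extChartAt I x).symm (extChartAt I x x))) := by
    rw [hx]
    exact (F.differentiableAt _).hasFDerivAt
  let L : E →L[ℝ] ℝ :=
    (fderiv ℝ F.1 fun k => g k x).comp (ContinuousLinearMap.pi fun k => cotDiff I (g k) x)
  have hm : HasMFDerivAt I 𝓘(ℝ, ℝ) (fun q => F.1 fun k => g k q) x L :=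
    hasMFDerivAt_iff_hasFDerivWithinAt.2 ⟨F.smooth.continuous.continuousAt.comp
      (continuousAt_pi.2 fun k => (h k).1), hF.comp_hasFDerivWithinAt _ hp⟩
  have hL : cotDiff I (fun q => F.1 fun k => g k q) x = L := hm.mfderiv
  rw [hL]
  ext v
  rw [ContinuousLinearMap.comp_apply, SmoothFn.fderiv_eq_sum, sum_apply]
  exact Finset.sum_congr rfl fun k _ => rfl

variable [IsManifold I ∞ X]

/-- An element of the dual of the model space as a cotangent vector at `x`. -/
def toCotFibre (x : X) (L : E →L[ℝ] ℝ) : CotFibre I X x := L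

/-- A cotangent vector as an element of the dual of the model space. -/
def ofCotFibre {x : X} (L : CotFibre I X x) : E →L[ℝ] ℝ := L

/-- The inverse of the differential at `x` of the chart at `x₀`. -/
def chartFrame (I : ModelWithCorners ℝ E H) (x₀ x : X) : E →L[ℝ] E :=
  mfderivWithin 𝓘(ℝ, E) I (extChartAt I x₀).symm (Set.range I) (extChartAt I x₀ x)

/-- The differential at `x` of the chart at `x₀`. -/
def chartDiff (I : ModelWithCorners ℝ E H) (x₀ x : X) : E →L[ℝ] E :=
  mfderiv I 𝓘(ℝ, E) (extChartAt I x₀) x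

instance : IsManifold I 1 X := .of_le (n := ∞) (by simp)

theorem chartDiff_comp_chartFrame {x₀ x : X} (hx : x ∈ (chartAt H x₀).source) :
    (chartDiff I x₀ x).comp (chartFrame I x₀ x) = ContinuousLinearMap.id ℝ E :=
  mfderiv_extChartAt_comp_mfderivWithin_extChartAt_symm' (I := I) (by rwa [extChartAt_source])

theorem chartFrame_comp_chartDiff {x₀ x : X} (hx : x ∈ (chartAt H x₀).source) :
    (chartFrame I x₀ x).comp (chartDiff I x₀ x) = ContinuousLinearMap.id ℝ E :=
  mfderivWithin_extChartAt_symm_comp_mfderiv_extChartAt' (I := I) (by rwa [extChartAt_source])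

/-- The trivialization of the cotangent bundle is composition with the coordinate frame of the
chart. -/
theorem cotTrivialization_apply {x₀ x : X} (hx : x ∈ (chartAt H x₀).source) (L : E →L[ℝ] ℝ) :
    (trivializationAt (E →L[ℝ] ℝ) (CotFibre I X) x₀ ⟨x, L⟩).2 =
      L.comp (chartFrame I x₀ x) := by
  rw [hom_trivializationAt_apply]
  have h1 := TangentBundle.symmL_trivializationAt (I := I) hx
  change ((trivializationAt ℝ (Bundle.Trivial X ℝ) x₀).continuousLinearMapAt ℝ x).comp
    (L.comp ((trivializationAt E (TangentSpace I) x₀).symmL ℝ x)) = _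
  rw [h1]
  ext v
  simp
  rfl

/-- The chart may be centred at any x₀ whose chart domain contains x, so one frame tests smoothness
on a whole chart domain. -/
theorem contMDiffAt_cotTotal_iff {U : Opens X} {s : ∀ x : U, CotFibre I X x.1} {x₀ : X} {x : U}
    (hx : x.1 ∈ (chartAt H x₀).source) :
    ContMDiffAt I (I.prod 𝓘(ℝ, E →L[ℝ] ℝ)) ∞ (cotTotal I s) x ↔
      ContMDiffAt I 𝓘(ℝ, E →L[ℝ] ℝ) ∞
        (fun y : U => (ofCotFibre (s y)).comp (chartFrame I x₀ y.1)) x := by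
  rw [Bundle.Trivialization.contMDiffAt_iff
    (e := trivializationAt (E →L[ℝ] ℝ) (CotFibre I X) x₀)]
  · refine (and_iff_right contMDiff_subtype_val.contMDiffAt).trans ?_
    refine Filter.EventuallyEq.contMDiffAt_iff ?_
    filter_upwards [continuous_subtype_val.continuousAt.eventually
      ((chartAt H x₀).open_source.mem_nhds hx)] with y hy
    exact cotTrivialization_apply hy (ofCotFibre (s y))
  · exact ⟨hx, trivial⟩

theorem contMDiffAt_cotDiff_comp_chartFrame {f : X → ℝ} {x₀ : X}
    (hf : ContMDiffAt I 𝓘(ℝ, ℝ) ∞ f x₀) :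
    ContMDiffAt I 𝓘(ℝ, E →L[ℝ] ℝ) ∞
      (fun y => (cotDiff I f y).comp (chartFrame I x₀ y)) x₀ := by
  refine (hf.mfderiv_const (m := ∞) (by simp)).congr_of_eventuallyEq ?_
  filter_upwards [(chartAt H x₀).open_source.mem_nhds (mem_chart_source H x₀)] with y hy
  have h1 := TangentBundle.symmL_trivializationAt (I := I) hy
  change _ = ((trivializationAt ℝ (TangentSpace 𝓘(ℝ, ℝ)) (f x₀)).continuousLinearMapAt ℝ (f y)).comp
    ((cotDiff I f y).comp ((trivializationAt E (TangentSpace I) x₀).symmL ℝ y))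
  rw [h1, TangentBundle.continuousLinearMapAt_model_space]
  rfl

theorem mem_cotSections_cotDiff {U : Opens X} {f : X → ℝ}
    (hf : ∀ x ∈ U, ContMDiffAt I 𝓘(ℝ, ℝ) ∞ f x) :
    (fun x : U => toCotFibre x.1 (cotDiff I f x.1)) ∈ cotSections I U :=
  mem_cotSections.2 fun x => (contMDiffAt_cotTotal_iff (mem_chart_source H x.1)).2 <|
    contMDiffAt_subtype_iff.2 (contMDiffAt_cotDiff_comp_chartFrame (hf x.1 x.2))

/-- Coordinates on an open subset of a manifold. -/
structure IsCoordinates {n : ℕ} (t : Fin n → manFn I X) (U : Set X) : Prop where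
  exists_smoothFn : ∀ y ∈ U, ∀ f : manFn I X, ∃ F : SmoothFn n,
    f.1 =ᶠ[𝓝 y] fun q => F.1 fun i => (t i).1 q
  exists_eq_sum : ∀ (V : Opens X), (V : Set X) ⊆ U → ∀ s ∈ cotSections I V,
    ∃ a : Fin n → manFn I V, ∀ x : V,
      ofCotFibre (s x) = ∑ i, (a i).1 x • cotDiff I (t i).1 x.1
  eq_zero : ∀ y ∈ U, ∀ a : Fin n → ℝ, ∑ i, a i • cotDiff I (t i).1 y = 0 → a = 0

end Cotangent

/-! ### Coordinates on manifolds modelled on quadrants -/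

section RnkCoordinates

variable {n k : ℕ} {X : Type u} [TopologicalSpace X] [ChartedSpace (Rnk n k) X]

theorem mem_range_modelRnk {p : EuclideanSpace ℝ (Fin n)} :
    p ∈ Set.range (modelRnk n k) ↔
      p.ofLp ∈ quadrant (Finset.univ.filter fun i : Fin n => i.val < k) := by
  change p ∈ Set.range (Subtype.val : Rnk n k → EuclideanSpace ℝ (Fin n)) ↔ _
  rw [Rnk.range_val, Set.mem_ofPred_eq, mem_quadrant]
  simp

theorem norm_ofLp_le (p : EuclideanSpace ℝ (Fin n)) : ‖p.ofLp‖ ≤ ‖p‖ :=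
  (pi_norm_le_iff_of_nonneg (norm_nonneg _)).2 fun i => PiLp.norm_apply_le p i

theorem clm_eq_sum_proj (L : EuclideanSpace ℝ (Fin n) →L[ℝ] ℝ) :
    L = ∑ i, L (EuclideanSpace.single i 1) • EuclideanSpace.proj i := by
  ext v
  conv_lhs => rw [← (EuclideanSpace.basisFun (Fin n) ℝ).sum_repr v, map_sum]
  rw [sum_apply]
  refine Finset.sum_congr rfl fun i _ => ?_
  rw [map_smul]
  simp [mul_comm]

variable [IsManifold (modelRnk n k) ∞ X]

/-- Read in the chart and cut off, f becomes a compactly supported smooth function on the whole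
quadrant, to which Seeley's extension applies. -/
theorem exists_smoothFn_chart {x₀ y : X} (hy : y ∈ (chartAt (Rnk n k) x₀).source)
    (f : manFn (modelRnk n k) X) : ∃ F : SmoothFn n,
      f.1 =ᶠ[𝓝 y] fun q => F.1 (extChartAt (modelRnk n k) x₀ q).ofLp := by
  set φ := extChartAt (modelRnk n k) x₀ with hφ
  have hys : y ∈ φ.source := by rwa [hφ, extChartAt_source]
  have hg : ContDiffOn ℝ ∞ (fun p => f.1 (φ.symm p)) φ.target :=
    contMDiffOn_iff_contDiffOn.1
      ((mem_manFn.1 f.2).comp_contMDiffOn (contMDiffOn_extChartAt_symm x₀))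
  obtain ⟨r, hr, hball⟩ := Metric.mem_nhdsWithin_iff.1 (extChartAt_target_mem_nhdsWithin' hys)
  -- The cutoff is 1 within r/3, giving agreement with f near y, and it vanishes from r/2 on,
  -- strictly inside the ball of radius r whose part in the quadrant lies in the chart.
  let ρ : ContDiffBump (φ y) := ⟨r / 3, r / 2, by linarith, by linarith⟩
  have hzero : ∀ p, r / 2 ≤ dist p (φ y) → ρ p = 0 := fun p hp => ρ.zero_of_le_dist hp
  have hcont : ContDiffOn ℝ ∞ (fun p => ρ p * f.1 (φ.symm p)) (Set.range (modelRnk n k)) := by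
    intro p hp
    by_cases hpr : dist p (φ y) < r
    · have hpt : p ∈ φ.target := hball ⟨hpr, hp⟩
      exact (ρ.contDiff.contDiffAt.contDiffWithinAt.mul (hg p hpt)).mono_of_mem_nhdsWithin
        (extChartAt_target_mem_nhdsWithin_of_mem hpt)
    · refine (contDiffWithinAt_const (c := (0 : ℝ))).congr_of_eventuallyEq ?_ ?_
      · have : ∀ᶠ q in 𝓝 p, r / 2 < dist q (φ y) :=
          (continuous_id.dist continuous_const).continuousAt.eventually_const_lt
            (by rw [not_lt] at hpr; exact lt_of_lt_of_le (by linarith) hpr)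
        filter_upwards [mem_nhdsWithin_of_mem_nhds this] with q hq
        rw [hzero q (le_of_lt hq), zero_mul]
      · rw [hzero p (by rw [not_lt] at hpr; linarith), zero_mul]
  have htest : IsTestOn (quadrant (Finset.univ.filter fun i : Fin n => i.val < k))
      (‖φ y‖ + r / 2) fun q => ρ (WithLp.toLp 2 q) * f.1 (φ.symm (WithLp.toLp 2 q)) := by
    refine ⟨?_, fun q _ hq => ?_⟩
    · exact hcont.comp (PiLp.continuousLinearEquiv 2 ℝ fun _ : Fin n => ℝ).symm.contDiff.contDiffOn
        fun q hq => mem_range_modelRnk.2 hq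
    · rw [hzero, zero_mul]
      have h1 : ‖q‖ ≤ ‖(WithLp.toLp 2 q : EuclideanSpace ℝ (Fin n))‖ := norm_ofLp_le _
      have h2 := norm_sub_norm_le (WithLp.toLp 2 q : EuclideanSpace ℝ (Fin n)) (φ y)
      rw [dist_eq_norm]
      linarith
  obtain ⟨F, hF⟩ := htest.exists_contDiff_extension
  refine ⟨F, ?_⟩
  have h1 : ∀ᶠ q in 𝓝 y, dist (φ q) (φ y) < r / 3 :=
    (continuousAt_extChartAt' hys).eventually (Metric.ball_mem_nhds _ (by linarith))
  filter_upwards [h1, extChartAt_source_mem_nhds' hys] with q hq hqs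
  have hqr : φ q ∈ Set.range (modelRnk n k) := extChartAt_target_subset_range x₀ (φ.map_source hqs)
  rw [hF _ (mem_range_modelRnk.1 hqr), WithLp.toLp_ofLp, φ.left_inv hqs,
    ρ.one_of_mem_closedBall (Metric.mem_closedBall.2 hq.le), one_mul]

/-- The dtᵢ are the components of the differential of the chart, which is invertible with inverse
`chartFrame`. So a covector field has as coefficients its values on the frame, and these are smooth.
-/
theorem isCoordinates_of_chart {t : Fin n → manFn (modelRnk n k) X} {U : Set X} {x₀ : X}
    (hU : U ⊆ (chartAt (Rnk n k) x₀).source) (ht : ∀ y ∈ U, ∀ i,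
      (t i).1 =ᶠ[𝓝 y] fun q => (extChartAt (modelRnk n k) x₀ q).ofLp i) : IsCoordinates t U := by
  have hdt : ∀ y ∈ U, ∀ i, cotDiff (modelRnk n k) (t i).1 y =
      (EuclideanSpace.proj i : EuclideanSpace ℝ (Fin n) →L[ℝ] ℝ).comp
        (chartDiff (modelRnk n k) x₀ y) := by
    intro y hy i
    rw [cotDiff_congr (ht y hy i)]
    have h1 : MDifferentiableAt (modelRnk n k) 𝓘(ℝ, EuclideanSpace ℝ (Fin n))
      (extChartAt (modelRnk n k) x₀) y := mdifferentiableAt_extChartAt (hU hy)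
    exact ((EuclideanSpace.proj i : EuclideanSpace ℝ (Fin n) →L[ℝ] ℝ).hasMFDerivAt.comp y
      h1.hasMFDerivAt).mfderiv
  refine ⟨fun y hy f => ?_, fun V hV s hs => ?_, fun y hy a ha => ?_⟩
  · obtain ⟨F, hF⟩ := exists_smoothFn_chart (hU hy) f
    refine ⟨F, ?_⟩
    filter_upwards [hF, Filter.eventually_all.2 fun i => ht y hy i] with q hq hq'
    rw [hq]
    exact congrArg F.1 (funext fun i => (hq' i).symm)
  · refine ⟨fun i => ⟨fun x => (ofCotFibre (s x)).comp (chartFrame (modelRnk n k) x₀ x.1)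
      (EuclideanSpace.single i 1), mem_manFn.2 fun x => ?_⟩, fun x => ?_⟩
    · exact ((contMDiffAt_cotTotal_iff (hU (hV x.2))).1 (mem_cotSections.1 hs x)).clm_apply
        contMDiffAt_const
    · have h1 : ofCotFibre (s x) = ((ofCotFibre (s x)).comp (chartFrame (modelRnk n k) x₀ x.1)).comp
          (chartDiff (modelRnk n k) x₀ x.1) := by
        rw [ContinuousLinearMap.comp_assoc, chartFrame_comp_chartDiff (hU (hV x.2)),
          ContinuousLinearMap.comp_id]
      conv_lhs => rw [h1, clm_eq_sum_proj
        ((ofCotFibre (s x)).comp (chartFrame (modelRnk n k) x₀ x.1))]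
      simp only [hdt _ (hV x.2)]
      ext v
      simp
  · have h1 := congrArg (fun L => L.comp (chartFrame (modelRnk n k) x₀ y)) ha
    have h2 : ∑ i, a i • (EuclideanSpace.proj i : EuclideanSpace ℝ (Fin n) →L[ℝ] ℝ) = 0 := by
      refine Eq.trans ?_ (h1.trans (ContinuousLinearMap.zero_comp _))
      simp only [hdt y hy, ContinuousLinearMap.finsetSum_comp, ContinuousLinearMap.smul_comp]
      refine Finset.sum_congr rfl fun i _ => ?_
      rw [ContinuousLinearMap.comp_assoc, chartDiff_comp_chartFrame (hU hy),
        ContinuousLinearMap.comp_id]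
    funext i
    have h3 := congrArg (fun L => L (EuclideanSpace.single i (1 : ℝ))) h2
    simpa [Pi.single_apply] using h3

theorem exists_isCoordinates [T2Space X] (x₀ : X) :
    ∃ (t : Fin n → manFn (modelRnk n k) X) (U : Set X), IsOpen U ∧ x₀ ∈ U ∧ IsCoordinates t U := by
  have hs := (chartAt (Rnk n k) x₀).open_source
  have h := fun i : Fin n => exists_manFn_germ (I := modelRnk n k) hs (mem_chart_source _ x₀)
    (g := fun q => (extChartAt (modelRnk n k) x₀ q).ofLp i) fun q hq =>
      ((EuclideanSpace.proj i : EuclideanSpace ℝ (Fin n) →L[ℝ] ℝ).contDiff.contMDiff.contMDiffAt).comp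
        q (contMDiffAt_extChartAt' hq)
  choose t ht using h
  -- The functions tᵢ are cut off away from x₀; `U` consists of points at which their germs are
  -- still those of the chart coordinates.
  obtain ⟨U, hU, hUo, hxU⟩ := mem_nhds_iff.1 (Filter.inter_mem
    (Filter.eventually_all.2 fun i => (ht i).eventually_nhds)
    (hs.mem_nhds (mem_chart_source (Rnk n k) x₀)))
  exact ⟨t, U, hUo, hxU, isCoordinates_of_chart (fun q hq => (hU hq).2) fun y hy i => (hU hy).1 i⟩

end RnkCoordinates

theorem isCoordinates_linearFn (n k : ℕ) :
    IsCoordinates (fun i => linearFn (n := n) (k := k) (EuclideanSpace.proj i)) Set.univ := by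
  refine isCoordinates_of_chart (x₀ := ⟨0, fun _ _ => le_rfl⟩) (fun y _ => ?_)
    fun y _ i => Filter.Eventually.of_forall fun q => ?_
  · rw [chartAt_self_eq]
    exact Set.mem_univ y
  · simp [linearFn]
    rfl

/-! ### From cotangent modules to one-forms -/

section ManifoldCotangent

variable {E : Type} [NormedAddCommGroup E] [NormedSpace ℝ E] {H : Type}
  [TopologicalSpace H] {I : ModelWithCorners ℝ E H} {X : Type u} [TopologicalSpace X]
  [ChartedSpace H X] [IsManifold I ∞ X]

instance cotSections.addCommGroup (U : Opens X) : AddCommGroup (cotSections I U) :=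
  Submodule.addCommGroup _

/-- The `C^∞(U)`-module of one-forms on `U`. -/
instance cotSections.module (U : Opens X) : Module (manFn I U) (cotSections I U) :=
  Submodule.module _

instance cotSections.distribMulAction (U : Opens X) :
    DistribMulAction (manFn I U) (cotSections I U) := (cotSections.module U).toDistribMulAction

instance cotSections.smul (U : Opens X) : SMul (manFn I U) (cotSections I U) :=
  (cotSections.distribMulAction U).toSMul

theorem exists_cotSections_glue {ι : Type*} {U : Opens X} (V : ι → Opens X) (hV : ∀ i, V i ≤ U)
    (h : U ≤ iSup V) (s : ∀ i, cotSections I (V i))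
    (hs : ∀ i j x (hi : x ∈ V i) (hj : x ∈ V j), (s i).1 ⟨x, hi⟩ = (s j).1 ⟨x, hj⟩) :
    ∃ t : cotSections I U, ∀ i x (hi : x ∈ V i), t.1 ⟨x, hV i hi⟩ = (s i).1 ⟨x, hi⟩ := by
  have hcov : ∀ x : U, ∃ i, x.1 ∈ V i := fun x => Opens.mem_iSup.1 (h x.2)
  choose i hi using hcov
  let t : ∀ x : U, CotFibre I X x.1 := fun x => (s (i x)).1 ⟨x.1, hi x⟩
  refine ⟨⟨t, mem_cotSections.2 fun x => ?_⟩, fun j x hj => hs _ _ x _ _⟩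
  refine ((contDiffWithinAt_localInvariantProp (I := I) (I' := I.prod 𝓘(ℝ, E →L[ℝ] ℝ))
    ∞).liftPropAt_iff_comp_inclusion (hV (i x)) (cotTotal I t) ⟨x.1, hi x⟩).2 ?_
  have h1 : cotTotal I t ∘ Set.inclusion (hV (i x)) = cotTotal I (s (i x)).1 :=
    funext fun y => congrArg (fun L : CotFibre I X y.1 => (⟨y.1, L⟩ :
      Bundle.TotalSpace (E →L[ℝ] ℝ) (CotFibre I X))) (hs _ _ y.1 _ _)
  rw [h1]
  exact mem_cotSections.1 (s (i x)).2 ⟨x.1, hi x⟩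

variable (I X) in
theorem manCot_isSheaf : (manCot I X).IsSheaf where
  locality V hV h s t hst := by
    refine Subtype.ext (funext fun x => ?_)
    obtain ⟨i, hi⟩ := Opens.mem_iSup.1 (h x.2)
    exact congrFun (congrArg Subtype.val (hst i)) ⟨x.1, hi⟩
  gluing := fun {ι} {U : Opens X} (V : ι → Opens X) hV h (s : ∀ i, cotSections I (V i)) hs => by
    obtain ⟨t, ht⟩ := exists_cotSections_glue (I := I) (X := X) (U := U) V hV h s
      fun i j x hi hj => congrFun (congrArg Subtype.val (hs i j)) ⟨x, hi, hj⟩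
    exact ⟨t, fun j => Subtype.ext (funext fun x => ht j x.1 x.2)⟩

/-- The differential of a smooth function on an open set. -/
def manDiff {U : Opens X} (g : manFn I U) : cotSections I U :=
  ⟨fun x => toCotFibre x.1 (cotDiff I (extendFn g) x.1),
    mem_cotSections_cotDiff fun _ hx => contMDiffAt_extendFn g hx⟩

theorem manDiff_apply {U : Opens X} (g : manFn I U) (x : U) :
    ofCotFibre ((manDiff g).1 x) = cotDiff I (extendFn g) x.1 := rfl

theorem ofCotFibre_sum_smul {U : Opens X} {ι : Type*} (s : Finset ι) (a : ι → manFn I U)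
    (σ : ι → cotSections I U) (x : U) : ofCotFibre ((∑ i ∈ s, a i • σ i).1 x) =
      ∑ i ∈ s, (a i).1 x • ofCotFibre ((σ i).1 x) := by
  classical
  induction s using Finset.induction_on with
  | empty => rfl
  | insert j s hj ih =>
    rw [Finset.sum_insert hj, Finset.sum_insert hj, ← ih]
    rfl

theorem cotSections_ext {U : Opens X} {σ τ : cotSections I U}
    (h : ∀ x, ofCotFibre (σ.1 x) = ofCotFibre (τ.1 x)) : σ = τ := Subtype.ext (funext h)

theorem isCInfDer_manDiff (U : Opens X) : IsCInfDer (manDiff : manFn I U → cotSections I U) := by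
  intro m f c
  refine cotSections_ext fun x => ?_
  rw [ofCotFibre_sum_smul, manDiff_apply]
  have h : extendFn (op f c) =ᶠ[𝓝 x.1] fun q => f.1 fun k => extendFn (c k) q := by
    filter_upwards [U.isOpen.mem_nhds x.2] with q hq
    rw [extendFn_apply _ hq]
    exact congrArg f.1 (funext fun k => (extendFn_apply (c k) hq).symm)
  rw [cotDiff_congr h, cotDiff_comp f fun k =>
    (contMDiffAt_extendFn (c k) x.2).mdifferentiableAt (by simp)]
  refine Finset.sum_congr rfl fun k _ => ?_
  rw [manDiff_apply]
  congr 1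
  exact congrArg (f.pderiv k).1 (funext fun k => extendFn_apply (c k) x.2)

omit [IsManifold I ∞ X] in
theorem extendFn_manRes {U V : Opens X} (h : V ≤ U) (g : manFn I U) {x : X} (hx : x ∈ V) :
    extendFn (manRes I h g) =ᶠ[𝓝 x] extendFn g := by
  filter_upwards [V.isOpen.mem_nhds hx] with q hq
  rw [extendFn_apply _ hq, extendFn_apply _ (h hq)]
  rfl

omit [IsManifold I ∞ X] in
theorem extendFn_restrict {U : Opens X} (f : manFn I X) {x : X} (hx : x ∈ U) :
    extendFn (manFn.restrict I f U) =ᶠ[𝓝 x] f.1 := by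
  filter_upwards [U.isOpen.mem_nhds hx] with q hq
  rw [extendFn_apply _ hq]
  rfl

theorem manDiff_restrict_apply {U : Opens X} (f : manFn I X) (x : U) :
    ofCotFibre ((manDiff (manFn.restrict I f U)).1 x) = cotDiff I f.1 x.1 :=
  cotDiff_congr (extendFn_restrict f x.2)

/-- The smooth one-form defined by an element of the cotangent module. -/
def omegaToForm (U : Opens X) : Omega (manFn I U) →ₗ[manFn I U] cotSections I U :=
  Omega.lift (C := manFn I U) (M := cotSections I U) (manDiff (I := I) (U := U))
    (isCInfDer_manDiff U)

theorem omegaToForm_d {U : Opens X} (g : manFn I U) : omegaToForm U (Omega.d g) = manDiff g :=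
  Omega.lift_d _ _ g

theorem omegaToForm_map {U V : Opens X} (h : V ≤ U) (m : Omega (manFn I U)) (x : V) :
    ofCotFibre ((omegaToForm V (Omega.map (manRes I h) m)).1 x) =
      ofCotFibre ((omegaToForm U m).1 ⟨x.1, h x.2⟩) := by
  induction m using Omega.induction with
  | zero => simp only [map_zero]; rfl
  | add m m' hm hm' =>
    simp only [map_add]
    exact congrArg₂ (· + ·) hm hm'
  | smul_d a c =>
    rw [LinearMap.map_smulₛₗ, map_smul, map_smul, Omega.map_d, omegaToForm_d, omegaToForm_d]
    exact congrArg (a.1 ⟨x.1, h x.2⟩ • ·) (cotDiff_congr (extendFn_manRes h c x.2))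

variable {n : ℕ} {t : Fin n → manFn I X} {U : Opens X}

theorem omegaToForm_sum {V : Opens X} (a : Fin n → manFn I V) (x : V) :
    ofCotFibre ((omegaToForm V (∑ i, a i • Omega.d (manFn.restrict I (t i) V))).1 x) =
      ∑ i, (a i).1 x • cotDiff I (t i).1 x.1 := by
  simp only [map_sum, map_smul, omegaToForm_d]
  rw [ofCotFibre_sum_smul]
  exact Finset.sum_congr rfl fun i _ => by rw [manDiff_restrict_apply]

theorem IsCoordinates.eq_zero_of_sum {V : Opens X} (ht : IsCoordinates t (U : Set X)) (hV : V ≤ U)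
    {a : Fin n → manFn I V} (h : ∀ x : V, ∑ i, (a i).1 x • cotDiff I (t i).1 x.1 = 0) : a = 0 :=
  funext fun i => Subtype.ext (funext fun x => congrFun (ht.eq_zero x.1 (hV x.2) _ (h x)) i)

variable [FiniteDimensional ℝ E] [T2Space X]

/-- Near x a function is F(t₁, …, t_n) with F smooth on ℝⁿ, and the relation for Φ_F writes its
differential through the dtᵢ already in the cotangent module, not merely as a form. -/
theorem IsCoordinates.exists_omega_eq_sum (ht : IsCoordinates t (U : Set X))
    {V : Opens X} (m : Omega (manFn I V)) {x : X} (hxU : x ∈ U) (hxV : x ∈ V) :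
    ∃ (W : Opens X) (hW : W ≤ V) (a : Fin n → manFn I W), x ∈ W ∧ W ≤ U ∧
      Omega.map (manRes I hW) m = ∑ i, a i • Omega.d (manFn.restrict I (t i) W) := by
  induction m using Omega.induction with
  | zero => exact ⟨V ⊓ U, inf_le_left, 0, ⟨hxV, hxU⟩, inf_le_right, by simp⟩
  | add m m' hm hm' =>
    obtain ⟨W, hW, a, hxW, hWU, ha⟩ := hm
    obtain ⟨W', hW', a', hxW', -, ha'⟩ := hm'
    have hres : ∀ (W₀ : Opens X) (h : W ⊓ W' ≤ W₀) (h₀ : W₀ ≤ V) (a : Fin n → manFn I W₀)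
        (m : Omega (manFn I V)),
        Omega.map (manRes I h₀) m = ∑ i, a i • Omega.d (manFn.restrict I (t i) W₀) →
        Omega.map (manRes I (h.trans h₀)) m =
          ∑ i, manRes I h (a i) • Omega.d (manFn.restrict I (t i) (W ⊓ W')) := by
      intro W₀ h h₀ a m e
      rw [← Omega.map_comp (manRes I h₀) (manRes I h) _ fun _ => rfl, e, map_sum]
      refine Finset.sum_congr rfl fun i _ => ?_
      rw [LinearMap.map_smulₛₗ, Omega.map_d]
      rfl
    refine ⟨W ⊓ W', inf_le_left.trans hW,
      fun i => manRes I inf_le_left (a i) + manRes I inf_le_right (a' i), ⟨hxW, hxW'⟩,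
      inf_le_left.trans hWU, ?_⟩
    rw [map_add, hres W inf_le_left hW a m ha, hres W' inf_le_right hW' a' m' ha',
      ← Finset.sum_add_distrib]
    exact Finset.sum_congr rfl fun i _ => (add_smul _ _ _).symm
  | smul_d b c =>
    obtain ⟨f, hf⟩ := exists_manFn_extendFn c hxV
    obtain ⟨F, hF⟩ := ht.exists_smoothFn x hxU f
    obtain ⟨W, hxW, hW⟩ := exists_opens_of_eventually
      ((hf.symm.trans hF).and (Filter.inter_mem (V.isOpen.mem_nhds hxV) (U.isOpen.mem_nhds hxU)))
    have hWV : W ≤ V := fun q hq => (hW q hq).2.1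
    have hc : manRes I hWV c = op F fun i => manFn.restrict I (t i) W :=
      Subtype.ext (funext fun q => by
        have := (hW q.1 q.2).1
        rw [extendFn_apply c (hWV q.2)] at this
        exact this)
    refine ⟨W, hWV, fun i => manRes I hWV b * op (F.pderiv i) fun i => manFn.restrict I (t i) W,
      hxW, fun q hq => (hW q hq).2.2, ?_⟩
    rw [LinearMap.map_smulₛₗ, Omega.map_d, hc, Omega.isCInfDer_d, Finset.smul_sum]
    exact Finset.sum_congr rfl fun i _ => (mul_smul _ _ _).symm

end ManifoldCotangent

theorem eq_zero_of_cotPreHom {X Y : CSpace.{u}} {i : CSpace.Iso X Y} {V : Opens Y.carrier}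
    {m : (cotPre Y).M V} (h : (cotPreHom i).app V m = 0) : m = 0 :=
  ((cotPreIso i).app V).injective (h.trans (map_zero _).symm)

/-! ### The cotangent sheaf of a manifold as the sheaf of one-forms -/

section ManifoldCotangentSheaf

variable {E : Type} [NormedAddCommGroup E] [NormedSpace ℝ E] {H : Type}
  [TopologicalSpace H] {I : ModelWithCorners ℝ E H} {X : Type u} [TopologicalSpace X]
  [ChartedSpace H X] [IsManifold I ∞ X] {n : ℕ} {t : Fin n → manFn I X}

theorem IsCoordinates.exists_omegaToForm_eq {U V : Opens X} (ht : IsCoordinates t (U : Set X))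
    (hV : V ≤ U) (s : cotSections I V) :
    ∃ a : Fin n → manFn I V,
      omegaToForm V (∑ i, a i • Omega.d (manFn.restrict I (t i) V)) = s := by
  obtain ⟨a, ha⟩ := ht.exists_eq_sum V hV s.1 s.2
  exact ⟨a, cotSections_ext fun x => (omegaToForm_sum a x).trans (ha x).symm⟩

theorem IsCoordinates.eq_zero_of_omegaToForm {U V : Opens X} (ht : IsCoordinates t (U : Set X))
    (hV : V ≤ U) {a : Fin n → manFn I V}
    (h : omegaToForm V (∑ i, a i • Omega.d (manFn.restrict I (t i) V)) = 0) : a = 0 :=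
  ht.eq_zero_of_sum hV fun x => (omegaToForm_sum a x).symm.trans
    (congrArg (fun s : cotSections I V => ofCotFibre (s.1 x)) h)

theorem cotSections_res_eq {U V : Opens X} (h : V ≤ U) {s : cotSections I U} {s' : cotSections I V}
    (H : ∀ x : V, ofCotFibre (s'.1 x) = ofCotFibre (s.1 ⟨x.1, h x.2⟩)) :
    s' = (manCot I X).res h s := cotSections_ext H

variable [FiniteDimensional ℝ E] [T2Space X]

/-- Locally the class is ∑ aᵢ dtᵢ. If its form vanishes, then all aᵢ vanish by pointwise
independence of the dtᵢ, and so the class itself is locally 0. -/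
theorem exists_map_eq_zero_of_omegaToForm_eq_zero {U V : Opens X}
    (ht : IsCoordinates t (U : Set X)) {m : Omega (manFn I V)} (hm : omegaToForm V m = 0) {x : X}
    (hxU : x ∈ U) (hxV : x ∈ V) :
    ∃ (W : Opens X) (hW : W ≤ V), x ∈ W ∧ Omega.map (manRes I hW) m = 0 := by
  obtain ⟨W, hW, a, hxW, hWU, ha⟩ := ht.exists_omega_eq_sum m hxU hxV
  refine ⟨W, hW, hxW, ?_⟩
  have h0 : a = 0 := by
    refine ht.eq_zero_of_omegaToForm hWU (cotSections_ext fun y => ?_)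
    rw [← ha, omegaToForm_map, hm]
    rfl
  rw [ha, h0]
  simp

variable [SigmaCompactSpace X]

variable (I X) in
/-- The morphism from the cotangent presheaf of the spectrum of `C^∞(X)` to the sheaf of
one-forms. -/
def omegaToManCot : PreMod.HomOver (manIso I X) (manCot I X) (cotPre (manSpec I X)) where
  app V := (omegaToForm (preimageOpens (manHomeo I X) V)).toAddMonoidHom.comp
    ((cotPreHom (manIso I X)).app V)
  app_smul {V} r m :=
    (congrArg (omegaToForm (preimageOpens (manHomeo I X) V))
      ((cotPreHom (manIso I X)).app_smul r m)).trans
      (map_smul (omegaToForm (preimageOpens (manHomeo I X) V)) _ _)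
  app_res {V W} h m :=
    (congrArg (omegaToForm (preimageOpens (manHomeo I X) W))
      ((cotPreHom (manIso I X)).app_res h m)).trans
      (cotSections_res_eq _ (omegaToForm_map (preimageOpens_mono (manHomeo I X) h) _))

/-- Both halves come from local coordinates: the dtᵢ generate the cotangent module near a point and
form a basis of the one-forms there. -/
theorem omegaToManCot_locBij (H : ∀ x : X, ∃ (n : ℕ) (t : Fin n → manFn I X) (U : Opens X),
    x ∈ U ∧ IsCoordinates t (U : Set X)) : (omegaToManCot I X).LocBij where
  inj := fun {V} m hm y hy => by
    obtain ⟨x, rfl⟩ := (manHomeo I X).surjective y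
    obtain ⟨n, t, U, hxU, ht⟩ := H x
    obtain ⟨W, hW, hxW, h0⟩ := exists_map_eq_zero_of_omegaToForm_eq_zero ht hm hxU hy
    obtain ⟨W, rfl⟩ := exists_preimageOpens (manHomeo I X) W
    have hWV := (preimageOpens_le_iff _).1 hW
    exact ⟨W, hWV, hxW, eq_zero_of_cotPreHom (((cotPreHom (manIso I X)).app_res hWV m).trans h0)⟩
  surj := fun {V} s y hy => by
    obtain ⟨x, rfl⟩ := (manHomeo I X).surjective y
    obtain ⟨n, t, U, hxU, ht⟩ := H x
    obtain ⟨U, rfl⟩ := exists_preimageOpens (manHomeo I X) U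
    obtain ⟨a, ha⟩ := ht.exists_omegaToForm_eq
      (V := preimageOpens (manHomeo I X) (V ⊓ U)) (preimageOpens_mono _ inf_le_right)
      ((manCot I X).res (preimageOpens_mono (manHomeo I X) inf_le_left) s)
    obtain ⟨m, hm⟩ := ((cotPreIso (manIso I X)).app (V ⊓ U)).surjective
      (∑ i, a i • Omega.d (manFn.restrict I (t i) (preimageOpens (manHomeo I X) (V ⊓ U))))
    exact ⟨V ⊓ U, inf_le_left, m, ⟨hy, hxU⟩,
      (congrArg (omegaToForm (I := I) (X := X) (preimageOpens (manHomeo I X) (V ⊓ U))) hm).trans ha⟩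

end ManifoldCotangentSheaf

/-! ### Frames and trivial sheaves of modules -/

namespace PreMod

variable {X Y : CSpace.{u}}

/-- A frame of a presheaf of modules over an open set. -/
def IsFrame (E : PreMod X) {V : Opens X.carrier} {n : ℕ} (e : Fin n → E.M V) : Prop :=
  Function.Bijective fun a : Fin n → X.O V => ∑ i, a i • e i

theorem IsoOver.isFrame {i : CSpace.Iso X Y} {E : PreMod X} {F : PreMod Y} (β : IsoOver i E F)
    {V : Opens Y.carrier} {n : ℕ} {e : Fin n → F.M V} (h : E.IsFrame fun j => β.app V (e j)) :
    F.IsFrame e := by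
  have key : ∀ a : Fin n → Y.O V,
      β.app V (∑ j, a j • e j) = ∑ j, i.sec V (a j) • β.app V (e j) := fun a => by
    rw [map_sum]
    exact Finset.sum_congr rfl fun j _ => β.app_smul _ _
  constructor
  · intro a a' haa
    have h1 : β.app V (∑ j, a j • e j) = β.app V (∑ j, a' j • e j) := congrArg (β.app V) haa
    rw [key, key] at h1
    have h2 := h.1 h1
    exact funext fun j => (i.sec V).toAlgEquiv.injective (congrFun h2 j)
  · intro s
    obtain ⟨a, ha⟩ := h.2 (β.app V s)
    refine ⟨fun j => (i.sec V).toAlgEquiv.symm (a j), (β.app V).injective ?_⟩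
    refine (key _).trans (Eq.trans (Finset.sum_congr rfl fun j _ => ?_) ha)
    exact congrArg (· • β.app V (e j)) ((i.sec V).toAlgEquiv.apply_symm_apply (a j))

variable {W : Type} [AddCommGroup W] [Module ℝ W] {n : ℕ} (b : Module.Basis (Fin n) ℝ W)
  {E : PreMod X} (e : ∀ V, Fin n → E.M V)

/-- The map `O(V) ⊗ W → E(V)` that takes a basis to given sections. -/
def tensorToFrame (V : Opens X.carrier) : X.O V ⊗[ℝ] W →ₗ[X.O V] E.M V :=
  (Algebra.TensorProduct.basis (X.O V) b).constr (X.O V) (e V)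

theorem tensorToFrame_tmul (V : Opens X.carrier) (r : X.O V) (w : W) :
    tensorToFrame b e V (r ⊗ₜ w) = r • ∑ j, algebraMap ℝ (X.O V) (b.repr w j) • e V j := by
  rw [tensorToFrame, Module.Basis.constr_apply_fintype, Finset.smul_sum]
  refine Finset.sum_congr rfl fun j _ => ?_
  rw [Module.Basis.equivFun_apply, Algebra.TensorProduct.basis_repr_tmul, smul_smul]
  simp

theorem tensorToFrame_bijective {V : Opens X.carrier} (h : E.IsFrame (e V)) :
    Function.Bijective (tensorToFrame b e V) := by
  have : (tensorToFrame b e V : X.O V ⊗[ℝ] W → E.M V) =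
      (fun a : Fin n → X.O V => ∑ i, a i • e V i) ∘
        (Algebra.TensorProduct.basis (X.O V) b).equivFun :=
    funext fun m => (Algebra.TensorProduct.basis (X.O V) b).constr_apply_fintype _ _ m
  rw [this]
  exact h.comp (LinearEquiv.bijective _)

variable {e}

theorem tensorToFrame_res (he : ∀ {U V} (h : V ≤ U) (j), E.res h (e U j) = e V j)
    {U V : Opens X.carrier} (h : V ≤ U) (m : X.O U ⊗[ℝ] W) :
    tensorToFrame b e V (tensorRes X W h m) = E.res h (tensorToFrame b e U m) := by
  induction m using TensorProduct.induction_on with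
  | zero => simp only [map_zero]
  | add m m' hm hm' => simp only [map_add, hm, hm']
  | tmul r w =>
    refine (tensorToFrame_tmul b e V (X.res h r) w).trans ?_
    rw [tensorToFrame_tmul, E.res_smul, map_sum]
    refine congrArg (X.res h r • ·) (Finset.sum_congr rfl fun j _ => ?_)
    rw [E.res_smul, he]
    exact congrArg (· • e V j) ((X.res h).toAlgHom.commutes _).symm

/-- A sheaf of modules with a frame is trivial. -/
def isoTensorVec (he : ∀ {U V} (h : V ≤ U) (j), E.res h (e U j) = e V j)
    (hf : ∀ V, E.IsFrame (e V)) : Iso E (tensorVec X W) :=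
  Iso.symm
    { app := fun V => LinearEquiv.ofBijective (tensorToFrame b e V)
        (tensorToFrame_bijective b e (hf V))
      app_res := fun h m => tensorToFrame_res b he h m }

theorem isoTensorVec_sum (he : ∀ {U V} (h : V ≤ U) (j), E.res h (e U j) = e V j)
    (hf : ∀ V, E.IsFrame (e V)) (V : Opens X.carrier) (w : W) :
    (isoTensorVec b he hf).app V (∑ j, algebraMap ℝ (X.O V) (b.repr w j) • e V j) =
      tensorVec.of V w := by
  refine (LinearEquiv.ofBijective (tensorToFrame b e V)
        (tensorToFrame_bijective b e (hf V))).symm_apply_eq.2 ?_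
  exact ((tensorToFrame_tmul b e V 1 w).trans (one_smul _ _)).symm

end PreMod

/-! ### Differentials of linear combinations -/

section CotangentSheaf

variable {X Y : CSpace.{u}}

theorem cotPreHom_d {i : CSpace.Iso X Y} {V : Opens Y.carrier} (s : Y.O V) :
    (cotPreHom i).app V (Omega.d s) = Omega.d (i.sec V s) := Omega.map_d (i.sec V).hom s

theorem cot_d_res {U V : Opens X.carrier} (h : V ≤ U) (s : X.O U) :
    (cot X).res h (cot.d s) = cot.d (X.res h s) :=
  ((cotPre X).toSheafify_res h _).symm.trans
    (congrArg ((cotPre X).toSheafify V) (Omega.map_d (X.res h) s))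

/-- The linear form with given coefficients, as a smooth function. -/
def SmoothFn.linear {n : ℕ} (r : Fin n → ℝ) : SmoothFn n :=
  ⟨fun x => ∑ i, r i * x i, SmoothFn.mem_iff.2 <|
    ContDiff.sum fun i _ => contDiff_const.mul (contDiff_apply ℝ ℝ i)⟩

theorem SmoothFn.pderiv_linear {n : ℕ} (r : Fin n → ℝ) (i : Fin n) :
    (SmoothFn.linear r).pderiv i = algebraMap ℝ (SmoothFn n) (r i) := by
  refine Subtype.ext (funext fun x => ?_)
  have h : (SmoothFn.linear r).1 =
      ⇑(∑ j, r j • (ContinuousLinearMap.proj j : (Fin n → ℝ) →L[ℝ] ℝ)) := by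
    funext x
    simp [SmoothFn.linear]
  change fderiv ℝ (SmoothFn.linear r).1 x (Pi.single i 1) = r i
  rw [h, ContinuousLinearMap.fderiv]
  simp [Pi.single_apply]

/-- Linearity of d over ℝ is the chain rule for the operation of a linear form, whose partial
derivatives are constants. -/
theorem cot_d_op_linear {U : Opens X.carrier} {n : ℕ} (r : Fin n → ℝ) (s : Fin n → X.O U) :
    cot.d (op (SmoothFn.linear r) s) = ∑ i, algebraMap ℝ (X.O U) (r i) • cot.d (s i) := by
  have h := congrArg ((cotPre X).toSheafify U) (Omega.isCInfDer_d (SmoothFn.linear r) s)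
  refine h.trans ((map_sum ((cotPre X).toSheafify U) _ _).trans
    (Finset.sum_congr rfl fun i _ => ?_))
  rw [SmoothFn.pderiv_linear, op_algebraMap]
  exact ((cotPre X).toSheafify U).map_smul _ _

end CotangentSheaf

/-! ### Coordinate frames of the cotangent sheaf of a manifold -/

section ManifoldCotangentFrame

variable {E : Type} [NormedAddCommGroup E] [NormedSpace ℝ E] {H : Type}
  [TopologicalSpace H] {I : ModelWithCorners ℝ E H} {X : Type u} [TopologicalSpace X]
  [ChartedSpace H X] [IsManifold I ∞ X] {n : ℕ} {t : Fin n → manFn I X}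

theorem IsCoordinates.isFrame_manDiff {U V : Opens X} (ht : IsCoordinates t (U : Set X))
    (hV : V ≤ U) : Function.Bijective fun a : Fin n → manFn I V =>
      ∑ i, a i • manDiff (manFn.restrict I (t i) V) := by
  have key : ∀ a : Fin n → manFn I V, ∑ i, a i • manDiff (manFn.restrict I (t i) V) =
      omegaToForm V (∑ i, a i • Omega.d (manFn.restrict I (t i) V)) := fun a => by
    simp only [map_sum, map_smul, omegaToForm_d]
  constructor
  · intro a a' h
    refine sub_eq_zero.1 (ht.eq_zero_of_omegaToForm hV ?_)
    rw [← key, ← sub_eq_zero.2 h, ← Finset.sum_sub_distrib]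
    exact Finset.sum_congr rfl fun i _ => sub_smul _ _ _
  · intro s
    obtain ⟨a, ha⟩ := ht.exists_omegaToForm_eq hV s
    exact ⟨a, (key a).trans ha⟩

variable [FiniteDimensional ℝ E] [T2Space X] [SigmaCompactSpace X]

/-- On a manifold with local coordinates, sections of the cotangent sheaf of the spectrum of
`C^∞(X)` are one-forms. -/
def manCotIso (H : ∀ x : X, ∃ (n : ℕ) (t : Fin n → manFn I X) (U : Opens X),
    x ∈ U ∧ IsCoordinates t (U : Set X)) :
    PreMod.IsoOver (manIso I X) (manCot I X) (cot (manSpec I X)) :=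
  (omegaToManCot_locBij H).isoSheafify (manCot_isSheaf I X)

theorem manCotIso_d (H : ∀ x : X, ∃ (n : ℕ) (t : Fin n → manFn I X) (U : Opens X),
    x ∈ U ∧ IsCoordinates t (U : Set X)) (V : Opens (RPoint (manFn I X))) (f : manFn I X) :
    (manCotIso H).app V (cot.d (Spec.fn V f)) =
      manDiff (manFn.restrict I f (preimageOpens (manHomeo I X) V)) := by
  refine ((omegaToManCot_locBij H).isoSheafify_toSheafify (manCot_isSheaf I X) _).trans ?_
  refine (congrArg (omegaToForm (I := I) (X := X) (preimageOpens (manHomeo I X) V)) ?_).trans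
    (omegaToForm_d _)
  refine (cotPreHom_d (i := manIso I X) (V := V) (Spec.fn V f)).trans ?_
  exact congrArg (Omega.d (C := manFn I (preimageOpens (manHomeo I X) V))) (manIso_sec_fn I X V f)

/-- Being a frame is reflected by isomorphisms, and the dtᵢ are a frame of the one-forms. -/
theorem IsCoordinates.isFrame_cot (H : ∀ x : X, ∃ (n : ℕ) (t : Fin n → manFn I X) (U : Opens X),
    x ∈ U ∧ IsCoordinates t (U : Set X)) {U : Opens X} (ht : IsCoordinates t (U : Set X))
    (V : Opens (RPoint (manFn I X))) (hV : preimageOpens (manHomeo I X) V ≤ U) :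
    (cot (manSpec I X)).IsFrame (V := V) fun i => cot.d (Spec.fn V (t i)) := by
  refine (manCotIso H).isFrame ?_
  have h : (fun j => (manCotIso H).app V (cot.d (Spec.fn V (t j)))) =
      fun j => manDiff (manFn.restrict I (t j) (preimageOpens (manHomeo I X) V)) :=
    funext fun j => manCotIso_d H V (t j)
  rw [h]
  exact ht.isFrame_manDiff hV

theorem isVectorBundle_cot_manSpec (H : ∀ x : X, ∃ (t : Fin n → manFn I X) (U : Opens X),
    x ∈ U ∧ IsCoordinates t (U : Set X)) : IsVectorBundle n (cot (manSpec I X)) := by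
  refine ⟨cot_isSheaf _, fun y => ?_⟩
  obtain ⟨x, rfl⟩ := (manHomeo I X).surjective y
  obtain ⟨t, U, hxU, ht⟩ := H x
  obtain ⟨U, rfl⟩ := exists_preimageOpens (manHomeo I X) U
  refine ⟨U, hxU, ⟨PreMod.isoTensorVec (Pi.basisFun ℝ (Fin n))
    (E := (cot (manSpec I X)).restrict U)
    (e := fun V j => cot.d (X := manSpec I X) (Spec.fn (imageOpens V) (t j))) ?_ ?_⟩⟩
  · exact fun h j => cot_d_res (X := manSpec I X) (imageOpens_mono h) _
  · intro V
    refine ht.isFrame_cot (fun x => ⟨n, H x⟩) (imageOpens V) (preimageOpens_mono _ ?_)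
    rintro _ ⟨z, -, rfl⟩
    exact z.2

end ManifoldCotangentFrame

/-! ### The global trivialization of the cotangent sheaf of ℝⁿ_k -/

section CotangentRnk

variable {n k : ℕ}

/-- The basis of the dual of `ℝⁿ` given by the coordinates. -/
def coordinateBasis (n : ℕ) : Module.Basis (Fin n) ℝ (EuclideanSpace ℝ (Fin n) →L[ℝ] ℝ) :=
  Module.Basis.ofEquivFun
    { toFun := fun l i => l (EuclideanSpace.single i 1)
      invFun := fun a => ∑ i, a i • EuclideanSpace.proj i
      map_add' := fun _ _ => rfl
      map_smul' := fun _ _ => rfl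
      left_inv := fun l => (clm_eq_sum_proj l).symm
      right_inv := fun a => by
        funext i
        simp }

theorem linearFn_eq_op (l : EuclideanSpace ℝ (Fin n) →L[ℝ] ℝ) :
    linearFn (k := k) l = op (SmoothFn.linear fun i => (coordinateBasis n).repr l i)
      fun i => linearFn (EuclideanSpace.proj i) := by
  refine Subtype.ext (funext fun x => ?_)
  change l x.1 = ∑ i, l (EuclideanSpace.single i 1) * x.1 i
  conv_lhs => rw [clm_eq_sum_proj l]
  simp

variable (n k) in
/-- The differentials of the coordinates on `ℝⁿ_k`. -/
def coordinateForm (V : Opens (manSpec (modelRnk n k) (Rnk n k)).carrier) (j : Fin n) :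
    (cot (manSpec (modelRnk n k) (Rnk n k))).M V :=
  cot.d (X := manSpec (modelRnk n k) (Rnk n k)) (Spec.fn V (linearFn (EuclideanSpace.proj j)))

theorem coordinateForm_res {U V : Opens (manSpec (modelRnk n k) (Rnk n k)).carrier} (h : V ≤ U)
    (j : Fin n) : (cot (manSpec (modelRnk n k) (Rnk n k))).res h (coordinateForm n k U j) =
      coordinateForm n k V j := cot_d_res (X := manSpec (modelRnk n k) (Rnk n k)) h _

theorem cot_d_linearFn (U : Opens (manSpec (modelRnk n k) (Rnk n k)).carrier)
    (l : EuclideanSpace ℝ (Fin n) →L[ℝ] ℝ) :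
    cot.d (X := manSpec (modelRnk n k) (Rnk n k)) (Spec.fn U (linearFn l)) =
      ∑ j, algebraMap ℝ ((manSpec (modelRnk n k) (Rnk n k)).O U) ((coordinateBasis n).repr l j) •
        coordinateForm n k U j := by
  refine Eq.trans ?_ (cot_d_op_linear (X := manSpec (modelRnk n k) (Rnk n k)) (U := U)
    (fun i => (coordinateBasis n).repr l i)
    fun j => Spec.fn U (linearFn (EuclideanSpace.proj j)))
  refine congrArg (cot.d (X := manSpec (modelRnk n k) (Rnk n k)) (U := U)) ?_
  rw [linearFn_eq_op l]
  exact toSections_op (C := manFn (modelRnk n k) (Rnk n k)) U _ _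

variable [SigmaCompactSpace (Rnk n k)]

theorem isFrame_coordinateForm (V : Opens (manSpec (modelRnk n k) (Rnk n k)).carrier) :
    (cot (manSpec (modelRnk n k) (Rnk n k))).IsFrame (coordinateForm n k V) :=
  (isCoordinates_linearFn n k).isFrame_cot (U := ⊤)
    (fun _ => ⟨n, _, ⊤, trivial, isCoordinates_linearFn n k⟩) V le_top

variable (n k) in
/-- The cotangent sheaf of `ℝⁿ_k` is trivial. -/
def cotRnkIso : PreMod.Iso (cot (manSpec (modelRnk n k) (Rnk n k)))
    (tensorVec (manSpec (modelRnk n k) (Rnk n k)) (EuclideanSpace ℝ (Fin n) →L[ℝ] ℝ)) :=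
  PreMod.isoTensorVec (coordinateBasis n) coordinateForm_res isFrame_coordinateForm

theorem cotRnkIso_d (U : Opens (manSpec (modelRnk n k) (Rnk n k)).carrier)
    (l : EuclideanSpace ℝ (Fin n) →L[ℝ] ℝ) :
    (cotRnkIso n k).app U (cot.d (X := manSpec (modelRnk n k) (Rnk n k))
      (Spec.fn U (linearFn l))) = tensorVec.of U l :=
  (congrArg ((cotRnkIso n k).app U) (cot_d_linearFn U l)).trans
    (PreMod.isoTensorVec_sum (coordinateBasis n) coordinateForm_res isFrame_coordinateForm U l)

end CotangentRnk

end CInf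

end

theorem theorem6p16 :
    (∀ (C : Type u) [CInf.CInfRing C], CInf.IsFG C →
      ∃ θ : CInf.PreMod.Iso (CInf.cot (CInf.Spec C)) (CInf.MSpec C (CInf.Omega C)),
        ∀ (U : TopologicalSpace.Opens (CInf.Spec C).carrier) (c : C),
          θ.app U (CInf.cot.d (CInf.Spec.fn U c)) = CInf.MSpec.of U (CInf.Omega.d c)) ∧
    (∀ X : CInf.CSpace.{u}, CInf.IsFairAffine X →
      (CInf.cotPre X).IsSheaf ∧
        ∀ U : TopologicalSpace.Opens X.carrier,
          Function.Bijective ((CInf.cotPre X).toSheafify U)) ∧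
    (∀ X : CInf.CSpace.{u}, CInf.IsLocallyGood X → CInf.IsCoherent (CInf.cot X)) ∧
    (∀ (n k : ℕ), k ≤ n →
      ∀ (X : Type u) [TopologicalSpace X] [T2Space X] [SecondCountableTopology X]
        [ChartedSpace (CInf.Rnk n k) X] [IsManifold (CInf.modelRnk n k) ∞ X],
        CInf.IsVectorBundle n (CInf.cot (CInf.manSpec (CInf.modelRnk n k) X)) ∧
        ∃ i : CInf.CSpace.Iso (CInf.manSpace (CInf.modelRnk n k) X)
            (CInf.manSpec (CInf.modelRnk n k) X),
          (∀ x : X, i.base x = CInf.manEval (CInf.modelRnk n k) X x) ∧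
          (∀ (V : TopologicalSpace.Opens (CInf.manSpec (CInf.modelRnk n k) X).carrier)
            (f : CInf.manFn (CInf.modelRnk n k) X),
            i.sec V (CInf.Spec.fn V f) =
              CInf.manFn.restrict (CInf.modelRnk n k) f (CInf.preimageOpens i.base V)) ∧
          ∃ β : CInf.PreMod.IsoOver i (CInf.manCot (CInf.modelRnk n k) X)
              (CInf.cot (CInf.manSpec (CInf.modelRnk n k) X)),
            ∀ (V : TopologicalSpace.Opens (CInf.manSpec (CInf.modelRnk n k) X).carrier)
              (f : CInf.manFn (CInf.modelRnk n k) X)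
              (x : X) (hx : x ∈ CInf.preimageOpens i.base V),
              CInf.manCot.val (β.app V (CInf.cot.d (CInf.Spec.fn V f))) ⟨x, hx⟩ =
                mfderiv (CInf.modelRnk n k) 𝓘(ℝ, ℝ) f.1 x) ∧
    (∀ (n k : ℕ), k ≤ n →
      ∃ θ : CInf.PreMod.Iso
          (CInf.cot (CInf.manSpec (CInf.modelRnk n k) (CInf.Rnk n k)))
          (CInf.tensorVec (CInf.manSpec (CInf.modelRnk n k) (CInf.Rnk n k))
            (EuclideanSpace ℝ (Fin n) →L[ℝ] ℝ)),
        ∀ (U : TopologicalSpace.Opens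
            (CInf.manSpec (CInf.modelRnk n k) (CInf.Rnk n k)).carrier)
          (l : EuclideanSpace ℝ (Fin n) →L[ℝ] ℝ),
          θ.app U (CInf.cot.d (CInf.Spec.fn U (CInf.linearFn l))) = CInf.tensorVec.of U l) := by
  refine ⟨fun C _ _ => ⟨CInf.cotSpecIso C, CInf.cotSpecIso_d⟩,
    fun X h => ⟨h.cotPre_isSheaf, h.cotPre_isSheaf.toSheafify_bijective⟩,
    fun X h => h.isCoherent_cot, fun n k _ X _ _ _ _ _ => ?_, fun n k _ => ?_⟩
  -- Local compactness and second countability together make `X` σ-compact, which provides the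
  -- proper function in `manEval_surjective`.
  · have := Manifold.locallyCompact_of_finiteDimensional (M := X) (CInf.modelRnk n k)
    have H (x : X) : ∃ (t : Fin n → CInf.manFn (CInf.modelRnk n k) X)
        (U : TopologicalSpace.Opens X), x ∈ U ∧ CInf.IsCoordinates t (U : Set X) :=
      let ⟨t, U, hU, hx, ht⟩ := CInf.exists_isCoordinates x
      ⟨t, ⟨U, hU⟩, hx, ht⟩
    refine ⟨CInf.isVectorBundle_cot_manSpec H, CInf.manIso (CInf.modelRnk n k) X,
      CInf.manIso_base _ X, CInf.manIso_sec_fn _ X, CInf.manCotIso fun x => ⟨n, H x⟩,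
      fun V f x hx => ?_⟩
    exact (congrArg (fun s : CInf.cotSections (CInf.modelRnk n k)
        (CInf.preimageOpens (CInf.manHomeo (CInf.modelRnk n k) X) V) => s.1 ⟨x, hx⟩)
      (CInf.manCotIso_d _ V f)).trans (CInf.manDiff_restrict_apply f ⟨x, hx⟩)
  · have := Manifold.locallyCompact_of_finiteDimensional (M := CInf.Rnk n k) (CInf.modelRnk n k)
    exact ⟨CInf.cotRnkIso n k, CInf.cotRnkIso_d⟩
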